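/- Let $q$ be a real number with $q\neq 0,\pm1$, put $\nu=q-q^{-1}$, let $U_q(\mathfrak{sl}_3)$ be the Drinfeld--Jimbo algebra with generators $E_i,F_i,K_i^{\pm1}$ ($i=1,2$) and coproduct $\Delta(E_i)=E_i\otimes K_i+1\otimes E_i$, $\Delta(F_i)=F_i\otimes 1+K_i^{-1}\otimes F_i$, $\Delta(K_i)=K_i\otimes K_i$, let $A=\mathcal O_q(\mathrm{SU}_3)$ be the dual quantum coordinate $*$-algebra, generated by the matrix coefficients $u_{ij}$ of the vector representation, and let $B=\mathcal O_q(\mathrm F_3)\subseteq A$ be the full quantum flag manifold, that is the subalgebra of elements $b$ with $b_{(1)}\langle b_{(2)},X\rangle=\varepsilon(X)b$ for all $X$ in the algebra generated by $K_1^{\pm1},K_2^{\pm1}$. Consider the elements $$E_{\alpha_1}=E_1,\quad E_{\alpha_2}=E_2,\quad E_{\alpha_1+\alpha_2}=E_2E_1-q^{-1}E_1E_2,$$ $$F_{\alpha_1}=K_1F_1,\quad F_{\alpha_2}=K_2F_2,\quad F_{\alpha_1+\alpha_2}=q^{-1}K_1K_2(F_1F_2-q^{-1}F_2F_1)$$ of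 $U_q(\mathfrak{sl}_3)$, and let $T$ be their span. Let $\Lambda^1=A^+/I$ with $A^+=\ker\varepsilon$ and $I=\{y\in A^+ : X(y)=0\text{ for all }X\in T\}$, and let $\{e_\gamma,f_\gamma : \gamma\in\{\alpha_1,\alpha_2,\alpha_1+\alpha_2\}\}$ be the basis of $\Lambda^1$ dual to the basis $\{E_\gamma,F_\gamma\}$ of $T$. Let $\Omega^1_q(\mathrm{SU}_3)=A\otimes\Lambda^1$ be the left $A$-covariant first-order differential calculus of $T$, with $(a\otimes v)b=ab_{(1)}\otimes vb_{(2)}$ and $\mathrm d a=a_{(1)}\otimes[a_{(2)}-\varepsilon(a_{(2)})1]$, let $\Omega^1_q(\mathrm F_3)=\mathrm{span}\{b\,\mathrm d b' : b,b'\in B\}$ be its restriction to $B$, and let $V^1=\Omega^1_q(\mathrm F_3)/B^+\Omega^1_q(\mathrm F_3)$, $B^+=B\cap\ker\varepsilon$, be the cotangent space of $\Omega^1_q(\mathrm F_3)$. Then $\Omega^1_q(\mathrm F_3)$ carries a unique $*$-structure, that is, a conjugate-linear involution with $(\mathrm d b)^*=\mathrm d(b^*)$, $(b\omega)^*=\omega^*b^*$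 and $(\omega b)^*=b^*\omega^*$, and the map $V^1\to\Lambda^1$, $[b\,\mathrm d b']\mapsto\varepsilon(b)[b'-\varepsilon(b')1]$, is bijective; identify $V^1$ with $\Lambda^1$ by means of it. A left $A$-covariant first-order almost complex structure is a decomposition $\Omega^1_q(\mathrm F_3)=\Omega^{(1,0)}\oplus\Omega^{(0,1)}$ into $B$-subbimodules that are also left $A$-subcomodules, such that $(\Omega^{(1,0)})^*=\Omega^{(0,1)}$; its opposite is obtained by exchanging the two summands. The calculus $\Omega^1_q(\mathrm F_3)$ admits exactly four left $A$-covariant first-order almost complex structures, and exactly two up to identification of opposite structures. They are the structures with associated decompositions of $V^1$ $$V^{(1,0)}=\mathrm{span}_{\mathbb C}\{e_{\alpha_1},e_{\alpha_2},e_{\alpha_1+\alpha_2}\},\qquad V^{(0,1)}=\mathrm{span}_{\mathbb C}\{f_{\alpha_1},f_{\alpha_2},f_{\alpha_1+\alpha_2}\},$$ and $$V^{(1,0)}=\mathrm{span}_{\mathbb C}\{e_{\alpha_1},f_{\alpha_2},e_{\alpha_1+\alpha_2}\},\qquad V^{(0,1)}=\mathrm{span}_{\mathbb C}\{f_{\alpha_1},e_{\alpha_2},f_{\alpha_1+\alpha_2}\},$$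 together with their opposites. -/

import Mathlib

open scoped TensorProduct ComplexConjugate
open WithConv

noncomputable section

/-- The deformation parameter: a real number `q` different from `0`, `1` and `-1`. -/
structure DefParam where
  val : ℝ
  ne_zero : val ≠ 0
  ne_one : val ≠ 1
  ne_neg_one : val ≠ -1

namespace DefParam

/-- The parameter as a complex number. -/
def c (q : DefParam) : ℂ := (q.val : ℂ)

theorem c_ne_zero (q : DefParam) : q.c ≠ 0 := by
  simpa [c] using q.ne_zero

theorem c_sub_inv_ne_zero (q : DefParam) : q.c - q.c⁻¹ ≠ 0 := by
  have h0 := q.ne_zero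
  have h1 := q.ne_one
  have h2 := q.ne_neg_one
  have key : q.val - q.val⁻¹ ≠ 0 := by
    intro h
    field_simp at h
    rcases mul_self_eq_one_iff.mp (by linarith : q.val * q.val = 1) with h | h
    · exact h1 h
    · exact h2 h
  have : q.c - q.c⁻¹ = ((q.val - q.val⁻¹ : ℝ) : ℂ) := by simp [c]
  rw [this]
  exact_mod_cast key

@[simp] theorem conj_c (q : DefParam) : conj q.c = q.c := Complex.conj_ofReal _

end DefParam

/-! ### The quantised enveloping algebra `U_q(sl_3)` -/

/-- Generators of `U_q(sl_3)`; the indices `0, 1` stand for the simple roots `α₁, α₂`. -/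
inductive UGen : Type
  | E (i : Fin 2)
  | F (i : Fin 2)
  | K (i : Fin 2)
  | Kinv (i : Fin 2)

/-- The Cartan matrix of `sl_3`. -/
def cartanA2 (i j : Fin 2) : ℤ := if i = j then 2 else -1

namespace UGen

/-- The generator `E_i` of the free algebra. -/
abbrev e (i : Fin 2) : FreeAlgebra ℂ UGen := FreeAlgebra.ι ℂ (E i)
/-- The generator `F_i` of the free algebra. -/
abbrev f (i : Fin 2) : FreeAlgebra ℂ UGen := FreeAlgebra.ι ℂ (F i)
/-- The generator `K_i` of the free algebra. -/
abbrev k (i : Fin 2) : FreeAlgebra ℂ UGen := FreeAlgebra.ι ℂ (K i)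
/-- The generator `K_i⁻¹` of the free algebra. -/
abbrev k' (i : Fin 2) : FreeAlgebra ℂ UGen := FreeAlgebra.ι ℂ (Kinv i)

end UGen

open UGen in
/-- The defining relations of `U_q(sl_3)`. -/
inductive URel (q : DefParam) : FreeAlgebra ℂ UGen → FreeAlgebra ℂ UGen → Prop
  | K_Kinv (i) : URel q (k i * k' i) 1
  | Kinv_K (i) : URel q (k' i * k i) 1
  | K_K (i j) : URel q (k i * k j) (k j * k i)
  | K_E (i j) : URel q (k i * e j) (q.c ^ cartanA2 i j • (e j * k i))
  | K_F (i j) : URel q (k i * f j) (q.c ^ (-cartanA2 i j) • (f j * k i))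
  | E_F (i j) : URel q (e i * f j - f j * e i)
      (if i = j then (q.c - q.c⁻¹)⁻¹ • (k i - k' i) else 0)
  | serreE (i j) (h : i ≠ j) : URel q
      (e i * e i * e j - (q.c + q.c⁻¹) • (e i * e j * e i) + e j * e i * e i) 0
  | serreF (i j) (h : i ≠ j) : URel q
      (f i * f i * f j - (q.c + q.c⁻¹) • (f i * f j * f i) + f j * f i * f i) 0

/-- The quantised enveloping algebra `U_q(sl_3)`. -/
def Uq (q : DefParam) : Type := RingQuot (URel q)

namespace Uq

variable {q : DefParam}

instance : Ring (Uq q) := inferInstanceAs (Ring (RingQuot (URel q)))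
instance : Algebra ℂ (Uq q) := inferInstanceAs (Algebra ℂ (RingQuot (URel q)))

variable (q) in
/-- The projection of the free algebra onto `U_q(sl_3)`. -/
def mk : FreeAlgebra ℂ UGen →ₐ[ℂ] Uq q := RingQuot.mkAlgHom ℂ (URel q)

/-- The generators `E_i`. -/
def E (i : Fin 2) : Uq q := mk q (UGen.e i)
/-- The generators `F_i`. -/
def F (i : Fin 2) : Uq q := mk q (UGen.f i)
/-- The generators `K_i`. -/
def K (i : Fin 2) : Uq q := mk q (UGen.k i)
/-- The generators `K_i⁻¹`. -/
def Kinv (i : Fin 2) : Uq q := mk q (UGen.k' i)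

theorem mk_rel {x y : FreeAlgebra ℂ UGen} (h : URel q x y) : mk q x = mk q y :=
  RingQuot.mkAlgHom_rel ℂ h

theorem K_mul_Kinv (i : Fin 2) : (K i * Kinv i : Uq q) = 1 := by
  simpa [K, Kinv] using mk_rel (URel.K_Kinv (q := q) i)

theorem Kinv_mul_K (i : Fin 2) : (Kinv i * K i : Uq q) = 1 := by
  simpa [K, Kinv] using mk_rel (URel.Kinv_K (q := q) i)

theorem K_mul_K (i j : Fin 2) : (K i * K j : Uq q) = K j * K i := by
  simpa [K] using mk_rel (URel.K_K (q := q) i j)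

theorem K_mul_E (i j : Fin 2) : (K i * E j : Uq q) = q.c ^ cartanA2 i j • (E j * K i) := by
  simpa [K, E] using mk_rel (URel.K_E (q := q) i j)

theorem K_mul_F (i j : Fin 2) : (K i * F j : Uq q) = q.c ^ (-cartanA2 i j) • (F j * K i) := by
  simpa [K, F] using mk_rel (URel.K_F (q := q) i j)

theorem E_mul_F (i j : Fin 2) : (E i * F j - F j * E i : Uq q) =
    if i = j then (q.c - q.c⁻¹)⁻¹ • (K i - Kinv i) else 0 := by
  have := mk_rel (URel.E_F (q := q) i j)
  split_ifs at this ⊢ <;> simpa [K, Kinv, E, F] using this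

theorem serreE (i j : Fin 2) (h : i ≠ j) :
    (E i * E i * E j - (q.c + q.c⁻¹) • (E i * E j * E i) + E j * E i * E i : Uq q) = 0 := by
  simpa [E] using mk_rel (URel.serreE (q := q) i j h)

theorem serreF (i j : Fin 2) (h : i ≠ j) :
    (F i * F i * F j - (q.c + q.c⁻¹) • (F i * F j * F i) + F j * F i * F i : Uq q) = 0 := by
  simpa [F] using mk_rel (URel.serreF (q := q) i j h)

/-- `K_i^{-1}` commutes past elements of weight `c` under `K_i`. -/
theorem Kinv_mul_of {i : Fin 2} {x : Uq q} {c : ℂ} (hc : c ≠ 0) (h : K i * x = c • (x * K i)) :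
    Kinv i * x = c⁻¹ • (x * Kinv i) := by
  have h2 : x * Kinv i = c • (Kinv i * x) := by
    calc x * Kinv i = (Kinv i * K i) * x * Kinv i := by rw [Kinv_mul_K, one_mul]
      _ = Kinv i * (K i * x) * Kinv i := by noncomm_ring
      _ = c • (Kinv i * x * (K i * Kinv i)) := by rw [h]; simp [mul_assoc]
      _ = _ := by rw [K_mul_Kinv, mul_one]
  rw [h2, smul_smul, inv_mul_cancel₀ hc, one_smul]

theorem Kinv_mul_E (i j : Fin 2) :
    (Kinv i * E j : Uq q) = q.c ^ (-cartanA2 i j) • (E j * Kinv i) := by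
  rw [Kinv_mul_of (zpow_ne_zero _ q.c_ne_zero) (K_mul_E i j), zpow_neg]

theorem Kinv_mul_F (i j : Fin 2) :
    (Kinv i * F j : Uq q) = q.c ^ cartanA2 i j • (F j * Kinv i) := by
  rw [Kinv_mul_of (zpow_ne_zero _ q.c_ne_zero) (K_mul_F i j), zpow_neg, inv_inv]

theorem Kinv_mul_K' (i j : Fin 2) : (Kinv i * K j : Uq q) = K j * Kinv i := by
  have := Kinv_mul_of (q := q) (i := i) (x := K j) (c := 1) one_ne_zero (by simp [K_mul_K i j])
  simpa using this

theorem Kinv_mul_Kinv (i j : Fin 2) : (Kinv i * Kinv j : Uq q) = Kinv j * Kinv i := by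
  have := Kinv_mul_of (q := q) (i := i) (x := Kinv j) (c := 1) one_ne_zero
    (by simp [Kinv_mul_K' j i])
  simpa using this

/-- A family of elements of an algebra that satisfies the defining relations. -/
structure IsRep (q : DefParam) {R : Type*} [Ring R] [Algebra ℂ R] (g : UGen → R) : Prop where
  K_Kinv : ∀ i, g (.K i) * g (.Kinv i) = 1
  Kinv_K : ∀ i, g (.Kinv i) * g (.K i) = 1
  K_K : ∀ i j, g (.K i) * g (.K j) = g (.K j) * g (.K i)
  K_E : ∀ i j, g (.K i) * g (.E j) = q.c ^ cartanA2 i j • (g (.E j) * g (.K i))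
  K_F : ∀ i j, g (.K i) * g (.F j) = q.c ^ (-cartanA2 i j) • (g (.F j) * g (.K i))
  E_F : ∀ i j, g (.E i) * g (.F j) - g (.F j) * g (.E i) =
    if i = j then (q.c - q.c⁻¹)⁻¹ • (g (.K i) - g (.Kinv i)) else 0
  serreE : ∀ i j, i ≠ j → g (.E i) * g (.E i) * g (.E j)
    - (q.c + q.c⁻¹) • (g (.E i) * g (.E j) * g (.E i)) + g (.E j) * g (.E i) * g (.E i) = 0
  serreF : ∀ i j, i ≠ j → g (.F i) * g (.F i) * g (.F j)
    - (q.c + q.c⁻¹) • (g (.F i) * g (.F j) * g (.F i)) + g (.F j) * g (.F i) * g (.F i) = 0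

section lift

variable {R : Type*} [Ring R] [Algebra ℂ R] {g : UGen → R}

/-- The algebra homomorphism out of `U_q(sl_3)` with given values on the generators. -/
def lift (h : IsRep q g) : Uq q →ₐ[ℂ] R :=
  RingQuot.liftAlgHom ℂ ⟨FreeAlgebra.lift ℂ g, by
    intro x y hxy
    induction hxy with
    | K_Kinv i => simpa using h.K_Kinv i
    | Kinv_K i => simpa using h.Kinv_K i
    | K_K i j => simpa using h.K_K i j
    | K_E i j => simpa using h.K_E i j
    | K_F i j => simpa using h.K_F i j
    | E_F i j =>
      have := h.E_F i j
      split_ifs at this ⊢ <;> simpa using this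
    | serreE i j hij => simpa using h.serreE i j hij
    | serreF i j hij => simpa using h.serreF i j hij⟩

theorem lift_mk (h : IsRep q g) (x : FreeAlgebra ℂ UGen) :
    lift h (mk q x) = FreeAlgebra.lift ℂ g x :=
  RingQuot.liftAlgHom_mkAlgHom_apply ℂ _ _ _

@[simp] theorem lift_E (h : IsRep q g) (i : Fin 2) : lift h (E i) = g (.E i) := by
  simp [E, lift_mk]
@[simp] theorem lift_F (h : IsRep q g) (i : Fin 2) : lift h (F i) = g (.F i) := by
  simp [F, lift_mk]
@[simp] theorem lift_K (h : IsRep q g) (i : Fin 2) : lift h (K i) = g (.K i) := by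
  simp [K, lift_mk]
@[simp] theorem lift_Kinv (h : IsRep q g) (i : Fin 2) : lift h (Kinv i) = g (.Kinv i) := by
  simp [Kinv, lift_mk]

/-- Algebra homomorphisms out of `U_q(sl_3)` are determined by their values on generators. -/
theorem algHom_ext {φ ψ : Uq q →ₐ[ℂ] R} (hE : ∀ i, φ (E i) = ψ (E i))
    (hF : ∀ i, φ (F i) = ψ (F i)) (hK : ∀ i, φ (K i) = ψ (K i))
    (hKi : ∀ i, φ (Kinv i) = ψ (Kinv i)) : φ = ψ := by
  apply RingQuot.ringQuot_ext'
  apply FreeAlgebra.hom_ext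
  funext x
  cases x with
  | E i => exact hE i
  | F i => exact hF i
  | K i => exact hK i
  | Kinv i => exact hKi i

end lift

/-- The `q`-Serre relation for sums of `q`-commuting elements. -/
theorem serre_add {R : Type*} [Ring R] [Algebra ℂ R] {p : ℂ} (hp : p ≠ 0) {x x' y y' : R}
    (h1 : x' * x = p⁻¹ ^ 2 • (x * x')) (h2 : x' * y = p • (y * x')) (h3 : y' * x = p • (x * y'))
    (h : x * x * y - (p + p⁻¹) • (x * y * x) + y * x * x = 0)
    (h' : x' * x' * y' - (p + p⁻¹) • (x' * y' * x') + y' * x' * x' = 0) :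
    (x + x') * (x + x') * (y + y') - (p + p⁻¹) • ((x + x') * (y + y') * (x + x'))
      + (y + y') * (x + x') * (x + x') = 0 := by
  have h1' : ∀ z, x' * (x * z) = p⁻¹ ^ 2 • (x * (x' * z)) := fun z => by
    rw [← mul_assoc, h1, smul_mul_assoc, mul_assoc]
  have h2' : ∀ z, x' * (y * z) = p • (y * (x' * z)) := fun z => by
    rw [← mul_assoc, h2, smul_mul_assoc, mul_assoc]
  have h3' : ∀ z, y' * (x * z) = p • (x * (y' * z)) := fun z => by
    rw [← mul_assoc, h3, smul_mul_assoc, mul_assoc]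
  have hs := congrArg₂ (· + ·) h h'
  simp only [add_zero] at hs
  rw [← hs]
  simp only [mul_add, add_mul, mul_assoc, h1, h2, h3, h1', h2', h3', mul_smul_comm, smul_mul_assoc, smul_smul,
    smul_add]
  match_scalars <;> field_simp <;> ring

end Uq
end

noncomputable section
namespace Uq

variable {q : DefParam}

/-! ### The coalgebra structure of `U_q(sl_3)` -/

variable (q) in
/-- The coproduct on generators. -/
def comulGen : UGen → Uq q ⊗[ℂ] Uq q
  | .E i => E i ⊗ₜ K i + 1 ⊗ₜ E i
  | .F i => F i ⊗ₜ 1 + Kinv i ⊗ₜ F i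
  | .K i => K i ⊗ₜ K i
  | .Kinv i => Kinv i ⊗ₜ Kinv i

variable (q) in
/-- The counit on generators. -/
def counitGen : UGen → ℂ
  | .E _ => 0
  | .F _ => 0
  | .K _ => 1
  | .Kinv _ => 1

theorem cartanA2_symm (i j : Fin 2) : cartanA2 i j = cartanA2 j i := by
  simp [cartanA2, eq_comm]

theorem isRep_comulGen : IsRep q (comulGen q) where
  K_Kinv i := by simp [comulGen, K_mul_Kinv, Algebra.TensorProduct.one_def]
  Kinv_K i := by simp [comulGen, Kinv_mul_K, Algebra.TensorProduct.one_def]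
  K_K i j := by simp [comulGen, K_mul_K i j]
  K_E i j := by
    simp only [comulGen, mul_add, add_mul, Algebra.TensorProduct.tmul_mul_tmul, K_mul_E, K_mul_K i j,
      one_mul, mul_one, smul_add, TensorProduct.smul_tmul', TensorProduct.tmul_smul]
  K_F i j := by
    simp only [comulGen, mul_add, add_mul, Algebra.TensorProduct.tmul_mul_tmul, K_mul_F,
      Kinv_mul_K', one_mul, mul_one, smul_add, TensorProduct.smul_tmul', TensorProduct.tmul_smul]
  E_F i j := by
    have h1 : (comulGen q (.E i) * comulGen q (.F j) - comulGen q (.F j) * comulGen q (.E i)) =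
        (E i * F j - F j * E i) ⊗ₜ K i + Kinv j ⊗ₜ (E i * F j - F j * E i) := by
      have hc : q.c ^ cartanA2 i j * q.c ^ (-cartanA2 i j) = 1 := by
        rw [← zpow_add₀ q.c_ne_zero]; simp
      simp only [comulGen, mul_add, add_mul, Algebra.TensorProduct.tmul_mul_tmul, K_mul_F,
        Kinv_mul_E, one_mul, mul_one, TensorProduct.sub_tmul, TensorProduct.tmul_sub,
        TensorProduct.tmul_smul, TensorProduct.smul_tmul', cartanA2_symm j i]
      abel
    rw [h1, E_mul_F]
    split_ifs with h
    · subst h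
      simp only [comulGen, ← TensorProduct.smul_tmul', TensorProduct.tmul_smul,
        TensorProduct.sub_tmul, TensorProduct.tmul_sub, ← smul_add]
      congr 1
      abel
    · simp
  serreE i j h := by
    have hc : cartanA2 i j = -1 := by simp [cartanA2, h]
    have hc' : cartanA2 j i = -1 := by simp [cartanA2, h.symm]
    have hc2 : cartanA2 i i = 2 := by simp [cartanA2]
    have hq := q.c_ne_zero
    apply serre_add hq
    · simp only [Algebra.TensorProduct.tmul_mul_tmul, K_mul_E, one_mul, mul_one, hc2,
        TensorProduct.tmul_smul, smul_smul]
      rw [show q.c⁻¹ ^ 2 * q.c ^ (2 : ℤ) = 1 by field_simp]; simp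
    · simp only [Algebra.TensorProduct.tmul_mul_tmul, K_mul_E, one_mul, mul_one, hc',
        TensorProduct.tmul_smul, smul_smul]
      rw [show q.c * q.c ^ (-1 : ℤ) = 1 by simp [hq]]; simp
    · simp only [Algebra.TensorProduct.tmul_mul_tmul, K_mul_E, one_mul, mul_one, hc,
        TensorProduct.tmul_smul, smul_smul]
      rw [show q.c * q.c ^ (-1 : ℤ) = 1 by simp [hq]]; simp
    · have e1 := serreE (q := q) i j h
      have e2 : (K i * K i * K j : Uq q) = K i * K j * K i := 
        (mul_assoc _ _ _).trans ((congrArg _ (K_mul_K i j)).trans (mul_assoc _ _ _).symm)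
      have e3 : (K j * K i * K i : Uq q) = K i * K j * K i := by rw [K_mul_K j i]
      simp only [Algebra.TensorProduct.tmul_mul_tmul, e2, e3, TensorProduct.smul_tmul',
        ← TensorProduct.sub_tmul, ← TensorProduct.add_tmul, e1, TensorProduct.zero_tmul]
    · have e1 := serreE (q := q) i j h
      simp only [Algebra.TensorProduct.tmul_mul_tmul, one_mul, ← TensorProduct.tmul_smul,
        ← TensorProduct.tmul_sub, ← TensorProduct.tmul_add, e1, TensorProduct.tmul_zero]
  serreF i j h := by
    have hc : cartanA2 i j = -1 := by simp [cartanA2, h]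
    have hc' : cartanA2 j i = -1 := by simp [cartanA2, h.symm]
    have hc2 : cartanA2 i i = 2 := by simp [cartanA2]
    have hq := q.c_ne_zero
    rw [show q.c + q.c⁻¹ = q.c⁻¹ + q.c⁻¹⁻¹ by rw [inv_inv, add_comm]]
    apply serre_add (inv_ne_zero hq)
    · simp only [Algebra.TensorProduct.tmul_mul_tmul, Kinv_mul_F, one_mul, mul_one, hc2, inv_inv,
        ← TensorProduct.smul_tmul']
      norm_cast
    · simp [Kinv_mul_F, hc, ← TensorProduct.smul_tmul']
    · simp [Kinv_mul_F, hc', ← TensorProduct.smul_tmul']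
    · have e1 := serreF (q := q) i j h
      rw [inv_inv, add_comm q.c⁻¹]
      simp only [Algebra.TensorProduct.tmul_mul_tmul, one_mul, TensorProduct.smul_tmul',
        ← TensorProduct.sub_tmul, ← TensorProduct.add_tmul, e1, TensorProduct.zero_tmul]
    · have e1 := serreF (q := q) i j h
      rw [inv_inv, add_comm q.c⁻¹]
      have e2 : (Kinv i * Kinv i * Kinv j : Uq q) = Kinv i * Kinv j * Kinv i := 
        (mul_assoc _ _ _).trans ((congrArg _ (Kinv_mul_Kinv i j)).trans (mul_assoc _ _ _).symm)
      have e3 : (Kinv j * Kinv i * Kinv i : Uq q) = Kinv i * Kinv j * Kinv i := by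
        rw [Kinv_mul_Kinv j i]
      simp only [Algebra.TensorProduct.tmul_mul_tmul, e2, e3, ← TensorProduct.tmul_smul,
        ← TensorProduct.tmul_sub, ← TensorProduct.tmul_add, e1, TensorProduct.tmul_zero]

theorem isRep_counitGen : IsRep q counitGen := by
  constructor <;> intros <;> simp [counitGen]

/-- `U_q(sl_3)` as a bialgebra, with `Δ(E_i) = E_i ⊗ K_i + 1 ⊗ E_i`,
`Δ(F_i) = F_i ⊗ 1 + K_i⁻¹ ⊗ F_i`, `Δ(K_i) = K_i ⊗ K_i`, `ε(E_i) = ε(F_i) = 0`, `ε(K_i) = 1`. -/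
instance : Bialgebra ℂ (Uq q) :=
  Bialgebra.ofAlgHom (lift isRep_comulGen) (lift isRep_counitGen)
    (by
      apply algHom_ext <;> intro i <;>
        simp [comulGen, TensorProduct.tmul_add, TensorProduct.add_tmul,
          Algebra.TensorProduct.one_def, add_assoc])
    (by
      apply algHom_ext <;> intro i <;> simp [comulGen, counitGen])
    (by
      apply algHom_ext <;> intro i <;> simp [comulGen, counitGen])

theorem comul_eq (x : Uq q) : Coalgebra.comul (R := ℂ) x = lift isRep_comulGen x := rfl
theorem counit_eq (x : Uq q) : Coalgebra.counit (R := ℂ) x = lift isRep_counitGen x := rfl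

@[simp] theorem comul_E (i : Fin 2) :
    Coalgebra.comul (R := ℂ) (E i : Uq q) = E i ⊗ₜ K i + 1 ⊗ₜ E i := by
  simp [comul_eq, comulGen]
@[simp] theorem comul_F (i : Fin 2) :
    Coalgebra.comul (R := ℂ) (F i : Uq q) = F i ⊗ₜ 1 + Kinv i ⊗ₜ F i := by
  simp [comul_eq, comulGen]
@[simp] theorem comul_K (i : Fin 2) :
    Coalgebra.comul (R := ℂ) (K i : Uq q) = K i ⊗ₜ K i := by
  simp [comul_eq, comulGen]
@[simp] theorem comul_Kinv (i : Fin 2) :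
    Coalgebra.comul (R := ℂ) (Kinv i : Uq q) = Kinv i ⊗ₜ Kinv i := by
  simp [comul_eq, comulGen]
@[simp] theorem counit_E (i : Fin 2) : Coalgebra.counit (R := ℂ) (E i : Uq q) = 0 := by
  simp [counit_eq, counitGen]
@[simp] theorem counit_F (i : Fin 2) : Coalgebra.counit (R := ℂ) (F i : Uq q) = 0 := by
  simp [counit_eq, counitGen]
@[simp] theorem counit_K (i : Fin 2) : Coalgebra.counit (R := ℂ) (K i : Uq q) = 1 := by
  simp [counit_eq, counitGen]
@[simp] theorem counit_Kinv (i : Fin 2) : Coalgebra.counit (R := ℂ) (Kinv i : Uq q) = 1 := by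
  simp [counit_eq, counitGen]

/-! ### The vector representation -/

variable (q) in
/-- The vector representation on generators: `ρ(E_1) = e_{21}`, `ρ(E_2) = e_{32}`,
`ρ(F_1) = e_{12}`, `ρ(F_2) = e_{23}`, `ρ(K_i)_{jj} = q^{δ_{i,j-1} - δ_{i,j}}`. -/
def vecGen : UGen → Matrix (Fin 3) (Fin 3) ℂ
  | .E i => Matrix.single i.succ i.castSucc 1
  | .F i => Matrix.single i.castSucc i.succ 1
  | .K i => Matrix.diagonal fun j =>
      if j = i.succ then q.c else if j = i.castSucc then q.c⁻¹ else 1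
  | .Kinv i => Matrix.diagonal fun j =>
      if j = i.succ then q.c⁻¹ else if j = i.castSucc then q.c else 1

theorem isRep_vecGen : IsRep q (vecGen q) := by
  have hq := q.c_ne_zero
  have hq' := q.c_sub_inv_ne_zero
  constructor
  · intro i; fin_cases i <;> ext a b <;> fin_cases a <;> fin_cases b <;> simp [vecGen, hq]
  · intro i; fin_cases i <;> ext a b <;> fin_cases a <;> fin_cases b <;> simp [vecGen, hq]
  · intro i j; simp [vecGen, mul_comm]
  · intro i j
    fin_cases i <;> fin_cases j <;> ext a b <;> fin_cases a <;> fin_cases b <;>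
      simp [vecGen, cartanA2, Matrix.single, hq] <;> field_simp
  · intro i j
    fin_cases i <;> fin_cases j <;> ext a b <;> fin_cases a <;> fin_cases b <;>
      simp [vecGen, cartanA2, Matrix.single, hq] <;> field_simp
  · intro i j
    fin_cases i <;> fin_cases j <;> ext a b <;> fin_cases a <;> fin_cases b <;>
      simp [vecGen, Matrix.single, Matrix.mul_apply] <;> grind
  · intro i j h
    fin_cases i <;> fin_cases j <;> ext a b <;> fin_cases a <;> fin_cases b <;>
      simp [vecGen, Matrix.single, Matrix.mul_apply] at h ⊢
  · intro i j h
    fin_cases i <;> fin_cases j <;> ext a b <;> fin_cases a <;> fin_cases b <;>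
      simp [vecGen, Matrix.single, Matrix.mul_apply] at h ⊢

variable (q) in
/-- The vector representation of `U_q(sl_3)`. -/
def vecRep : Uq q →ₐ[ℂ] Matrix (Fin 3) (Fin 3) ℂ := lift isRep_vecGen

end Uq
end

noncomputable section

/-! ### Conjugate-linear algebra maps -/

/-- A complex algebra with the conjugate scalar multiplication. -/
def ConjAlg (R : Type*) : Type _ := R

namespace ConjAlg

variable {R : Type*} [Ring R] [Algebra ℂ R]

instance : Ring (ConjAlg R) := inferInstanceAs (Ring R)

instance : Algebra ℂ (ConjAlg R) where
  smul c x := @HSMul.hSMul ℂ R R _ (conj c) x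
  algebraMap := (algebraMap ℂ R).comp (starRingEnd ℂ)
  commutes' c x := Algebra.commutes (R := ℂ) (A := R) (conj c) x
  smul_def' c x := Algebra.smul_def (R := ℂ) (A := R) (conj c) x

end ConjAlg

namespace Uq

variable {q : DefParam}

variable (q) in
/-- The values on generators of the conjugate-linear map `theta`. -/
def thetaGen : UGen → Uq q
  | .E i => -(q.c • F i)
  | .F i => -(q.c⁻¹ • E i)
  | .K i => Kinv i
  | .Kinv i => K i

theorem isRep_thetaGen : IsRep q (thetaGen q) where
  K_Kinv i := Kinv_mul_K i
  Kinv_K i := K_mul_Kinv i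
  K_K i j := Kinv_mul_Kinv i j
  K_E i j := by simp [thetaGen, Kinv_mul_F, smul_smul, mul_comm]
  K_F i j := by simp [thetaGen, Kinv_mul_E, smul_smul, mul_comm]
  E_F i j := by
    have hq := q.c_ne_zero
    have h := E_mul_F (q := q) j i
    have h2 : (-(q.c • F i) * -(q.c⁻¹ • E j) - -(q.c⁻¹ • E j) * -(q.c • F i) : Uq q)
        = -(E j * F i - F i * E j) := by
      simp [smul_smul, hq]
    simp only [thetaGen]
    rw [h2, h]
    by_cases hij : i = j
    · subst hij
      simp [← smul_neg]
    · simp [hij, Ne.symm hij]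
  serreE i j h := by
    have e := serreF (q := q) i j h
    have : (-(q.c • F i) * -(q.c • F i) * -(q.c • F j)
      - (q.c + q.c⁻¹) • (-(q.c • F i) * -(q.c • F j) * -(q.c • F i))
      + -(q.c • F j) * -(q.c • F i) * -(q.c • F i) : Uq q) = -(q.c ^ 3) •
      (F i * F i * F j - (q.c + q.c⁻¹) • (F i * F j * F i) + F j * F i * F i) := by
      simp only [neg_mul, mul_neg, smul_mul_assoc, mul_smul_comm]
      module
    simp only [thetaGen]
    rw [this, e, smul_zero]
  serreF i j h := by
    have e := serreE (q := q) i j h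
    have : (-(q.c⁻¹ • E i) * -(q.c⁻¹ • E i) * -(q.c⁻¹ • E j)
      - (q.c + q.c⁻¹) • (-(q.c⁻¹ • E i) * -(q.c⁻¹ • E j) * -(q.c⁻¹ • E i))
      + -(q.c⁻¹ • E j) * -(q.c⁻¹ • E i) * -(q.c⁻¹ • E i) : Uq q) = -(q.c⁻¹ ^ 3) •
      (E i * E i * E j - (q.c + q.c⁻¹) • (E i * E j * E i) + E j * E i * E i) := by
      simp only [neg_mul, mul_neg, smul_mul_assoc, mul_smul_comm]
      module
    simp only [thetaGen]
    rw [this, e, smul_zero]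

/-- Since `q` is real, a family satisfying the relations also satisfies them in the conjugate
algebra. -/
theorem IsRep.conj {R : Type*} [Ring R] [Algebra ℂ R] {g : UGen → R} (h : IsRep q g) :
    IsRep q (R := ConjAlg R) g where
  K_Kinv := h.K_Kinv
  Kinv_K := h.Kinv_K
  K_K := h.K_K
  K_E i j := by
    have := h.K_E i j
    rw [show q.c ^ cartanA2 i j = conj (q.c ^ cartanA2 i j) by simp [map_zpow₀]] at this
    exact this
  K_F i j := by
    have := h.K_F i j
    rw [show q.c ^ (-cartanA2 i j) = conj (q.c ^ (-cartanA2 i j)) by simp [map_zpow₀]] at this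
    exact this
  E_F i j := by
    have := h.E_F i j
    rw [show (q.c - q.c⁻¹)⁻¹ = conj ((q.c - q.c⁻¹)⁻¹) by simp] at this
    split_ifs at this ⊢ <;> exact this
  serreE i j hij := by
    have := h.serreE i j hij
    rw [show q.c + q.c⁻¹ = conj (q.c + q.c⁻¹) by simp] at this
    exact this
  serreF i j hij := by
    have := h.serreF i j hij
    rw [show q.c + q.c⁻¹ = conj (q.c + q.c⁻¹) by simp] at this
    exact this

variable (q) in
/-- The map `theta`, bundled as an algebra homomorphism into the conjugate algebra. -/
def thetaHom : Uq q →ₐ[ℂ] ConjAlg (Uq q) := lift isRep_thetaGen.conj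

variable (q) in
/-- The conjugate-linear multiplicative map `θ` of `U_q(sl_3)` with `θ(E_i) = -q F_i`,
`θ(F_i) = -q⁻¹ E_i`, `θ(K_i) = K_i⁻¹`. It describes the involution of `O_q(SU_3)`
by duality: `⟨X, a^*⟩ = conj ⟨θ(X), a⟩`. -/
def theta : Uq q →ₛₗ[starRingEnd ℂ] Uq q where
  toFun := thetaHom q
  map_add' := map_add (thetaHom q)
  map_smul' c x := map_smul (thetaHom q) c x

@[simp] theorem theta_mul (x y : Uq q) : theta q (x * y) = theta q x * theta q y :=
  map_mul (thetaHom q) x y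
@[simp] theorem theta_one : theta q 1 = 1 := map_one (thetaHom q)
@[simp] theorem theta_E (i : Fin 2) : theta q (E i) = -(q.c • F i) := lift_E isRep_thetaGen.conj i
@[simp] theorem theta_F (i : Fin 2) : theta q (F i) = -(q.c⁻¹ • E i) := lift_F isRep_thetaGen.conj i
@[simp] theorem theta_K (i : Fin 2) : theta q (K i) = Kinv i := lift_K isRep_thetaGen.conj i
@[simp] theorem theta_Kinv (i : Fin 2) : theta q (Kinv i) = K i := lift_Kinv isRep_thetaGen.conj i

/-- Induction on elements of `U_q(sl_3)`. -/
theorem induction {p : Uq q → Prop} (hs : ∀ c : ℂ, p (algebraMap ℂ _ c))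
    (hE : ∀ i, p (E i)) (hF : ∀ i, p (F i)) (hK : ∀ i, p (K i)) (hKi : ∀ i, p (Kinv i))
    (hm : ∀ x y, p x → p y → p (x * y)) (ha : ∀ x y, p x → p y → p (x + y)) (x : Uq q) : p x := by
  obtain ⟨y, rfl⟩ := RingQuot.mkAlgHom_surjective ℂ (URel q) x
  change p (mk q y)
  induction y using FreeAlgebra.induction with
  | grade0 c => rw [AlgHom.commutes]; exact hs c
  | grade1 g =>
    cases g with
    | E i => exact hE i
    | F i => exact hF i
    | K i => exact hK i
    | Kinv i => exact hKi i
  | mul a b h1 h2 => rw [map_mul]; exact hm _ _ h1 h2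
  | add a b h1 h2 => rw [map_add]; exact ha _ _ h1 h2

end Uq

/-! ### The convolution algebra of functionals on `U_q(sl_3)` -/

/-- The linear functionals on `U_q(sl_3)` with the convolution product
`(ab)(X) = a(X_(1)) b(X_(2))`. -/
abbrev UqDual (q : DefParam) : Type := WithConv (Uq q →ₗ[ℂ] ℂ)

namespace UqDual

open Uq

variable {q : DefParam}

variable (q) in
/-- The matrix coefficient `u_{ij}` of the vector representation. -/
def u (i j : Fin 3) : UqDual q :=
  toConv (Matrix.entryLinearMap ℂ ℂ i j ∘ₗ (vecRep q).toLinearMap)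

@[simp] theorem u_apply (i j : Fin 3) (X : Uq q) : u q i j X = vecRep q X i j := rfl

/-- The conjugate-linear map `a ↦ a^*`, `a^*(X) = conj (a(θ(X)))`. -/
def dualStar (a : UqDual q) : UqDual q :=
  toConv
    { toFun := fun X => conj (a (theta q X))
      map_add' := fun X Y => by simp
      map_smul' := fun c X => by simp }

@[simp] theorem dualStar_apply (a : UqDual q) (X : Uq q) :
    dualStar a X = conj (a (theta q X)) := rfl

theorem ext {a b : UqDual q} (h : ∀ X, a X = b X) : a = b :=
  WithConv.ext (LinearMap.ext h)

end UqDual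
end

noncomputable section

/-- Functoriality of the conjugate algebra. -/
def ConjAlg.map {R S : Type*} [Ring R] [Algebra ℂ R] [Ring S] [Algebra ℂ S] (φ : R →ₐ[ℂ] S) :
    ConjAlg R →ₐ[ℂ] ConjAlg S where
  toFun := φ
  map_one' := map_one φ
  map_mul' := map_mul φ
  map_zero' := map_zero φ
  map_add' := map_add φ
  commutes' c := φ.commutes (conj c)

namespace UqDual

open Uq

variable {q : DefParam}

variable (q) in
/-- The conjugate-linear map `θ ⊗ θ`, as an algebra homomorphism into the conjugate algebra. -/
def thetaTensor : Uq q ⊗[ℂ] Uq q →ₐ[ℂ] ConjAlg (Uq q ⊗[ℂ] Uq q) :=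
  Algebra.TensorProduct.lift
    ((ConjAlg.map Algebra.TensorProduct.includeLeft).comp (thetaHom q))
    ((ConjAlg.map Algebra.TensorProduct.includeRight).comp (thetaHom q))
    (fun x y => by
      change (theta q x ⊗ₜ[ℂ] (1 : Uq q)) * ((1 : Uq q) ⊗ₜ[ℂ] theta q y) =
        ((1 : Uq q) ⊗ₜ[ℂ] theta q y) * (theta q x ⊗ₜ[ℂ] (1 : Uq q))
      simp)

theorem thetaTensor_tmul (x y : Uq q) :
    thetaTensor q (x ⊗ₜ y) = (theta q x ⊗ₜ[ℂ] theta q y : Uq q ⊗[ℂ] Uq q) := by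
  rw [thetaTensor, Algebra.TensorProduct.lift_tmul]
  change (theta q x ⊗ₜ[ℂ] (1 : Uq q)) * ((1 : Uq q) ⊗ₜ[ℂ] theta q y) = _
  simp

theorem comul_theta (x : Uq q) : (Coalgebra.comul (R := ℂ) (theta q x) : Uq q ⊗[ℂ] Uq q) =
    thetaTensor q (TensorProduct.comm ℂ _ _ (Coalgebra.comul (R := ℂ) x)) := by
  have h : (ConjAlg.map (Bialgebra.comulAlgHom ℂ (Uq q))).comp (thetaHom q) =
      (thetaTensor q).comp
        ((Algebra.TensorProduct.comm ℂ (Uq q) (Uq q)).toAlgHom.comp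
          (Bialgebra.comulAlgHom ℂ (Uq q))) := by
    apply algHom_ext
    · intro i
      change Coalgebra.comul (R := ℂ) (theta q (E i)) =
        thetaTensor q (TensorProduct.comm ℂ _ _ (Coalgebra.comul (R := ℂ) (E i)))
      rw [comul_E, map_add, map_add, TensorProduct.comm_tmul, TensorProduct.comm_tmul,
        thetaTensor_tmul, thetaTensor_tmul]
      change _ = (theta q (K i) ⊗ₜ[ℂ] theta q (E i) + theta q (E i) ⊗ₜ[ℂ] theta q 1 :
        Uq q ⊗[ℂ] Uq q)
      simp [TensorProduct.tmul_neg, TensorProduct.neg_tmul, TensorProduct.smul_tmul']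
    · intro i
      change Coalgebra.comul (R := ℂ) (theta q (F i)) =
        thetaTensor q (TensorProduct.comm ℂ _ _ (Coalgebra.comul (R := ℂ) (F i)))
      rw [comul_F, map_add, map_add, TensorProduct.comm_tmul, TensorProduct.comm_tmul,
        thetaTensor_tmul, thetaTensor_tmul]
      change _ = (theta q 1 ⊗ₜ[ℂ] theta q (F i) + theta q (F i) ⊗ₜ[ℂ] theta q (Kinv i) :
        Uq q ⊗[ℂ] Uq q)
      simp [TensorProduct.tmul_neg, TensorProduct.neg_tmul, TensorProduct.smul_tmul']
    · intro i
      change Coalgebra.comul (R := ℂ) (theta q (K i)) =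
        thetaTensor q (TensorProduct.comm ℂ _ _ (Coalgebra.comul (R := ℂ) (K i)))
      rw [comul_K, TensorProduct.comm_tmul, thetaTensor_tmul]
      simp
    · intro i
      change Coalgebra.comul (R := ℂ) (theta q (Kinv i)) =
        thetaTensor q (TensorProduct.comm ℂ _ _ (Coalgebra.comul (R := ℂ) (Kinv i)))
      rw [comul_Kinv, TensorProduct.comm_tmul, thetaTensor_tmul]
      simp
  exact DFunLike.congr_fun h x

/-- `θ` reverses the coproduct, so that `a ↦ a^*` reverses products. -/
theorem dualStar_mul (a b : UqDual q) : dualStar (a * b) = dualStar b * dualStar a := by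
  apply ext
  intro X
  rw [dualStar_apply, LinearMap.convMul_apply, LinearMap.convMul_apply, comul_theta]
  generalize Coalgebra.comul (R := ℂ) X = t
  induction t using TensorProduct.induction_on with
  | zero =>
    rw [map_zero, map_zero, map_zero]
    exact (congrArg conj ((congrArg _ (map_zero _)).trans (map_zero _))).trans (by simp)
  | tmul x y =>
    rw [TensorProduct.comm_tmul, thetaTensor_tmul]
    simp [mul_comm]
  | add s t hs ht =>
    rw [map_add, map_add, map_add, map_add, ← hs, ← ht]
    exact (congrArg conj ((congrArg _ (map_add _ _ _)).trans (map_add _ _ _))).trans (map_add _ _ _)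

end UqDual

/-! ### The quantum coordinate algebra `O_q(SU_3)` -/

open UqDual in
/-- The quantum coordinate algebra `O_q(SU_3)`, as the algebra of functionals on `U_q(sl_3)` that is
generated by the matrix coefficients `u_{ij}`. -/
def OqSub (q : DefParam) : Subalgebra ℂ (UqDual q) :=
  Algebra.adjoin ℂ (Set.range fun p : Fin 3 × Fin 3 => u q p.1 p.2)

/-- The quantum coordinate algebra `O_q(SU_3)`. -/
def Oq (q : DefParam) : Type := OqSub q

namespace Oq

variable {q : DefParam}

instance : Ring (Oq q) := inferInstanceAs (Ring (OqSub q))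
instance : Algebra ℂ (Oq q) := inferInstanceAs (Algebra ℂ (OqSub q))

variable (q) in
/-- The inclusion of `O_q(SU_3)` into the dual of `U_q(sl_3)`. -/
def val : Oq q →ₐ[ℂ] UqDual q := (OqSub q).val

theorem val_injective : Function.Injective (val q) := Subtype.val_injective

end Oq

end

noncomputable section

namespace Oq

open Uq UqDual

variable {q : DefParam}

/-- The generators `u_{ij}` of `O_q(SU_3)`. -/
def u (i j : Fin 3) : Oq q := ⟨UqDual.u q i j, Algebra.subset_adjoin ⟨(i, j), rfl⟩⟩

theorem val_u (i j : Fin 3) : val q (u i j) = UqDual.u q i j := rfl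

/-- The pairing `⟨X, a⟩` of `X ∈ U_q(sl_3)` with `a ∈ O_q(SU_3)`. -/
def pair (X : Uq q) : Oq q →ₗ[ℂ] ℂ where
  toFun a := val q a X
  map_add' a b := by rw [map_add]; rfl
  map_smul' c a := by rw [map_smul]; rfl

theorem pair_apply (X : Uq q) (a : Oq q) : pair X a = val q a X := rfl

@[simp] theorem pair_u (X : Uq q) (i j : Fin 3) : pair X (u i j) = vecRep q X i j := rfl

theorem ext_pair {a b : Oq q} (h : ∀ X, pair X a = pair X b) : a = b :=
  val_injective (UqDual.ext h)

/-- Induction on elements of `O_q(SU_3)`. -/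
theorem induction {p : Oq q → Prop} (hu : ∀ i j, p (u i j)) (hs : ∀ c : ℂ, p (algebraMap ℂ _ c))
    (ha : ∀ a b, p a → p b → p (a + b)) (hm : ∀ a b, p a → p b → p (a * b)) (a : Oq q) : p a := by
  obtain ⟨a, ha'⟩ := a
  induction ha' using Algebra.adjoin_induction with
  | mem x hx =>
    obtain ⟨i, rfl⟩ := hx
    exact hu i.1 i.2
  | algebraMap c => exact hs c
  | add x y hx hy h1 h2 => exact ha ⟨x, hx⟩ ⟨y, hy⟩ h1 h2
  | mul x y hx hy h1 h2 => exact hm ⟨x, hx⟩ ⟨y, hy⟩ h1 h2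

/-- Algebra homomorphisms out of `O_q(SU_3)` are determined on the generators. -/
theorem algHom_ext {R : Type*} [Ring R] [Algebra ℂ R] {φ ψ : Oq q →ₐ[ℂ] R}
    (h : ∀ i j, φ (u i j) = ψ (u i j)) : φ = ψ := by
  ext a
  induction a using Oq.induction with
  | hu i j => exact h i j
  | hs c => simp
  | ha a b h1 h2 => simp [h1, h2]
  | hm a b h1 h2 => simp [h1, h2]

/-! ### The coproduct of `O_q(SU_3)` -/

variable (q) in
/-- The functional `X ⊗ Y ↦ a(X) b(Y)` for `a ⊗ b ∈ O_q(SU_3) ⊗ O_q(SU_3)`, linear part. -/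
def pairTwoLin : Oq q ⊗[ℂ] Oq q →ₗ[ℂ] WithConv (Uq q ⊗[ℂ] Uq q →ₗ[ℂ] ℂ) :=
  TensorProduct.lift <| LinearMap.mk₂ ℂ
    (fun a b => toConv (LinearMap.mul' ℂ ℂ ∘ₗ TensorProduct.map (val q a).ofConv
      (val q b).ofConv))
    (fun a a' b => by
      refine WithConv.ext (TensorProduct.ext' fun x y => ?_); simp [add_mul])
    (fun c a b => by
      refine WithConv.ext (TensorProduct.ext' fun x y => ?_); simp [mul_assoc])
    (fun a b b' => by
      refine WithConv.ext (TensorProduct.ext' fun x y => ?_); simp [mul_add])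
    (fun c a b => by
      refine WithConv.ext (TensorProduct.ext' fun x y => ?_); simp [mul_left_comm])

@[simp] theorem pairTwoLin_tmul (a b : Oq q) (X Y : Uq q) :
    pairTwoLin q (a ⊗ₜ b) (X ⊗ₜ Y) = pair X a * pair Y b := rfl

theorem pairTwoLin_injective : Function.Injective (pairTwoLin q) := by
  classical
  rw [injective_iff_map_eq_zero]
  intro t ht
  let b := Module.Basis.ofVectorSpace ℂ (Oq q)
  set m := TensorProduct.equivFinsuppOfBasisRight (M := Oq q) b t with hm
  have htm : t = m.sum fun i c => c ⊗ₜ b i := by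
    rw [← (TensorProduct.equivFinsuppOfBasisRight (M := Oq q) b).symm_apply_apply t, ← hm,
      TensorProduct.equivFinsuppOfBasisRight_symm_apply]
  have key : ∀ X, m.sum (fun i c => pair X c • b i) = 0 := by
    intro X
    apply ext_pair
    intro Y
    have h1 : pairTwoLin q t (X ⊗ₜ Y) = 0 := by rw [ht]; rfl
    rw [htm, Finsupp.sum, map_sum, WithConv.ofConv_sum, LinearMap.sum_apply] at h1
    rw [Finsupp.sum, map_sum, map_zero, ← h1]
    exact Finset.sum_congr rfl fun i _ => by rw [map_smul, pairTwoLin_tmul, smul_eq_mul]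
  have hm0 : m = 0 := by
    ext1 i
    apply ext_pair
    intro X
    rw [Finsupp.zero_apply, map_zero]
    by_cases hi : i ∈ m.support
    · exact linearIndependent_iff'.mp b.linearIndependent m.support (fun i => pair X (m i))
        (key X) i hi
    · rw [Finsupp.notMem_support_iff.mp hi, map_zero]
  rw [htm, hm0, Finsupp.sum_zero_index]

variable (q) in
/-- The functional `X ⊗ Y ↦ a(X) b(Y)` for `a ⊗ b ∈ O_q(SU_3) ⊗ O_q(SU_3)`. -/
def pairTwo : Oq q ⊗[ℂ] Oq q →ₐ[ℂ] WithConv (Uq q ⊗[ℂ] Uq q →ₗ[ℂ] ℂ) :=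
  Algebra.TensorProduct.algHomOfLinearMapTensorProduct (pairTwoLin q)
    (fun a a' b b' => by
      refine WithConv.ext (TensorProduct.ext' fun x y => ?_)
      change pair x (a * a') * pair y (b * b') =
        (pairTwoLin q (a ⊗ₜ b) * pairTwoLin q (a' ⊗ₜ b')) (x ⊗ₜ y)
      rw [((Coalgebra.Repr.arbitrary ℂ x).tmul (Coalgebra.Repr.arbitrary ℂ y)).convMul_apply]
      simp only [pair_apply, map_mul]
      rw [(Coalgebra.Repr.arbitrary ℂ x).convMul_apply,
        (Coalgebra.Repr.arbitrary ℂ y).convMul_apply, Finset.sum_mul_sum, ← Finset.sum_product']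
      refine Finset.sum_congr rfl fun i _ => ?_
      simp [pair_apply]
      ring)
    (by
      refine WithConv.ext (TensorProduct.ext' fun x y => ?_)
      simp [pair_apply, mul_comm])

variable (q) in
/-- The functional `X ⊗ Y ↦ a(XY)`. -/
def mulDual : UqDual q →ₐ[ℂ] WithConv (Uq q ⊗[ℂ] Uq q →ₗ[ℂ] ℂ) :=
  AlgHom.ofLinearMap
    { toFun := fun a => toConv (a.ofConv ∘ₗ LinearMap.mul' ℂ (Uq q))
      map_add' := fun _ _ => rfl
      map_smul' := fun _ _ => rfl }
    (by
      refine WithConv.ext (TensorProduct.ext' fun x y => ?_)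
      change Coalgebra.counit (R := ℂ) (x * y) = _
      simp [mul_comm])
    (fun a b => WithConv.ext
      (LinearMap.convMul_comp_coalgHom_distrib a b (Bialgebra.mulCoalgHom ℂ (Uq q))))

theorem mulDual_apply (a : UqDual q) (X Y : Uq q) : mulDual q a (X ⊗ₜ Y) = a (X * Y) := rfl

theorem mulDual_u (i j : Fin 3) :
    mulDual q (UqDual.u q i j) = pairTwo q (∑ k, u i k ⊗ₜ u k j) := by
  refine WithConv.ext (TensorProduct.ext' fun x y => ?_)
  change vecRep q (x * y) i j = _
  rw [map_mul, Matrix.mul_apply, map_sum, WithConv.ofConv_sum, LinearMap.sum_apply]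
  rfl

theorem mulDual_mem_range (a : Oq q) : mulDual q (val q a) ∈ (pairTwo q).range := by
  have : OqSub q ≤ (pairTwo q).range.comap (mulDual q) := by
    apply Algebra.adjoin_le
    rintro _ ⟨p, rfl⟩
    exact ⟨_, (mulDual_u p.1 p.2).symm⟩
  exact this a.2

theorem pairTwo_injective : Function.Injective (pairTwo q) := pairTwoLin_injective

variable (q) in
/-- The coproduct of `O_q(SU_3)`, dual to the product of `U_q(sl_3)`. -/
def comulHom : Oq q →ₐ[ℂ] Oq q ⊗[ℂ] Oq q :=
  (AlgEquiv.ofInjective (pairTwo q) pairTwo_injective).symm.toAlgHom.comp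
    (((mulDual q).comp (val q)).codRestrict _ mulDual_mem_range)

theorem pairTwo_comulHom (a : Oq q) : pairTwo q (comulHom q a) = mulDual q (val q a) := by
  have := (AlgEquiv.ofInjective (pairTwo q) pairTwo_injective).apply_symm_apply
    ⟨mulDual q (val q a), mulDual_mem_range a⟩
  exact congrArg Subtype.val this

theorem comulHom_u (i j : Fin 3) : comulHom q (u i j) = ∑ k, u i k ⊗ₜ u k j :=
  pairTwo_injective ((pairTwo_comulHom _).trans (mulDual_u i j))

variable (q) in
/-- The counit `a ↦ a(1)` of `O_q(SU_3)`. -/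
def counitHom : Oq q →ₐ[ℂ] ℂ :=
  AlgHom.ofLinearMap (pair 1) (by simp [pair_apply]) (fun a b => by simp [pair_apply, Algebra.TensorProduct.one_def])

theorem counitHom_u (i j : Fin 3) : counitHom q (u i j) = if i = j then 1 else 0 := by
  change vecRep q 1 i j = _
  rw [map_one, Matrix.one_apply]

/-- `O_q(SU_3)` as a bialgebra: `⟨XY, a⟩ = ⟨X, a_(1)⟩⟨Y, a_(2)⟩` and `ε(a) = ⟨1, a⟩`. -/
instance : Bialgebra ℂ (Oq q) :=
  Bialgebra.ofAlgHom (comulHom q) (counitHom q)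
    (by
      apply algHom_ext
      intro i j
      simp only [AlgHom.comp_apply, comulHom_u, map_sum, Algebra.TensorProduct.map_tmul,
        TensorProduct.sum_tmul, TensorProduct.tmul_sum]
      simp
      rw [Finset.sum_comm])
    (by
      apply algHom_ext
      intro i j
      simp [comulHom_u, counitHom_u, TensorProduct.ite_tmul])
    (by
      apply algHom_ext
      intro i j
      simp [comulHom_u, counitHom_u, TensorProduct.tmul_ite])

theorem comul_eq (a : Oq q) : Coalgebra.comul (R := ℂ) a = comulHom q a := rfl
theorem counit_eq (a : Oq q) : Coalgebra.counit (R := ℂ) a = pair 1 a := rfl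

theorem comul_u (i j : Fin 3) :
    Coalgebra.comul (R := ℂ) (u i j : Oq q) = ∑ k, u i k ⊗ₜ u k j := comulHom_u i j

end Oq
end

noncomputable section

namespace Oq

open Uq UqDual

variable {q : DefParam}

/-! ### The involution of `O_q(SU_3)` -/

/-- The Kronecker product of matrices as an algebra homomorphism. -/
def kronHom : Matrix (Fin 3) (Fin 3) ℂ ⊗[ℂ] Matrix (Fin 3) (Fin 3) ℂ →ₐ[ℂ]
    Matrix (Fin 3 × Fin 3) (Fin 3 × Fin 3) ℂ :=
  Algebra.TensorProduct.algHomOfLinearMapTensorProduct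
    (TensorProduct.lift (Matrix.kroneckerBilinear (R := ℂ) (α := ℂ)))
    (fun a a' b b' => Matrix.mul_kronecker_mul a a' b b')
    Matrix.one_kronecker_one

variable (q) in
/-- The tensor square of the vector representation. -/
def vecTwo : Uq q →ₐ[ℂ] Matrix (Fin 3 × Fin 3) (Fin 3 × Fin 3) ℂ :=
  kronHom.comp ((Algebra.TensorProduct.map (vecRep q) (vecRep q)).comp
    (Bialgebra.comulAlgHom ℂ (Uq q)))

theorem vecTwo_apply (X : Uq q) (a b c d : Fin 3) :
    vecTwo q X (a, b) (c, d) = (UqDual.u q a c * UqDual.u q b d) X := by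
  rw [LinearMap.convMul_apply]
  change kronHom (Algebra.TensorProduct.map (vecRep q) (vecRep q) (Coalgebra.comul X)) _ _ = _
  generalize (Coalgebra.comul (R := ℂ) X) = t
  induction t using TensorProduct.induction_on with
  | zero => simp
  | tmul x y => rfl
  | add s t hs ht => rw [map_add, map_add, Matrix.add_apply, hs, ht, map_add, map_add]

@[simp] theorem vecRep_E (i : Fin 2) : vecRep q (E i) = vecGen q (.E i) := lift_E _ i
@[simp] theorem vecRep_F (i : Fin 2) : vecRep q (F i) = vecGen q (.F i) := lift_F _ i
@[simp] theorem vecRep_K (i : Fin 2) : vecRep q (K i) = vecGen q (.K i) := lift_K _ i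
@[simp] theorem vecRep_Kinv (i : Fin 2) : vecRep q (Kinv i) = vecGen q (.Kinv i) := lift_Kinv _ i

theorem kronHom_tmul (A B : Matrix (Fin 3) (Fin 3) ℂ) (a b c d : Fin 3) :
    kronHom (A ⊗ₜ B) (a, b) (c, d) = A a c * B b d := rfl

theorem vecTwo_E (i : Fin 2) (a b c d : Fin 3) : vecTwo q (E i) (a, b) (c, d) =
    vecRep q (E i) a c * vecRep q (K i) b d + (1 : Matrix _ _ ℂ) a c * vecRep q (E i) b d := by
  rw [← kronHom_tmul, ← kronHom_tmul, ← Matrix.add_apply, ← map_add]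
  simp [vecTwo]

theorem vecTwo_F (i : Fin 2) (a b c d : Fin 3) : vecTwo q (F i) (a, b) (c, d) =
    vecRep q (F i) a c * (1 : Matrix _ _ ℂ) b d + vecRep q (Kinv i) a c * vecRep q (F i) b d := by
  rw [← kronHom_tmul, ← kronHom_tmul, ← Matrix.add_apply, ← map_add]
  simp [vecTwo]

theorem vecTwo_K (i : Fin 2) (a b c d : Fin 3) : vecTwo q (K i) (a, b) (c, d) =
    vecRep q (K i) a c * vecRep q (K i) b d := by
  rw [← kronHom_tmul]
  simp [vecTwo]

theorem vecTwo_Kinv (i : Fin 2) (a b c d : Fin 3) : vecTwo q (Kinv i) (a, b) (c, d) =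
    vecRep q (Kinv i) a c * vecRep q (Kinv i) b d := by
  rw [← kronHom_tmul]
  simp [vecTwo]

variable (q) in
/-- The antisymmetric tensors spanning the copy of the dual of the vector representation in its
tensor square. -/
def antisymm : Matrix (Fin 3 × Fin 3) (Fin 3) ℂ := Matrix.of fun p j =>
  if p.1 = j ∨ p.2 = j ∨ p.1 = p.2 then 0
  else (-q.c) ^ (j : ℕ) * if p.1 < p.2 then 1 else -q.c

set_option maxHeartbeats 2000000 in
theorem vecTwo_mul_antisymm (X : Uq q) :
    vecTwo q X * antisymm q = antisymm q * (vecRep q (theta q X)).map conj := by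
  have hq := q.c_ne_zero
  induction X using Uq.induction with
  | hs c =>
    have h1 : theta q (algebraMap ℂ _ c) = conj c • 1 := by
      rw [Algebra.algebraMap_eq_smul_one, LinearMap.map_smulₛₗ, theta_one]
    have h2 : ((conj c • (1 : Matrix (Fin 3) (Fin 3) ℂ)).map conj) = c • 1 := by
      ext a b
      by_cases h : a = b <;> simp [h]
    rw [h1, AlgHom.commutes, map_smul, map_one, h2, Algebra.algebraMap_eq_smul_one,
      Matrix.smul_mul, Matrix.mul_smul, Matrix.one_mul, Matrix.mul_one]
  | hm x y hx hy =>
    rw [map_mul, theta_mul, map_mul, Matrix.mul_assoc, hy, ← Matrix.mul_assoc, hx,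
      Matrix.mul_assoc, Matrix.map_mul]
  | ha x y hx hy =>
    rw [map_add, map_add, map_add, Matrix.add_mul, hx, hy, Matrix.map_add _ (map_add _),
      Matrix.mul_add]
  | hE i =>
    ext ⟨a, b⟩ j
    rw [theta_E, map_neg, map_smul, vecRep_F]
    simp only [Matrix.mul_apply, Fintype.sum_prod_type, vecTwo_E, vecRep_E, vecRep_K]
    fin_cases i <;> fin_cases j <;> fin_cases a <;> fin_cases b <;>
      simp [vecGen, antisymm, Fin.sum_univ_three, Matrix.single, Matrix.diagonal, Matrix.one_apply]
      <;> (try field_simp) <;> first | ring1 | simp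
  | hF i =>
    ext ⟨a, b⟩ j
    rw [theta_F, map_neg, map_smul, vecRep_E]
    simp only [Matrix.mul_apply, Fintype.sum_prod_type, vecTwo_F, vecRep_F, vecRep_Kinv]
    fin_cases i <;> fin_cases j <;> fin_cases a <;> fin_cases b <;>
      simp [vecGen, antisymm, Fin.sum_univ_three, Matrix.single, Matrix.diagonal, Matrix.one_apply]
      <;> field_simp <;> ring1
  | hK i =>
    ext ⟨a, b⟩ j
    rw [theta_K, vecRep_Kinv]
    simp only [Matrix.mul_apply, Fintype.sum_prod_type, vecTwo_K, vecRep_K]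
    fin_cases i <;> fin_cases j <;> fin_cases a <;> fin_cases b <;>
      simp [vecGen, antisymm, Fin.sum_univ_three, Matrix.diagonal] <;> field_simp
  | hKi i =>
    ext ⟨a, b⟩ j
    rw [theta_Kinv, vecRep_K]
    simp only [Matrix.mul_apply, Fintype.sum_prod_type, vecTwo_Kinv, vecRep_Kinv]
    fin_cases i <;> fin_cases j <;> fin_cases a <;> fin_cases b <;>
      simp [vecGen, antisymm, Fin.sum_univ_three, Matrix.diagonal] <;> field_simp

/-- The adjoints of the generators as quantum minors. -/
theorem antisymm_mul_dualStar (a b j : Fin 3) :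
    ∑ k, antisymm q (a, b) k • dualStar (UqDual.u q k j) =
      ∑ c, ∑ d, antisymm q (c, d) j • (UqDual.u q a c * UqDual.u q b d) := by
  apply UqDual.ext
  intro X
  have h := congrFun (congrFun (vecTwo_mul_antisymm (q := q) X) (a, b)) j
  simp only [Matrix.mul_apply, Fintype.sum_prod_type, vecTwo_apply, Matrix.map_apply] at h
  simp only [WithConv.ofConv_sum, LinearMap.sum_apply, WithConv.ofConv_smul, LinearMap.smul_apply,
    smul_eq_mul, dualStar_apply, UqDual.u_apply]
  rw [← h]
  exact Finset.sum_congr rfl fun c _ => Finset.sum_congr rfl fun d _ => mul_comm _ _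

theorem u_mem (i j : Fin 3) : UqDual.u q i j ∈ OqSub q :=
  Algebra.subset_adjoin ⟨(i, j), rfl⟩

theorem dualStar_u_mem (i j : Fin 3) : dualStar (UqDual.u q i j) ∈ OqSub q := by
  have hq := q.c_ne_zero
  have h : ∀ a b, ∑ k, antisymm q (a, b) k • dualStar (UqDual.u q k j) ∈ OqSub q := by
    intro a b
    rw [antisymm_mul_dualStar]
    exact Subalgebra.sum_mem _ fun c _ => Subalgebra.sum_mem _ fun d _ =>
      Subalgebra.smul_mem _ (Subalgebra.mul_mem _ (u_mem _ _) (u_mem _ _)) _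
  have h2 : ∀ (c : ℂ) (x : UqDual q), c ≠ 0 → c • x ∈ OqSub q → x ∈ OqSub q := by
    intro c x hc hx
    have := Subalgebra.smul_mem _ hx c⁻¹
    rwa [smul_smul, inv_mul_cancel₀ hc, one_smul] at this
  fin_cases i
  · refine h2 1 _ one_ne_zero ?_
    simpa [antisymm, Fin.sum_univ_three] using h 1 2
  · refine h2 (-q.c) _ (by simpa using hq) ?_
    simpa [antisymm, Fin.sum_univ_three] using h 0 2
  · refine h2 (q.c ^ 2) _ (by simpa using hq) ?_
    simpa [antisymm, Fin.sum_univ_three] using h 0 1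

theorem dualStar_mem {a : UqDual q} (h : a ∈ OqSub q) : dualStar a ∈ OqSub q := by
  induction h using Algebra.adjoin_induction with
  | mem x hx =>
    obtain ⟨p, rfl⟩ := hx
    exact dualStar_u_mem _ _
  | algebraMap c =>
    have : dualStar (algebraMap ℂ (UqDual q) c) = algebraMap ℂ (UqDual q) (conj c) := by
      apply UqDual.ext
      intro X
      have h2 : conj (Coalgebra.counit (R := ℂ) (theta q X)) = Coalgebra.counit (R := ℂ) X := by
        induction X using Uq.induction with
        | hs c => simp [Algebra.algebraMap_eq_smul_one]
        | hE i => simp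
        | hF i => simp
        | hK i => simp
        | hKi i => simp
        | hm x y h1 h2 => simp [h1, h2]
        | ha x y h1 h2 => simp [h1, h2]
      simp [Algebra.algebraMap_eq_smul_one, h2]
    rw [this]
    exact Subalgebra.algebraMap_mem _ _
  | add x y hx hy h1 h2 =>
    have : dualStar (x + y) = dualStar x + dualStar y := by
      apply UqDual.ext
      intro X
      simp
    rw [this]
    exact Subalgebra.add_mem _ h1 h2
  | mul x y hx hy h1 h2 =>
    rw [dualStar_mul]
    exact Subalgebra.mul_mem _ h2 h1

variable (q) in
/-- The involution `a ↦ a^*` of `O_q(SU_3)`, with `⟨X, a^*⟩ = conj ⟨θ(X), a⟩`. -/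
def star : Oq q →ₛₗ[starRingEnd ℂ] Oq q where
  toFun a := ⟨dualStar (val q a), dualStar_mem a.2⟩
  map_add' a b := ext_pair fun X => by
    change conj (pair (theta q X) (a + b)) = conj (pair (theta q X) a) + conj (pair (theta q X) b)
    simp
  map_smul' c a := ext_pair fun X => by
    change conj (pair (theta q X) (c • a)) = conj c * conj (pair (theta q X) a)
    simp

theorem pair_star (X : Uq q) (a : Oq q) : pair X (star q a) = conj (pair (theta q X) a) := rfl

theorem star_mul (a b : Oq q) : star q (a * b) = star q b * star q a :=
  val_injective (dualStar_mul (val q a) (val q b))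

end Oq
end

noncomputable section

namespace Oq

open Uq

variable {q : DefParam}

/-- The pairing of a product, `⟨X, ab⟩ = ⟨X_(1), a⟩⟨X_(2), b⟩`. -/
theorem pair_mul (X : Uq q) (a b : Oq q) :
    pair X (a * b) = pairTwo q (a ⊗ₜ b) (Coalgebra.comul (R := ℂ) X) := by
  rw [pair_apply, map_mul, LinearMap.convMul_apply]
  rfl

@[simp] theorem pairTwo_tmul (a b : Oq q) (X Y : Uq q) :
    pairTwo q (a ⊗ₜ b) (X ⊗ₜ Y) = pair X a * pair Y b := rfl

theorem theta_theta (X : Uq q) : theta q (theta q X) = X := by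
  have hq := q.c_ne_zero
  induction X using Uq.induction with
  | hs c => simp [Algebra.algebraMap_eq_smul_one]
  | hE i => simp [smul_smul, hq]
  | hF i => simp [smul_smul, hq]
  | hK i => simp
  | hKi i => simp
  | hm x y h1 h2 => simp [h1, h2]
  | ha x y h1 h2 => simp [h1, h2]

theorem star_star (a : Oq q) : star q (star q a) = a :=
  ext_pair fun X => by simp [pair_star, theta_theta]

/-- The map `X ⊗ Y ↦ ρ(X) ρ(θ(Y))^*` for the vector representation `ρ`. -/
def unitaryMap : Uq q ⊗[ℂ] Uq q →ₗ[ℂ] Matrix (Fin 3) (Fin 3) ℂ :=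
  TensorProduct.lift <| LinearMap.mk₂ ℂ
    (fun X Y => vecRep q X * (vecRep q (theta q Y)).conjTranspose)
    (fun X X' Y => by simp [add_mul])
    (fun c X Y => by simp)
    (fun X Y Y' => by simp [mul_add])
    (fun c X Y => by simp)

theorem unitaryMap_tmul (X Y : Uq q) :
    unitaryMap (X ⊗ₜ Y) = vecRep q X * (vecRep q (theta q Y)).conjTranspose := rfl

theorem unitaryMap_mul (X Y : Uq q) (t : Uq q ⊗[ℂ] Uq q) : unitaryMap ((X ⊗ₜ Y) * t) =
    vecRep q X * unitaryMap t * (vecRep q (theta q Y)).conjTranspose := by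
  induction t using TensorProduct.induction_on with
  | zero => simp
  | tmul x y => simp [unitaryMap_tmul, mul_assoc]
  | add s t hs ht => simp [mul_add, add_mul, hs, ht]

theorem unitaryMap_comul (X : Uq q) :
    unitaryMap (Coalgebra.comul (R := ℂ) X) = Coalgebra.counit (R := ℂ) X • 1 := by
  have hq := q.c_ne_zero
  induction X using Uq.induction with
  | hs c => simp [Algebra.algebraMap_eq_smul_one, Algebra.TensorProduct.one_def, unitaryMap_tmul]
  | hE i =>
    rw [comul_E, map_add, unitaryMap_tmul, unitaryMap_tmul]
    ext a b
    fin_cases i <;> fin_cases a <;> fin_cases b <;>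
      simp [vecGen, Matrix.single, Matrix.mul_apply, Matrix.diagonal]
  | hF i =>
    rw [comul_F, map_add, unitaryMap_tmul, unitaryMap_tmul]
    ext a b
    fin_cases i <;> fin_cases a <;> fin_cases b <;>
      simp [vecGen, Matrix.single, Matrix.mul_apply, Matrix.diagonal] <;> (try field_simp) <;> (try ring)
  | hK i =>
    rw [comul_K, unitaryMap_tmul, theta_K, counit_K, one_smul]
    ext a b
    fin_cases i <;> fin_cases a <;> fin_cases b <;>
      simp [vecGen, Matrix.mul_apply, Matrix.diagonal, hq]
  | hKi i =>
    rw [comul_Kinv, unitaryMap_tmul, theta_Kinv, counit_Kinv, one_smul]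
    ext a b
    fin_cases i <;> fin_cases a <;> fin_cases b <;>
      simp [vecGen, Matrix.mul_apply, Matrix.diagonal, hq]
  | hm x y h1 h2 =>
    have h : ∀ s : Uq q ⊗[ℂ] Uq q, unitaryMap (s * Coalgebra.comul (R := ℂ) y) =
        Coalgebra.counit (R := ℂ) y • unitaryMap s := by
      intro s
      induction s using TensorProduct.induction_on with
      | zero => simp
      | tmul a b => rw [unitaryMap_mul, h2]; simp [unitaryMap_tmul]
      | add s t hs ht => rw [add_mul, map_add, hs, ht, map_add, smul_add]
    rw [Bialgebra.comul_mul, h, h1, smul_smul, Bialgebra.counit_mul, mul_comm]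
  | ha x y h1 h2 => rw [map_add, map_add, h1, h2, map_add, add_smul]

/-- The matrix `(u_{ij})` is unitary, that is `u_{ji}^* = S(u_{ij})` for the antipode `S`. -/
theorem sum_u_mul_star (i j : Fin 3) :
    ∑ k, u i k * star q (u j k) = if i = j then (1 : Oq q) else 0 := by
  apply ext_pair
  intro X
  have h : ∀ t : Uq q ⊗[ℂ] Uq q,
      ∑ k, pairTwo q (u i k ⊗ₜ star q (u j k)) t = unitaryMap t i j := by
    intro t
    induction t using TensorProduct.induction_on with
    | zero => simp
    | tmul x y =>
      rw [unitaryMap_tmul, Matrix.mul_apply]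
      rfl
    | add s t hs ht =>
      rw [map_add, Matrix.add_apply, ← hs, ← ht, ← Finset.sum_add_distrib]
      exact Finset.sum_congr rfl fun k _ => map_add _ _ _
  rw [map_sum]
  simp only [pair_mul]
  rw [h, unitaryMap_comul, Matrix.smul_apply, Matrix.one_apply]
  have h1 : pair X (1 : Oq q) = Coalgebra.counit (R := ℂ) X := by
    rw [pair_apply, map_one]
    exact (LinearMap.convOne_apply _).trans (by simp)
  split_ifs <;> simp [h1]

end Oq
end

noncomputable section

/-! ### The quantum tangent space -/

/-- The positive roots `α₁`, `α₂`, `α₁ + α₂` of `sl_3`. -/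
inductive PosRoot : Type
  | a1
  | a2
  | a12

namespace Uq

variable {q : DefParam}

/-- The root vectors `E_{α₁} = E_1`, `E_{α₂} = E_2`, `E_{α₁+α₂} = E_2 E_1 - q⁻¹ E_1 E_2`. -/
def rootE : PosRoot → Uq q
  | .a1 => E 0
  | .a2 => E 1
  | .a12 => E 1 * E 0 - q.c⁻¹ • (E 0 * E 1)

/-- The root vectors `F_{α_i} = K_i F_i` and
`F_{α₁+α₂} = q⁻¹ K_1 K_2 (F_1 F_2 - q⁻¹ F_2 F_1)`. -/
def rootF : PosRoot → Uq q
  | .a1 => K 0 * F 0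
  | .a2 => K 1 * F 1
  | .a12 => q.c⁻¹ • (K 0 * K 1 * (F 0 * F 1 - q.c⁻¹ • (F 1 * F 0)))

variable (q) in
/-- The quantum tangent space `T`, spanned by the `E_γ` and `F_γ` for `γ` a positive root. -/
def tangent : Submodule ℂ (Uq q) :=
  Submodule.span ℂ (Set.range rootE ∪ Set.range rootF)

theorem comul_rootE_a12 : Coalgebra.comul (R := ℂ) (rootE .a12 : Uq q) =
    rootE .a12 ⊗ₜ (K 0 * K 1) + (q.c⁻¹ * (q.c - q.c⁻¹)) • (rootE .a1 ⊗ₜ (E 1 * K 0))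
      + 1 ⊗ₜ rootE .a12 := by
  have hq := q.c_ne_zero
  simp only [rootE, map_sub, map_smul, Bialgebra.comul_mul, comul_E, mul_add, add_mul,
    Algebra.TensorProduct.tmul_mul_tmul, mul_one, one_mul, K_mul_K 1 0, K_mul_E,
    TensorProduct.sub_tmul, TensorProduct.tmul_sub, TensorProduct.tmul_smul,
    ← TensorProduct.smul_tmul']
  simp only [cartanA2]
  norm_num
  match_scalars <;> field_simp <;> ring1

theorem rootF_a12_eq : (rootF .a12 : Uq q) =
    rootF .a1 * rootF .a2 - q.c⁻¹ • (rootF .a2 * rootF .a1) := by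
  have hq := q.c_ne_zero
  have h1 : (F 0 * K 1 : Uq q) = q.c⁻¹ • (K 1 * F 0) := by
    rw [K_mul_F]; simp [cartanA2, smul_smul, hq]
  have h2 : (F 1 * K 0 : Uq q) = q.c⁻¹ • (K 0 * F 1) := by
    rw [K_mul_F]; simp [cartanA2, smul_smul, hq]
  have e1 : (K 0 * F 0 * (K 1 * F 1) : Uq q) = q.c⁻¹ • (K 0 * K 1 * (F 0 * F 1)) := by
    rw [show (K 0 * F 0 * (K 1 * F 1) : Uq q) = K 0 * (F 0 * K 1) * F 1 by noncomm_ring, h1]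
    simp [mul_assoc]
  have e2 : (K 1 * F 1 * (K 0 * F 0) : Uq q) = q.c⁻¹ • (K 0 * K 1 * (F 1 * F 0)) := by
    rw [show (K 1 * F 1 * (K 0 * F 0) : Uq q) = K 1 * (F 1 * K 0) * F 0 by noncomm_ring, h2,
      K_mul_K 0 1]
    simp [mul_assoc]
  simp only [rootF, e1, e2, mul_sub, smul_sub, mul_smul_comm]

theorem comul_K_mul_F (i : Fin 2) : Coalgebra.comul (R := ℂ) (K i * F i : Uq q) =
    (K i * F i) ⊗ₜ K i + 1 ⊗ₜ (K i * F i) := by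
  simp [mul_add, K_mul_Kinv]

theorem comul_rootF_a12 : Coalgebra.comul (R := ℂ) (rootF .a12 : Uq q) =
    rootF .a12 ⊗ₜ (K 0 * K 1) + (q.c - q.c⁻¹) • (rootF .a1 ⊗ₜ (rootF .a2 * K 0))
      + 1 ⊗ₜ rootF .a12 := by
  have hq := q.c_ne_zero
  have h1 : (K 0 * (K 1 * F 1) : Uq q) = q.c • (K 1 * F 1 * K 0) := by
    rw [← mul_assoc, K_mul_K 0 1, mul_assoc, K_mul_F]; simp [cartanA2, mul_assoc]
  have h2 : (K 1 * (K 0 * F 0) : Uq q) = q.c • (K 0 * F 0 * K 1) := by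
    rw [← mul_assoc, K_mul_K 1 0, mul_assoc, K_mul_F]; simp [cartanA2, mul_assoc]
  rw [rootF_a12_eq]
  simp only [rootF, map_sub, map_smul, Bialgebra.comul_mul (R := ℂ) (K 0 * F 0),
    Bialgebra.comul_mul (R := ℂ) (K 1 * F 1), comul_K_mul_F, mul_add, add_mul,
    Algebra.TensorProduct.tmul_mul_tmul, mul_one, one_mul, K_mul_K 1 0, h1, h2,
    TensorProduct.sub_tmul, TensorProduct.tmul_sub, TensorProduct.tmul_smul,
    ← TensorProduct.smul_tmul']
  match_scalars <;> field_simp <;> ring1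

theorem counit_of_mem_tangent {X : Uq q} (hX : X ∈ tangent q) :
    Coalgebra.counit (R := ℂ) X = 0 := by
  induction hX using Submodule.span_induction with
  | mem x hx =>
    rcases hx with ⟨γ, rfl⟩ | ⟨γ, rfl⟩ <;> cases γ <;> simp [rootE, rootF]
  | zero => simp
  | add x y _ _ h1 h2 => simp [h1, h2]
  | smul c x _ h => simp [h]

end Uq

namespace Oq

open Uq

variable {q : DefParam}

variable (q) in
/-- The augmentation ideal `A⁺ = ker ε` of `A = O_q(SU_3)`. -/
def aug : Submodule ℂ (Oq q) := LinearMap.ker (Coalgebra.counit (R := ℂ) (A := Oq q))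

theorem mem_aug {a : Oq q} : a ∈ aug q ↔ Coalgebra.counit (R := ℂ) a = 0 := Iff.rfl

variable (q) in
/-- The right ideal `I = {y ∈ A⁺ : X(y) = 0 for all X ∈ T}`, as a subspace of `A⁺`. -/
def tangentIdeal : Submodule ℂ (aug q) where
  carrier := {y | ∀ X ∈ tangent q, pair X (y : Oq q) = 0}
  add_mem' h1 h2 X hX := by simp [h1 X hX, h2 X hX]
  zero_mem' X hX := by simp
  smul_mem' c y h X hX := by simp [h X hX]

theorem mem_tangentIdeal {y : aug q} :
    y ∈ tangentIdeal q ↔ ∀ X ∈ tangent q, pair X (y : Oq q) = 0 := Iff.rfl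

theorem pair_mul_eq_zero {y : aug q} (hy : y ∈ tangentIdeal q) (a : Oq q) {X : Uq q}
    (hX : X ∈ tangent q) : pair X ((y : Oq q) * a) = 0 := by
  have hE : ∀ γ, pair (rootE γ) (y : Oq q) = 0 := fun γ =>
    hy _ (Submodule.subset_span (Or.inl ⟨γ, rfl⟩))
  have hF : ∀ γ, pair (rootF γ) (y : Oq q) = 0 := fun γ =>
    hy _ (Submodule.subset_span (Or.inr ⟨γ, rfl⟩))
  have h1 : pair 1 (y : Oq q) = 0 := y.2
  have key : ∀ X ∈ Set.range rootE ∪ Set.range rootF, pair X ((y : Oq q) * a) = 0 := by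
    rintro X (⟨γ, rfl⟩ | ⟨γ, rfl⟩) <;> rw [pair_mul]
    · cases γ with
      | a1 => simp only [rootE, comul_E, map_add, pairTwo_tmul, h1]; simp [← rootE.eq_1, hE]
      | a2 => simp only [rootE, comul_E, map_add, pairTwo_tmul, h1]; simp [← rootE.eq_2, hE]
      | a12 => simp only [comul_rootE_a12, map_add, map_smul, pairTwo_tmul, h1, hE]; simp
    · cases γ with
      | a1 => simp only [rootF, comul_K_mul_F, map_add, pairTwo_tmul, h1]; simp [← rootF.eq_1, hF]
      | a2 => simp only [rootF, comul_K_mul_F, map_add, pairTwo_tmul, h1]; simp [← rootF.eq_2, hF]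
      | a12 => simp only [comul_rootF_a12, map_add, map_smul, pairTwo_tmul, h1, hF]; simp
  induction hX using Submodule.span_induction with
  | mem x hx => exact key x hx
  | zero => simp [pair_apply]
  | add x y _ _ h1 h2 =>
    rw [pair_apply, map_add, ← pair_apply, ← pair_apply, h1, h2, add_zero]
  | smul c x _ h => rw [pair_apply, map_smul, ← pair_apply, h, smul_zero]

/-! ### The cotangent space `Λ¹` -/

variable (q) in
/-- The cotangent space `Λ¹ = A⁺ / I`. -/
def Cot : Type := aug q ⧸ tangentIdeal q

instance : AddCommGroup (Cot q) := inferInstanceAs (AddCommGroup (aug q ⧸ tangentIdeal q))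
instance : Module ℂ (Cot q) := inferInstanceAs (Module ℂ (aug q ⧸ tangentIdeal q))

variable (q) in
/-- The projection of `A⁺` onto `Λ¹`. -/
def cotMk : aug q →ₗ[ℂ] Cot q := (tangentIdeal q).mkQ

theorem cotMk_surjective : Function.Surjective (cotMk q) := (tangentIdeal q).mkQ_surjective

theorem cotMk_eq_zero {y : aug q} : cotMk q y = 0 ↔ y ∈ tangentIdeal q :=
  Submodule.Quotient.mk_eq_zero _

/-- Linear maps out of `Λ¹`. -/
def cotLift {V : Type*} [AddCommGroup V] [Module ℂ V] (f : aug q →ₗ[ℂ] V)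
    (h : ∀ y ∈ tangentIdeal q, f y = 0) : Cot q →ₗ[ℂ] V :=
  (tangentIdeal q).liftQ f h

theorem cotLift_mk {V : Type*} [AddCommGroup V] [Module ℂ V] (f : aug q →ₗ[ℂ] V)
    (h : ∀ y ∈ tangentIdeal q, f y = 0) (y : aug q) : cotLift f h (cotMk q y) = f y := rfl

variable (q) in
/-- The projection `a ↦ a - ε(a) 1` of `A` onto `A⁺`. -/
def plus : Oq q →ₗ[ℂ] aug q :=
  (LinearMap.id - Algebra.linearMap ℂ (Oq q) ∘ₗ Coalgebra.counit (R := ℂ)).codRestrict _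
    (fun a => by simp [mem_aug])

theorem coe_plus (a : Oq q) :
    (plus q a : Oq q) = a - algebraMap ℂ (Oq q) (Coalgebra.counit (R := ℂ) a) := rfl

variable (q) in
/-- The class `[a⁺] = [a - ε(a) 1]` in `Λ¹` of an element `a` of `A`. -/
def cls : Oq q →ₗ[ℂ] Cot q := cotMk q ∘ₗ plus q

theorem cls_coe (y : aug q) : cls q (y : Oq q) = cotMk q y := by
  have : plus q (y : Oq q) = y := by
    apply Subtype.ext
    rw [coe_plus, mem_aug.mp y.2, map_zero, sub_zero]
  rw [cls, LinearMap.comp_apply, this]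

variable (q) in
/-- The right `A`-module structure of `Λ¹`, `[y] a = [y a]`. -/
def cotMul : Cot q →ₗ[ℂ] Oq q →ₗ[ℂ] Cot q :=
  cotLift
    ((LinearMap.mul ℂ (Oq q)).compr₂ (cls q) ∘ₗ (aug q).subtype)
    (by
      intro y hy
      ext a
      change cls q ((y : Oq q) * a) = 0
      have hm : (y : Oq q) * a ∈ aug q := by
        rw [mem_aug, Bialgebra.counit_mul, mem_aug.mp y.2, zero_mul]
      rw [show (y : Oq q) * a = ((⟨_, hm⟩ : aug q) : Oq q) from rfl, cls_coe,
        cotMk_eq_zero]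
      exact fun X hX => pair_mul_eq_zero hy a hX)

theorem cotMul_mk (y : aug q) (a : Oq q) :
    cotMul q (cotMk q y) a = cls q ((y : Oq q) * a) := rfl

theorem cls_mul (a b : Oq q) :
    cls q (a * b) = cotMul q (cls q a) b + Coalgebra.counit (R := ℂ) a • cls q b := by
  have : cotMul q (cls q a) b = cls q ((plus q a : Oq q) * b) := rfl
  rw [this, coe_plus, sub_mul, map_sub, Algebra.algebraMap_eq_smul_one, smul_mul_assoc, one_mul,
    map_smul, sub_add_cancel]

/-- The pairing of `Λ¹` with the tangent space. -/
def cotPair (X : tangent q) : Cot q →ₗ[ℂ] ℂ :=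
  cotLift (pair (X : Uq q) ∘ₗ (aug q).subtype) (fun _ hy => hy X X.2)

theorem cotPair_cls (X : tangent q) (a : Oq q) : cotPair X (cls q a) = pair (X : Uq q) a := by
  change pair (X : Uq q) (plus q a : Oq q) = _
  have h : pair (X : Uq q) (1 : Oq q) = 0 := by
    rw [pair_apply, map_one]
    exact (LinearMap.convOne_apply _).trans (by simp [counit_of_mem_tangent X.2])
  rw [coe_plus, map_sub, Algebra.algebraMap_eq_smul_one, map_smul, h, smul_zero, sub_zero]

/-- The basis elements `e_γ` of `Λ¹`. -/
def cotE : PosRoot → Cot q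
  | .a1 => cls q (u 1 0)
  | .a2 => cls q (u 2 1)
  | .a12 => cls q (u 2 0)

/-- The basis elements `f_γ` of `Λ¹`. -/
def cotF : PosRoot → Cot q
  | .a1 => cls q (q.c • u 0 1)
  | .a2 => cls q (q.c • u 1 2)
  | .a12 => cls q (q.c ^ 2 • u 0 2)

theorem rootE_mem (γ : PosRoot) : rootE γ ∈ tangent q := Submodule.subset_span (Or.inl ⟨γ, rfl⟩)
theorem rootF_mem (γ : PosRoot) : rootF γ ∈ tangent q := Submodule.subset_span (Or.inr ⟨γ, rfl⟩)

theorem cotPair_E_E_self (γ : PosRoot) : cotPair ⟨rootE γ, rootE_mem γ⟩ (cotE (q := q) γ) = 1 := by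
  have hq := q.c_ne_zero
  cases γ <;> simp [cotE, cotPair_cls, rootE, vecGen, Matrix.single, Matrix.mul_apply]

theorem cotPair_E_E (β γ : PosRoot) (h : β ≠ γ) :
    cotPair ⟨rootE β, rootE_mem β⟩ (cotE (q := q) γ) = 0 := by
  cases β <;> cases γ <;>
    simp [cotE, cotPair_cls, rootE, vecGen, Matrix.single, Matrix.mul_apply] at h ⊢

theorem cotPair_E_F (β γ : PosRoot) :
    cotPair ⟨rootE β, rootE_mem β⟩ (cotF (q := q) γ) = 0 := by
  cases β <;> cases γ <;>
    simp [cotF, cotPair_cls, rootE, vecGen, Matrix.single, Matrix.mul_apply]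

theorem cotPair_F_E (β γ : PosRoot) :
    cotPair ⟨rootF β, rootF_mem β⟩ (cotE (q := q) γ) = 0 := by
  cases β <;> cases γ <;>
    simp [cotE, cotPair_cls, rootF, vecGen, Matrix.single, Matrix.mul_apply]

theorem cotPair_F_F_self (γ : PosRoot) : cotPair ⟨rootF γ, rootF_mem γ⟩ (cotF (q := q) γ) = 1 := by
  have hq := q.c_ne_zero
  cases γ <;> simp [cotF, cotPair_cls, rootF, vecGen, Matrix.single, Matrix.mul_apply, hq] <;>
    field_simp

theorem cotPair_F_F (β γ : PosRoot) (h : β ≠ γ) :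
    cotPair ⟨rootF β, rootF_mem β⟩ (cotF (q := q) γ) = 0 := by
  cases β <;> cases γ <;>
    simp [cotF, cotPair_cls, rootF, vecGen, Matrix.single, Matrix.mul_apply] at h ⊢

end Oq
end

noncomputable section

namespace Oq

open Uq

variable {q : DefParam}

/-! ### The first-order calculus `Ω¹_q(SU_3)` -/

variable (q) in
/-- The bimodule of one-forms `Ω¹_q(SU_3) = A ⊗ Λ¹`; its left `A`-module structure is the one on the
first tensor factor. -/
abbrev FormsA : Type := Oq q ⊗[ℂ] Cot q

/-- The right multiplication `(a ⊗ v) b = a b_(1) ⊗ v b_(2)`. -/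
def rmulA (ω : FormsA q) : Oq q →ₗ[ℂ] FormsA q :=
  TensorProduct.map (LinearMap.mul' ℂ (Oq q)) (TensorProduct.lift (cotMul q)) ∘ₗ
    (TensorProduct.tensorTensorTensorComm ℂ (Oq q) (Cot q) (Oq q) (Oq q)).toLinearMap ∘ₗ
    TensorProduct.mk ℂ (FormsA q) (Oq q ⊗[ℂ] Oq q) ω ∘ₗ Coalgebra.comul

variable (q) in
/-- The exterior derivative `d a = a_(1) ⊗ [a_(2)⁺]`. -/
def dA : Oq q →ₗ[ℂ] FormsA q := LinearMap.lTensor (Oq q) (cls q) ∘ₗ Coalgebra.comul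

variable (q) in
/-- The left coaction `a ⊗ v ↦ a_(1) ⊗ (a_(2) ⊗ v)`. -/
def coactA : FormsA q →ₗ[ℂ] Oq q ⊗[ℂ] FormsA q :=
  (TensorProduct.assoc ℂ (Oq q) (Oq q) (Cot q)).toLinearMap ∘ₗ
    LinearMap.rTensor (Cot q) Coalgebra.comul

/-- The action of `b_(1) ⊗ b_(2)` on `Ω¹_q(SU_3)` that underlies the right multiplication. -/
def rmulTen (ω : FormsA q) (t : Oq q ⊗[ℂ] Oq q) : FormsA q :=
  TensorProduct.map (LinearMap.mul' ℂ (Oq q)) (TensorProduct.lift (cotMul q))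
    (TensorProduct.tensorTensorTensorComm ℂ (Oq q) (Cot q) (Oq q) (Oq q) (ω ⊗ₜ t))

theorem rmulA_eq (ω : FormsA q) (b : Oq q) : rmulA ω b = rmulTen ω (Coalgebra.comul (R := ℂ) b) :=
  rfl

theorem rmulTen_tmul (a b c : Oq q) (v : Cot q) :
    rmulTen (a ⊗ₜ v) (b ⊗ₜ c) = (a * b) ⊗ₜ cotMul q v c := rfl

theorem rmulTen_add_left (ω η : FormsA q) (t) : rmulTen (ω + η) t = rmulTen ω t + rmulTen η t := by
  simp [rmulTen, TensorProduct.add_tmul]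

theorem rmulTen_add_right (ω : FormsA q) (s t) : rmulTen ω (s + t) = rmulTen ω s + rmulTen ω t := by
  simp [rmulTen, TensorProduct.tmul_add]

theorem rmulTen_zero_left (t) : rmulTen (0 : FormsA q) t = 0 := by
  simp [rmulTen]

theorem rmulTen_zero_right (ω : FormsA q) : rmulTen ω 0 = 0 := by
  simp [rmulTen]

theorem rmulTen_smul_left (a : Oq q) (ω : FormsA q) (t) :
    rmulTen (a • ω) t = a • rmulTen ω t := by
  induction ω using TensorProduct.induction_on with
  | zero => simp [rmulTen_zero_left]
  | add x y hx hy => rw [smul_add, rmulTen_add_left, rmulTen_add_left, hx, hy, smul_add]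
  | tmul b v =>
    induction t using TensorProduct.induction_on with
    | zero => simp [rmulTen_zero_right]
    | add x y hx hy => rw [rmulTen_add_right, rmulTen_add_right, hx, hy, smul_add]
    | tmul x y =>
      rw [TensorProduct.smul_tmul', rmulTen_tmul, rmulTen_tmul, TensorProduct.smul_tmul',
        smul_eq_mul, smul_eq_mul, mul_assoc]

theorem rmulA_smul_left (a : Oq q) (ω : FormsA q) (b : Oq q) :
    rmulA (a • ω) b = a • rmulA ω b := rmulTen_smul_left _ _ _

theorem rmulA_add_left (ω η : FormsA q) (b : Oq q) :
    rmulA (ω + η) b = rmulA ω b + rmulA η b := rmulTen_add_left _ _ _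

theorem rmulA_csmul_left (c : ℂ) (ω : FormsA q) (b : Oq q) :
    rmulA (c • ω) b = c • rmulA ω b := by
  rw [← algebraMap_smul (Oq q) c ω, rmulA_smul_left, algebraMap_smul]

theorem rmulA_zero_left (b : Oq q) : rmulA (0 : FormsA q) b = 0 := rmulTen_zero_left _

theorem lTensor_cls_mul (s t : Oq q ⊗[ℂ] Oq q) :
    LinearMap.lTensor (Oq q) (cls q) (s * t) = rmulTen (LinearMap.lTensor (Oq q) (cls q) s) t
      + (TensorProduct.rid ℂ (Oq q) (LinearMap.lTensor (Oq q) (Coalgebra.counit (R := ℂ)) s)) •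
        LinearMap.lTensor (Oq q) (cls q) t := by
  induction s using TensorProduct.induction_on with
  | zero => simp [rmulTen_zero_left]
  | add x y hx hy =>
    rw [add_mul, map_add, hx, hy, map_add, map_add, map_add, rmulTen_add_left, add_smul]
    abel
  | tmul a b =>
    induction t using TensorProduct.induction_on with
    | zero => simp [rmulTen_zero_right]
    | add x y hx hy =>
      rw [mul_add, map_add, hx, hy, map_add, rmulTen_add_right, smul_add]
      abel
    | tmul x y =>
      simp only [Algebra.TensorProduct.tmul_mul_tmul, LinearMap.lTensor_tmul, rmulTen_tmul,
        TensorProduct.rid_tmul, cls_mul, TensorProduct.tmul_add, TensorProduct.smul_tmul',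
        TensorProduct.tmul_smul, smul_eq_mul, smul_mul_assoc]

/-- The Leibniz rule `d(ab) = (da) b + a (db)`. -/
theorem dA_mul (a b : Oq q) : dA q (a * b) = rmulA (dA q a) b + a • dA q b := by
  rw [dA, LinearMap.comp_apply, Bialgebra.comul_mul, lTensor_cls_mul, rmulA_eq]
  simp

/-! ### The quantum flag manifold `O_q(F_3)` -/

/-- The left action `X ▷ a = a_(1) ⟨X, a_(2)⟩` of `U_q(sl_3)` on `O_q(SU_3)`. -/
def act (X : Uq q) : Oq q →ₗ[ℂ] Oq q :=
  (TensorProduct.rid ℂ (Oq q)).toLinearMap ∘ₗ LinearMap.lTensor (Oq q) (pair X) ∘ₗ Coalgebra.comul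

theorem pair_act (X Z : Uq q) (a : Oq q) : pair Z (act X a) = pair (Z * X) a := by
  have h : pair (Z * X) a = pairTwo q (comulHom q a) (Z ⊗ₜ X) := by
    rw [pairTwo_comulHom]; rfl
  rw [h]
  change pair Z (TensorProduct.rid ℂ (Oq q) (LinearMap.lTensor (Oq q) (pair X) (comulHom q a))) = _
  generalize comulHom q a = t
  induction t using TensorProduct.induction_on with
  | zero => simp
  | tmul x y => simp [mul_comm]
  | add s t hs ht =>
    rw [map_add, map_add, map_add, hs, ht, map_add, WithConv.ofConv_add, LinearMap.add_apply]

theorem act_mul (X Y : Uq q) (a : Oq q) : act (X * Y) a = act X (act Y a) :=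
  ext_pair fun Z => by simp only [pair_act, mul_assoc]

theorem act_add (X Y : Uq q) (a : Oq q) : act (X + Y) a = act X a + act Y a :=
  ext_pair fun Z => by
    simp only [pair_act, mul_add, map_add]
    simp [pair_apply]

theorem act_algebraMap (c : ℂ) (a : Oq q) : act (algebraMap ℂ _ c) a = c • a :=
  ext_pair fun Z => by
    rw [pair_act, map_smul, Algebra.algebraMap_eq_smul_one, mul_smul_comm, mul_one]
    simp [pair_apply]

theorem act_grouplike {X : Uq q} (hX : Coalgebra.comul (R := ℂ) X = X ⊗ₜ X) (a b : Oq q) :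
    act X (a * b) = act X a * act X b := by
  apply ext_pair
  intro Z
  rw [pair_act, pair_mul, pair_mul, Bialgebra.comul_mul, hX]
  generalize Coalgebra.comul (R := ℂ) Z = t
  induction t using TensorProduct.induction_on with
  | zero => rw [zero_mul, map_zero, map_zero]
  | tmul x y => simp [pair_act]
  | add s t hs ht => rw [add_mul, map_add, map_add, hs, ht]

variable (q) in
/-- The Hopf subalgebra `U_q(h)` generated by the `K_i^{±1}`. -/
def cartan : Subalgebra ℂ (Uq q) := Algebra.adjoin ℂ (Set.range K ∪ Set.range Kinv)

/-- An element is `U_q(h)`-invariant as soon as it is fixed by the `K_i^{±1}`. -/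
theorem invariant_iff (b : Oq q) :
    (∀ X ∈ cartan q, act X b = Coalgebra.counit (R := ℂ) X • b) ↔
      (∀ i, act (K i) b = b) ∧ ∀ i, act (Kinv i) b = b := by
  constructor
  · intro h
    constructor <;> intro i
    · rw [h _ (Algebra.subset_adjoin (Or.inl ⟨i, rfl⟩)), counit_K, one_smul]
    · rw [h _ (Algebra.subset_adjoin (Or.inr ⟨i, rfl⟩)), counit_Kinv, one_smul]
  · rintro ⟨h1, h2⟩ X hX
    induction hX using Algebra.adjoin_induction with
    | mem x hx => rcases hx with ⟨i, rfl⟩ | ⟨i, rfl⟩ <;> simp [h1, h2]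
    | algebraMap c => rw [act_algebraMap]; simp
    | add x y _ _ hx hy => rw [act_add, hx, hy, map_add, add_smul]
    | mul x y _ _ hx hy =>
      rw [act_mul, hy, map_smul, hx, smul_smul, Bialgebra.counit_mul, mul_comm]

variable (q) in
/-- The full quantum flag manifold `O_q(F_3)`, the subalgebra of `U_q(h)`-invariants
`{b : X ▷ b = ε(X) b for all X ∈ U_q(h)}` of `O_q(SU_3)`. -/
def flag : Subalgebra ℂ (Oq q) where
  carrier := {b | ∀ X ∈ cartan q, act X b = Coalgebra.counit (R := ℂ) X • b}
  mul_mem' {a b} ha hb := by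
    simp only [Set.mem_ofPred_eq, invariant_iff] at ha hb ⊢
    exact ⟨fun i => by rw [act_grouplike (comul_K i), ha.1, hb.1],
      fun i => by rw [act_grouplike (comul_Kinv i), ha.2, hb.2]⟩
  add_mem' {a b} ha hb X hX := by rw [map_add, ha X hX, hb X hX, smul_add]
  algebraMap_mem' c X hX := by
    apply ext_pair
    intro Z
    rw [pair_act, map_smul]
    have h : ∀ Y : Uq q, pair Y (algebraMap ℂ (Oq q) c) = c * Coalgebra.counit (R := ℂ) Y := by
      intro Y
      rw [Algebra.algebraMap_eq_smul_one, map_smul, pair_apply, map_one]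
      exact congrArg _ ((LinearMap.convOne_apply _).trans (by simp))
    rw [h, h, Bialgebra.counit_mul, smul_eq_mul]
    ring

theorem mem_flag {b : Oq q} : b ∈ flag q ↔
    ∀ X ∈ cartan q, act X b = Coalgebra.counit (R := ℂ) X • b := Iff.rfl

theorem mem_flag_iff {b : Oq q} :
    b ∈ flag q ↔ (∀ i, act (K i) b = b) ∧ ∀ i, act (Kinv i) b = b := invariant_iff b

theorem star_mem_flag {b : Oq q} (hb : b ∈ flag q) : star q b ∈ flag q := by
  rw [mem_flag_iff] at hb ⊢
  constructor <;> intro i <;> apply ext_pair <;> intro Z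
  · rw [pair_act, pair_star, theta_mul, theta_K, ← pair_act, hb.2, pair_star]
  · rw [pair_act, pair_star, theta_mul, theta_Kinv, ← pair_act, hb.1, pair_star]

/-- The involution of `O_q(F_3)`. -/
def starB (b : flag q) : flag q := ⟨star q b, star_mem_flag b.2⟩

/-! ### The first-order calculus `Ω¹_q(F_3)` -/

variable (q) in
/-- The restriction `Ω¹_q(F_3)` of the calculus `Ω¹_q(SU_3)` to `B = O_q(F_3)`: the span of the
one-forms `b db'` with `b, b' ∈ B`. -/
def forms : Submodule ℂ (FormsA q) :=
  Submodule.span ℂ {ω | ∃ b b' : flag q, ω = (b : Oq q) • dA q b'}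

theorem smul_dA_mem (b b' : flag q) : (b : Oq q) • dA q b' ∈ forms q :=
  Submodule.subset_span ⟨b, b', rfl⟩

theorem smul_mem_forms (b : flag q) {ω : FormsA q} (h : ω ∈ forms q) :
    (b : Oq q) • ω ∈ forms q := by
  induction h using Submodule.span_induction with
  | mem x hx =>
    obtain ⟨b', b'', rfl⟩ := hx
    rw [smul_smul]
    exact smul_dA_mem (b * b') b''
  | zero => simp
  | add x y _ _ hx hy => rw [smul_add]; exact Submodule.add_mem _ hx hy
  | smul c x _ hx => rw [smul_comm]; exact Submodule.smul_mem _ _ hx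

theorem rmulA_mem_forms (b : flag q) {ω : FormsA q} (h : ω ∈ forms q) :
    rmulA ω b ∈ forms q := by
  induction h using Submodule.span_induction with
  | mem x hx =>
    obtain ⟨b', b'', rfl⟩ := hx
    have h : rmulA (dA q b'') (b : Oq q) = dA q (b'' * b : flag q) - (b'' : Oq q) • dA q b := by
      rw [Subalgebra.coe_mul, dA_mul, add_sub_cancel_right]
    rw [rmulA_smul_left, h, smul_sub, smul_smul]
    exact Submodule.sub_mem _ (smul_dA_mem b' (b'' * b)) (smul_dA_mem (b' * b'') b)
  | zero => rw [rmulA_zero_left]; exact Submodule.zero_mem _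
  | add x y _ _ hx hy => rw [rmulA_add_left]; exact Submodule.add_mem _ hx hy
  | smul c x _ hx => rw [rmulA_csmul_left]; exact Submodule.smul_mem _ _ hx

variable (q) in
/-- The space `Ω¹_q(F_3)` as a type. -/
def FormsB : Type := forms q

instance : AddCommGroup (FormsB q) := inferInstanceAs (AddCommGroup (forms q))
instance : Module ℂ (FormsB q) := inferInstanceAs (Module ℂ (forms q))

variable (q) in
/-- The inclusion of `Ω¹_q(F_3)` into `Ω¹_q(SU_3)`. -/
def incl : FormsB q →ₗ[ℂ] FormsA q := (forms q).subtype

theorem incl_injective : Function.Injective (incl q) := Subtype.val_injective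

theorem incl_mem (ω : FormsB q) : incl q ω ∈ forms q := ω.2

/-- An element of the span of the `b db'` as an element of `Ω¹_q(F_3)`. -/
def FormsB.mk (ω : FormsA q) (h : ω ∈ forms q) : FormsB q := ⟨ω, h⟩

@[simp] theorem incl_mk (ω : FormsA q) (h : ω ∈ forms q) : incl q (FormsB.mk ω h) = ω := rfl

/-- The one-form `db` of `Ω¹_q(F_3)`. -/
def dB (b : flag q) : FormsB q :=
  FormsB.mk (dA q b) (by simpa using smul_dA_mem (1 : flag q) b)

/-- Left multiplication on `Ω¹_q(F_3)`. -/
def lmulB (b : flag q) (ω : FormsB q) : FormsB q :=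
  FormsB.mk ((b : Oq q) • incl q ω) (smul_mem_forms b (incl_mem ω))

/-- Right multiplication on `Ω¹_q(F_3)`. -/
def rmulB (ω : FormsB q) (b : flag q) : FormsB q :=
  FormsB.mk (rmulA (incl q ω) b) (rmulA_mem_forms b (incl_mem ω))

/-- A `*`-structure of the calculus `Ω¹_q(F_3)`: a conjugate-linear involution that extends the
involution of `O_q(F_3)` and is compatible with `d` and the bimodule structure. -/
structure IsFormStar (σ : FormsB q →ₛₗ[starRingEnd ℂ] FormsB q) : Prop where
  star_star : ∀ ω, σ (σ ω) = ω
  star_d : ∀ b, σ (dB b) = dB (starB b)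
  star_lmul : ∀ b ω, σ (lmulB b ω) = rmulB (σ ω) (starB b)
  star_rmul : ∀ ω b, σ (rmulB ω b) = lmulB (starB b) (σ ω)

/-! ### The cotangent space of `O_q(F_3)` -/

variable (q) in
/-- The subspace `B⁺ Ω¹_q(F_3)` for `B = O_q(F_3)` and `B⁺ = B ∩ ker ε`. -/
def augForms : Submodule ℂ (FormsB q) :=
  Submodule.span ℂ {ω | ∃ b : flag q, (b : Oq q) ∈ aug q ∧ ∃ η, ω = lmulB b η}

variable (q) in
/-- The cotangent space `V¹ = Ω¹_q(F_3) / B⁺ Ω¹_q(F_3)`. -/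
abbrev CotB : Type := FormsB q ⧸ augForms q

variable (q) in
/-- The map `ε ⊗ id : Ω¹_q(SU_3) = A ⊗ Λ¹ → Λ¹`. -/
def evalA : FormsA q →ₗ[ℂ] Cot q :=
  (TensorProduct.lid ℂ (Cot q)).toLinearMap ∘ₗ LinearMap.rTensor (Cot q) Coalgebra.counit

theorem evalA_smul (a : Oq q) (ω : FormsA q) :
    evalA q (a • ω) = Coalgebra.counit (R := ℂ) a • evalA q ω := by
  induction ω using TensorProduct.induction_on with
  | zero => simp
  | tmul b v => simp [evalA, TensorProduct.smul_tmul', mul_smul]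
  | add x y hx hy => rw [smul_add, map_add, hx, hy, map_add, smul_add]

theorem evalA_dA (a : Oq q) : evalA q (dA q a) = cls q a := by
  have h : ∀ t : Oq q ⊗[ℂ] Oq q, evalA q (LinearMap.lTensor (Oq q) (cls q) t) =
      cls q (TensorProduct.lid ℂ (Oq q) (LinearMap.rTensor (Oq q) (Coalgebra.counit (R := ℂ)) t)) := by
    intro t
    induction t using TensorProduct.induction_on with
    | zero => simp
    | tmul b v => simp [evalA]
    | add x y hx hy => simp only [map_add, hx, hy]
  rw [dA, LinearMap.comp_apply, h]
  simp

variable (q) in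
/-- The canonical map `V¹ → Λ¹`, `[b db'] ↦ ε(b) [b'⁺]`, which identifies the two cotangent
spaces. -/
def cotMap : CotB q →ₗ[ℂ] Cot q :=
  (augForms q).liftQ (evalA q ∘ₗ incl q) (by
    rw [augForms, Submodule.span_le]
    rintro _ ⟨b, hb, η, rfl⟩
    change evalA q ((b : Oq q) • incl q η) = 0
    rw [evalA_smul, mem_aug.mp hb, zero_smul])

theorem cotMap_mk (b b' : flag q) :
    cotMap q ((augForms q).mkQ (lmulB b (dB b'))) =
      Coalgebra.counit (R := ℂ) (b : Oq q) • cls q (b' : Oq q) := by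
  change evalA q ((b : Oq q) • dA q (b' : Oq q)) = _
  rw [evalA_smul, evalA_dA]

/-- The subspace of `V¹` (as a subspace of `Λ¹`) determined by a subspace of `Ω¹_q(F_3)`. -/
def cotSub (N : Submodule ℂ (FormsB q)) : Submodule ℂ (Cot q) :=
  (N.map (augForms q).mkQ).map (cotMap q)

/-! ### Covariant first-order almost complex structures -/

/-- A `B`-subbimodule of `Ω¹_q(F_3)`. -/
structure IsSubBimodule (N : Submodule ℂ (FormsB q)) : Prop where
  lmul_mem : ∀ b, ∀ ω ∈ N, lmulB b ω ∈ N
  rmul_mem : ∀ b, ∀ ω ∈ N, rmulB ω b ∈ N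

/-- A left `O_q(SU_3)`-subcomodule of `Ω¹_q(F_3)`: the coaction maps `N` into `A ⊗ N`. -/
def IsSubComodule (N : Submodule ℂ (FormsB q)) : Prop :=
  ∀ ω ∈ N, coactA q (incl q ω) ∈
    LinearMap.range (LinearMap.lTensor (Oq q) (incl q ∘ₗ N.subtype))

/-- A left `O_q(SU_3)`-covariant first-order almost complex structure
`Ω¹_q(F_3) = Ω^{(1,0)} ⊕ Ω^{(0,1)}`, given as the pair `(Ω^{(1,0)}, Ω^{(0,1)})`. -/
structure IsCovariantFoacs (σ : FormsB q →ₛₗ[starRingEnd ℂ] FormsB q)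
    (P : Submodule ℂ (FormsB q) × Submodule ℂ (FormsB q)) : Prop where
  bimodule_fst : IsSubBimodule P.1
  bimodule_snd : IsSubBimodule P.2
  isCompl : IsCompl P.1 P.2
  star_eq : P.1.map σ = P.2
  comodule_fst : IsSubComodule P.1
  comodule_snd : IsSubComodule P.2

end Oq
end

/-! ### Roots, and the weights of the root vectors -/

noncomputable section

/-! Write A for O_q(SU_3), B for O_q(F_3), and X_γ for the six root vectors, with γ running over the
roots. A one-form on A is a tuple of coefficients in A along the basis of Λ¹ dual to the X_γ, and
the γ-coefficient of da is X_γ ▷ a (`comp_dA`). Since X_γ is a weight vector for the K_i and B is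
the weight zero part of A, the γ-coefficient of a form on B has weight γ.

This condition is also sufficient (`forms_eq`). There is b in B whose class is e_γ
(`exists_flag_cls_eq`), and applying S(ω_(-1)) ω_(0) to ω = db writes 1 ⊗ e_γ as an A-combination of
forms on B. Comparing weights, the coefficients may be chosen of weight -γ. Multiplying by a of
weight γ then brings them into B, and into B⁺ if ε(a) = 0. So Ω¹ of the flag manifold is the sum
over γ of A_γ ⊗ e_γ, and the same argument identifies V¹ with Λ¹ (`cotMap_bijective`).

Let N be a left B-submodule and left A-subcomodule. Its image in Λ¹ is stable under the weight
operators. As q is real and |q| is neither 0 nor 1, the six weights are distinct, so the image is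
spanned by basis vectors. The coaction and the argument above recover N from the image: N consists
of the forms with coefficients supported on a set S of roots (`eq_coordForms`).

Right multiplication decides which S occur. It is diagonal on Λ¹ except that the middle term of the
coproduct of E_{α₁+α₂} sends e_{α₁} partly into e_{α₁+α₂}, and likewise for the f's. The factor q -
q⁻¹ is nonzero, so the form space of S is a bimodule exactly if ±α₁ in S forces ±(α₁+α₂) in S, sign
by sign (`IsClosedSet`).

For the involution, (da)^* has coefficients (θ(X_γ) ▷ a)^*. Although θ does not preserve T, each
θ(X_γ) lies in the left ideal generated by T, and explicit left multipliers define the involution on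
all forms (`starComp`). Up to a term at ∓α₁ that closedness absorbs, it exchanges γ and -γ, so it
takes the forms of a closed S to those of -S. An almost complex structure is thus a closed S whose
complement is -S: one sign for each positive root, where the sign of α₁+α₂ equals that of α₁. The
free signs of α₁ and α₂ give four structures, in two opposite pairs. -/

instance : DecidableEq PosRoot := fun a b => by
  cases a <;> cases b <;> first | exact isTrue rfl | exact isFalse (by simp)

instance : Fintype PosRoot := ⟨{.a1, .a2, .a12}, fun a => by cases a <;> simp⟩

/-- The roots of `sl_3`; `inl γ` stands for `γ` and `inr γ` for `-γ`. -/
abbrev Root : Type := PosRoot ⊕ PosRoot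

namespace Uq

variable {q : DefParam}

/-- The basis vectors of the quantum tangent space. -/
def rootVec : Root → Uq q := Sum.elim rootE rootF

theorem rootVec_mem (γ : Root) : rootVec γ ∈ tangent q := by
  rcases γ with γ | γ
  · exact Submodule.subset_span (Or.inl ⟨γ, rfl⟩)
  · exact Submodule.subset_span (Or.inr ⟨γ, rfl⟩)

/-- The pairing of a positive root with a simple coroot. -/
def posWeight : PosRoot → Fin 2 → ℤ
  | .a1, i => cartanA2 i 0
  | .a2, i => cartanA2 i 1
  | .a12, i => cartanA2 i 0 + cartanA2 i 1

/-- The pairing of a root with a simple coroot. -/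
def intWeight : Root → Fin 2 → ℤ
  | .inl γ, i => posWeight γ i
  | .inr γ, i => -posWeight γ i

variable (q) in
/-- The weight of a root vector under the conjugation by the `K_i`. -/
def weight (γ : Root) (i : Fin 2) : ℂ := q.c ^ intWeight γ i

theorem weight_ne_zero (γ : Root) (i : Fin 2) : weight q γ i ≠ 0 := zpow_ne_zero _ q.c_ne_zero

/-- Distinct integer powers of q differ because |q| is neither 0 nor 1; absolute values also cover
negative q. It remains that the pairings with the two simple coroots separate the six roots. This is
what later splits subspaces of Λ¹ into coordinate lines. -/
theorem weight_injective : Function.Injective (weight q) := by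
  have h0 : 0 < |q.val| := abs_pos.mpr q.ne_zero
  have h1 : |q.val| ≠ 1 := by
    intro h
    rcases (abs_eq (by norm_num)).mp h with h | h
    · exact q.ne_one h
    · exact q.ne_neg_one h
  have hinj : ∀ m n : ℤ, q.c ^ m = q.c ^ n → m = n := by
    intro m n h
    have : |q.val| ^ m = |q.val| ^ n := by
      have h' : q.val ^ m = q.val ^ n := by
        simp only [DefParam.c] at h
        exact_mod_cast h
      rw [← abs_zpow, ← abs_zpow, h']
    exact zpow_right_injective₀ h0 h1 this
  intro β γ h
  have e0 := hinj _ _ (congrFun h 0)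
  have e1 := hinj _ _ (congrFun h 1)
  rcases β with β | β <;> rcases γ with γ | γ <;> cases β <;> cases γ <;>
    simp [intWeight, posWeight, cartanA2] at e0 e1 ⊢

theorem K_mul_mul {i : Fin 2} {x y : Uq q} {c d : ℂ} (hx : K i * x = c • (x * K i))
    (hy : K i * y = d • (y * K i)) : K i * (x * y) = (c * d) • (x * y * K i) := by
  rw [← mul_assoc, hx, smul_mul_assoc, mul_assoc, hy, mul_smul_comm, smul_smul, mul_assoc]

/-- Weights multiply along products, and the two monomials in a root vector for α₁+α₂ have the same
weight. -/
theorem K_mul_rootVec (i : Fin 2) (γ : Root) :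
    (K i * rootVec γ : Uq q) = weight q γ i • (rootVec γ * K i) := by
  have hF : ∀ j, (K i * (K j * F j) : Uq q) = q.c ^ (-cartanA2 i j) • (K j * F j * K i) := by
    intro j
    rw [K_mul_mul (c := 1) (by rw [one_smul, K_mul_K]) (K_mul_F i j), one_mul]
  have hc : q.c ^ cartanA2 i 1 * q.c ^ cartanA2 i 0 = q.c ^ (cartanA2 i 0 + cartanA2 i 1) := by
    rw [← zpow_add₀ q.c_ne_zero, add_comm]
  have hc' : q.c ^ (-cartanA2 i 1) * q.c ^ (-cartanA2 i 0) =
      q.c ^ (-(cartanA2 i 0 + cartanA2 i 1)) := by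
    rw [← zpow_add₀ q.c_ne_zero, neg_add, add_comm]
  rcases γ with γ | γ <;> cases γ
  · exact K_mul_E i 0
  · exact K_mul_E i 1
  · simp only [rootVec, rootE, Sum.elim_inl, mul_sub, mul_smul_comm, sub_mul, smul_mul_assoc,
      weight, intWeight, posWeight]
    rw [K_mul_mul (K_mul_E i 1) (K_mul_E i 0), K_mul_mul (K_mul_E i 0) (K_mul_E i 1),
      mul_comm (q.c ^ cartanA2 i 0), hc, smul_sub, smul_comm q.c⁻¹]
  · exact hF 0
  · exact hF 1
  · simp only [rootVec, rootF_a12_eq, Sum.elim_inr, mul_sub, mul_smul_comm, sub_mul,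
      smul_mul_assoc, weight, intWeight, posWeight]
    simp only [rootF]
    rw [K_mul_mul (hF 1) (hF 0), K_mul_mul (hF 0) (hF 1),
      mul_comm (q.c ^ (-cartanA2 i 0)), hc', smul_sub, smul_comm q.c⁻¹]

end Uq

/-! ### The action on `O_q(SU_3)` and the coordinates of one-forms -/

namespace Oq

open Uq

variable {q : DefParam}

theorem act_one (a : Oq q) : act 1 a = a := by
  simpa using act_algebraMap (q := q) 1 a

theorem act_smul (c : ℂ) (X : Uq q) (a : Oq q) : act (c • X) a = c • act X a := by
  rw [← one_mul X, ← smul_mul_assoc, act_mul, ← Algebra.algebraMap_eq_smul_one, act_algebraMap,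
    one_mul]

theorem act_neg (X : Uq q) (a : Oq q) : act (-X) a = -act X a := by
  rw [← neg_one_smul ℂ, act_smul, neg_one_smul]

theorem pair_add (X Y : Uq q) (a : Oq q) : pair (X + Y) a = pair X a + pair Y a := by
  simp [pair_apply]

theorem pair_smul (c : ℂ) (X : Uq q) (a : Oq q) : pair (c • X) a = c * pair X a := by
  simp [pair_apply]

theorem pair_one_act (X : Uq q) (a : Oq q) : pair 1 (act X a) = pair X a := by
  rw [pair_act, one_mul]

variable (q) in
/-- The product `act X a * act Y b`, extended linearly in `X ⊗ Y`. -/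
def actTwo (a b : Oq q) : Uq q ⊗[ℂ] Uq q →ₗ[ℂ] Oq q :=
  TensorProduct.lift <| LinearMap.mk₂ ℂ (fun X Y => act X a * act Y b)
    (fun X X' Y => by rw [act_add, add_mul])
    (fun c X Y => by rw [act_smul, smul_mul_assoc])
    (fun X Y Y' => by rw [act_add, mul_add])
    (fun c X Y => by rw [act_smul, mul_smul_comm])

@[simp] theorem actTwo_tmul (a b : Oq q) (X Y : Uq q) :
    actTwo q a b (X ⊗ₜ Y) = act X a * act Y b := rfl

/-- The action on a product, `X ▷ (ab) = (X_(1) ▷ a)(X_(2) ▷ b)`. -/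
theorem act_mul_apply (X : Uq q) (a b : Oq q) :
    act X (a * b) = actTwo q a b (Coalgebra.comul (R := ℂ) X) := by
  apply ext_pair
  intro Z
  -- The statement is linear in the coproduct of X, so it is proved with an arbitrary tensor `s` in
  -- its place.
  have h : ∀ s : Uq q ⊗[ℂ] Uq q, pairTwo q (a ⊗ₜ b) (Coalgebra.comul (R := ℂ) Z * s) =
      pair Z (actTwo q a b s) := by
    intro s
    induction s using TensorProduct.induction_on with
    | zero => rw [mul_zero, map_zero, map_zero, map_zero]
    | add s t hs ht => rw [mul_add, map_add, hs, ht, map_add, map_add]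
    | tmul X Y =>
      rw [actTwo_tmul, pair_mul]
      generalize Coalgebra.comul (R := ℂ) Z = t
      induction t using TensorProduct.induction_on with
      | zero => rw [zero_mul, map_zero, map_zero]
      | tmul x y => simp [pair_act]
      | add s t hs ht => rw [add_mul, map_add, map_add, hs, ht]
  rw [pair_act, pair_mul, Bialgebra.comul_mul, h]

theorem act_E_mul (i : Fin 2) (a b : Oq q) :
    act (E i) (a * b) = act (E i) a * act (K i) b + a * act (E i) b := by
  rw [act_mul_apply, comul_E, map_add, actTwo_tmul, actTwo_tmul, act_one]

theorem act_F_mul (i : Fin 2) (a b : Oq q) :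
    act (F i) (a * b) = act (F i) a * b + act (Kinv i) a * act (F i) b := by
  rw [act_mul_apply, comul_F, map_add, actTwo_tmul, actTwo_tmul, act_one]

theorem act_K_mul (i : Fin 2) (a b : Oq q) :
    act (K i) (a * b) = act (K i) a * act (K i) b := act_grouplike (comul_K i) a b

theorem act_Kinv_mul (i : Fin 2) (a b : Oq q) :
    act (Kinv i) (a * b) = act (Kinv i) a * act (Kinv i) b := act_grouplike (comul_Kinv i) a b

/-- The action on adjoints. -/
theorem act_star (X : Uq q) (a : Oq q) : act X (star q a) = star q (act (theta q X) a) :=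
  ext_pair fun Z => by rw [pair_act, pair_star, theta_mul, pair_star, pair_act]

/-- The pairing of `Λ¹` with a root vector. -/
def coord (γ : Root) : Cot q →ₗ[ℂ] ℂ := cotPair ⟨rootVec γ, rootVec_mem γ⟩

theorem coord_cls (γ : Root) (a : Oq q) : coord γ (cls q a) = pair (rootVec γ) a :=
  cotPair_cls _ a

/-- The basis `e_γ, f_γ` of `Λ¹`. -/
def cotVec : Root → Cot q := Sum.elim cotE cotF

theorem coord_cotVec (β γ : Root) : coord β (cotVec γ : Cot q) = if β = γ then 1 else 0 := by
  rcases β with β | β <;> rcases γ with γ | γ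
  · by_cases h : β = γ
    · subst h; rw [if_pos rfl]; exact cotPair_E_E_self β
    · rw [if_neg (by simpa using h)]; exact cotPair_E_E β γ h
  · rw [if_neg (by simp)]; exact cotPair_E_F β γ
  · rw [if_neg (by simp)]; exact cotPair_F_E β γ
  · by_cases h : β = γ
    · subst h; rw [if_pos rfl]; exact cotPair_F_F_self β
    · rw [if_neg (by simpa using h)]; exact cotPair_F_F β γ h

/-- The subspace I divided out of A⁺ is the annihilator of T, and the root vectors span T. -/
theorem cot_ext {v w : Cot q} (h : ∀ γ, coord γ v = coord γ w) : v = w := by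
  rw [← sub_eq_zero]
  obtain ⟨y, hy⟩ := cotMk_surjective (v - w)
  have h' : ∀ γ, pair (rootVec γ) (y : Oq q) = 0 := fun γ => by
    rw [← coord_cls, cls_coe, hy, map_sub, h, sub_self]
  rw [← hy, cotMk_eq_zero]
  intro X hX
  induction hX using Submodule.span_induction with
  | mem x hx =>
    rcases hx with ⟨γ, rfl⟩ | ⟨γ, rfl⟩
    · exact h' (.inl γ)
    · exact h' (.inr γ)
  | zero => simp [pair_apply]
  | add x y _ _ h1 h2 => rw [pair_add, h1, h2, add_zero]
  | smul c x _ h => rw [pair_smul, h, mul_zero]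

theorem sum_coord_smul (v : Cot q) : ∑ γ, coord γ v • cotVec γ = v := by
  apply cot_ext
  intro β
  simp only [map_sum, map_smul, coord_cotVec, smul_eq_mul, mul_ite, mul_one, mul_zero,
    Finset.sum_ite_eq, Finset.mem_univ, if_true]

/-- The coefficient of a one-form with respect to a basis vector of `Λ¹`. -/
def comp (γ : Root) : FormsA q →ₗ[ℂ] Oq q :=
  (TensorProduct.rid ℂ (Oq q)).toLinearMap ∘ₗ LinearMap.lTensor (Oq q) (coord γ)

@[simp] theorem comp_tmul (γ : Root) (a : Oq q) (v : Cot q) :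
    comp γ (a ⊗ₜ v) = coord γ v • a := by simp [comp]

theorem sum_comp_tmul (ω : FormsA q) : ∑ γ, comp γ ω ⊗ₜ cotVec γ = ω := by
  induction ω using TensorProduct.induction_on with
  | zero => simp
  | tmul a v =>
    conv_rhs => rw [← sum_coord_smul v, TensorProduct.tmul_sum]
    simp only [comp_tmul, TensorProduct.smul_tmul]
  | add x y hx hy =>
    conv_rhs => rw [← hx, ← hy]
    simp only [map_add, TensorProduct.add_tmul, Finset.sum_add_distrib]

theorem forms_ext {ω η : FormsA q} (h : ∀ γ, comp γ ω = comp γ η) : ω = η := by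
  rw [← sum_comp_tmul ω, ← sum_comp_tmul η]
  simp only [h]

theorem comp_smul (γ : Root) (a : Oq q) (ω : FormsA q) : comp γ (a • ω) = a * comp γ ω := by
  induction ω using TensorProduct.induction_on with
  | zero => simp
  | tmul b v => simp [TensorProduct.smul_tmul']
  | add x y hx hy => rw [smul_add, map_add, hx, hy, map_add, mul_add]

/-- The link between the calculus and the action: questions about one-forms become questions about
U_q(sl_3) acting on A. -/
theorem comp_dA (γ : Root) (a : Oq q) : comp γ (dA q a) = act (rootVec γ) a := by
  have h : ∀ t : Oq q ⊗[ℂ] Oq q, comp γ (LinearMap.lTensor (Oq q) (cls q) t) =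
      TensorProduct.rid ℂ (Oq q) (LinearMap.lTensor (Oq q) (pair (rootVec γ)) t) := by
    intro t
    induction t using TensorProduct.induction_on with
    | zero => simp
    | tmul b v => simp [coord_cls]
    | add x y hx hy => simp only [map_add, hx, hy]
  exact h _

theorem coord_evalA (γ : Root) (ω : FormsA q) : coord γ (evalA q ω) = pair 1 (comp γ ω) := by
  induction ω using TensorProduct.induction_on with
  | zero => simp
  | tmul a v => simp [evalA, counit_eq, mul_comm]
  | add x y hx hy => simp only [map_add, hx, hy]

/-! ### The right multiplication in coordinates -/

/-- Right multiplication on Λ¹ is read off from coproducts of root vectors. The subtracted term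
removes the contribution of 1 ⊗ X_γ. -/
theorem coord_cotMul_cls (γ : Root) (a b : Oq q) : coord γ (cotMul q (cls q a) b) =
    pairTwo q (a ⊗ₜ b) (Coalgebra.comul (R := ℂ) (rootVec γ)) - pair 1 a * pair (rootVec γ) b := by
  have h := cls_mul a b
  rw [eq_comm, ← eq_sub_iff_add_eq] at h
  rw [h, map_sub, map_smul, coord_cls, coord_cls, pair_mul, counit_eq, smul_eq_mul]

theorem cls_surjective : Function.Surjective (cls q) := by
  intro v
  obtain ⟨y, rfl⟩ := cotMk_surjective v
  exact ⟨y, cls_coe y⟩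

/-- The group-like element by which a root vector is skew-primitive up to lower terms. -/
def rootK : PosRoot → Uq q
  | .a1 => K 0
  | .a2 => K 1
  | .a12 => K 0 * K 1

/-- E_i is skew-primitive, so once 1 ⊗ E_i has cancelled only E_i ⊗ K_i is left and right
multiplication acts by a scalar on this coordinate. -/
theorem coord_cotMul_E (i : Fin 2) (γ : PosRoot) (hγ : (rootE γ : Uq q) = E i)
    (hK : (rootK γ : Uq q) = K i) (v : Cot q) (b : Oq q) :
    coord (.inl γ) (cotMul q v b) = coord (.inl γ) v * pair (rootK γ) b := by
  obtain ⟨a, rfl⟩ := cls_surjective v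
  rw [coord_cotMul_cls, coord_cls, show (rootVec (.inl γ) : Uq q) = E i from hγ, comul_E, map_add,
    pairTwo_tmul, pairTwo_tmul, add_sub_cancel_right, hK]

theorem coord_cotMul_F (i : Fin 2) (γ : PosRoot) (hγ : (rootF γ : Uq q) = K i * F i)
    (hK : (rootK γ : Uq q) = K i) (v : Cot q) (b : Oq q) :
    coord (.inr γ) (cotMul q v b) = coord (.inr γ) v * pair (rootK γ) b := by
  obtain ⟨a, rfl⟩ := cls_surjective v
  rw [coord_cotMul_cls, coord_cls, show (rootVec (.inr γ) : Uq q) = K i * F i from hγ,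
    comul_K_mul_F, map_add, pairTwo_tmul, pairTwo_tmul, add_sub_cancel_right, hK]

/-- The middle term E_{α₁} ⊗ E_2 K_1 of the coproduct makes the α₁-coordinate contribute to the
α₁+α₂ one. No such term starts from E_{α₂}; this asymmetry is why the sign of α₂ stays free in the
classification. -/
theorem coord_cotMul_E12 (v : Cot q) (b : Oq q) :
    coord (.inl .a12) (cotMul q v b) = coord (.inl .a12) v * pair (rootK .a12) b +
      (q.c⁻¹ * (q.c - q.c⁻¹)) * (coord (.inl .a1) v * pair (E 1 * K 0) b) := by
  obtain ⟨a, rfl⟩ := cls_surjective v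
  rw [coord_cotMul_cls, coord_cls, coord_cls, rootVec, Sum.elim_inl, comul_rootE_a12, map_add,
    map_add, map_smul, pairTwo_tmul, pairTwo_tmul, pairTwo_tmul, add_sub_cancel_right]
  rfl

theorem coord_cotMul_F12 (v : Cot q) (b : Oq q) :
    coord (.inr .a12) (cotMul q v b) = coord (.inr .a12) v * pair (rootK .a12) b +
      (q.c - q.c⁻¹) * (coord (.inr .a1) v * pair (K 1 * F 1 * K 0) b) := by
  obtain ⟨a, rfl⟩ := cls_surjective v
  rw [coord_cotMul_cls, coord_cls, coord_cls, rootVec, Sum.elim_inr, comul_rootF_a12, map_add,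
    map_add, map_smul, pairTwo_tmul, pairTwo_tmul, pairTwo_tmul, add_sub_cancel_right]
  rfl

theorem act_eq (X : Uq q) (b : Oq q) : act X b =
    TensorProduct.rid ℂ (Oq q) (LinearMap.lTensor (Oq q) (pair X) (Coalgebra.comul b)) := rfl

/-- A formula for the right multiplication of `Λ¹` yields one for the calculus. -/
theorem comp_rmulA_of {γ β : Root} {X Y : Uq q} {c : ℂ}
    (h : ∀ (v : Cot q) (b : Oq q), coord γ (cotMul q v b) =
      coord γ v * pair X b + c * (coord β v * pair Y b)) (ω : FormsA q) (b : Oq q) :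
    comp γ (rmulA ω b) = comp γ ω * act X b + c • (comp β ω * act Y b) := by
  rw [rmulA_eq, act_eq, act_eq]
  generalize (Coalgebra.comul (R := ℂ) b) = t
  induction ω using TensorProduct.induction_on with
  | zero => simp [rmulTen_zero_left]
  | add x y hx hy =>
    rw [rmulTen_add_left, map_add, hx, hy, map_add, map_add, add_mul, add_mul, smul_add]
    abel
  | tmul a v =>
    induction t using TensorProduct.induction_on with
    | zero => simp [rmulTen_zero_right]
    | add x y hx hy =>
      rw [rmulTen_add_right, map_add, hx, hy, map_add, map_add, map_add, map_add, mul_add,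
        mul_add, smul_add]
      abel
    | tmul x y =>
      simp only [rmulTen_tmul, comp_tmul, h, LinearMap.lTensor_tmul, TensorProduct.rid_tmul,
        smul_mul_assoc, mul_smul_comm, smul_smul, add_smul]
      rw [mul_comm (pair X y)]
      congr 2
      ring

theorem comp_rmulA_of' {γ : Root} {X : Uq q}
    (h : ∀ (v : Cot q) (b : Oq q), coord γ (cotMul q v b) = coord γ v * pair X b)
    (ω : FormsA q) (b : Oq q) : comp γ (rmulA ω b) = comp γ ω * act X b := by
  -- With `c = 0` the second term drops out, so the choices of `β` and `Y` are immaterial.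
  have := comp_rmulA_of (γ := γ) (β := γ) (X := X) (Y := X) (c := 0)
    (fun v b => by rw [h, zero_mul, add_zero]) ω b
  simpa using this

theorem comp_rmulA_E1 (ω : FormsA q) (b : Oq q) :
    comp (.inl .a1) (rmulA ω b) = comp (.inl .a1) ω * act (K 0) b :=
  comp_rmulA_of' (coord_cotMul_E 0 .a1 rfl rfl) ω b

theorem comp_rmulA_E2 (ω : FormsA q) (b : Oq q) :
    comp (.inl .a2) (rmulA ω b) = comp (.inl .a2) ω * act (K 1) b :=
  comp_rmulA_of' (coord_cotMul_E 1 .a2 rfl rfl) ω b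

theorem comp_rmulA_F1 (ω : FormsA q) (b : Oq q) :
    comp (.inr .a1) (rmulA ω b) = comp (.inr .a1) ω * act (K 0) b :=
  comp_rmulA_of' (coord_cotMul_F 0 .a1 rfl rfl) ω b

theorem comp_rmulA_F2 (ω : FormsA q) (b : Oq q) :
    comp (.inr .a2) (rmulA ω b) = comp (.inr .a2) ω * act (K 1) b :=
  comp_rmulA_of' (coord_cotMul_F 1 .a2 rfl rfl) ω b

theorem comp_rmulA_E12 (ω : FormsA q) (b : Oq q) :
    comp (.inl .a12) (rmulA ω b) = comp (.inl .a12) ω * act (K 0 * K 1) b +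
      (q.c⁻¹ * (q.c - q.c⁻¹)) • (comp (.inl .a1) ω * act (E 1 * K 0) b) :=
  comp_rmulA_of coord_cotMul_E12 ω b

theorem comp_rmulA_F12 (ω : FormsA q) (b : Oq q) :
    comp (.inr .a12) (rmulA ω b) = comp (.inr .a12) ω * act (K 0 * K 1) b +
      (q.c - q.c⁻¹) • (comp (.inr .a1) ω * act (K 1 * F 1 * K 0) b) :=
  comp_rmulA_of coord_cotMul_F12 ω b

end Oq
end

noncomputable section

/-! ### The antipode -/

namespace Uq

open MulOpposite

variable {q : DefParam}

variable (q) in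
/-- The antipode on generators, with values in the opposite algebra. -/
def antipodeGen : UGen → (Uq q)ᵐᵒᵖ
  | .E i => op (-(E i * Kinv i))
  | .F i => op (-(K i * F i))
  | .K i => op (Kinv i)
  | .Kinv i => op (K i)

/-- Moving k and l to the right costs each of the three cubic monomials the same factor c²d = 1, so
the relation becomes the Serre relation for x and y times k²l. The order of factors is reversed
because the antipode takes values in the opposite algebra. -/
theorem serre_mul {R : Type*} [Ring R] [Algebra ℂ R] {p c d : ℂ} (hd : c ^ 2 * d = 1)
    {x y k l : R} (h1 : k * x = d • (x * k)) (h2 : k * y = c • (y * k)) (h3 : l * x = c • (x * l))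
    (hkl : l * k = k * l) (h : y * x * x - p • (x * y * x) + x * x * y = 0) :
    (y * l) * (x * k) * (x * k) - p • ((x * k) * (y * l) * (x * k)) +
      (x * k) * (x * k) * (y * l) = 0 := by
  have h1' : ∀ z, k * (x * z) = d • (x * (k * z)) := fun z => by
    rw [← mul_assoc, h1, smul_mul_assoc, mul_assoc]
  have h2' : ∀ z, k * (y * z) = c • (y * (k * z)) := fun z => by
    rw [← mul_assoc, h2, smul_mul_assoc, mul_assoc]
  have h3' : ∀ z, l * (x * z) = c • (x * (l * z)) := fun z => by
    rw [← mul_assoc, h3, smul_mul_assoc, mul_assoc]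
  have e : (y * x * x - p • (x * y * x) + x * x * y) * (k * k * l) = 0 := by rw [h, zero_mul]
  have hd1 : c * (c * d) = 1 := by rw [← hd]; ring
  have hd3 : d * (c * c) = 1 := by rw [← hd]; ring
  rw [← e]
  simp only [add_mul, sub_mul, mul_assoc, h1', h2', h3', hkl, mul_smul_comm,
    smul_mul_assoc, smul_smul, hd1, hd3, one_smul]

theorem isRep_antipodeGen : IsRep q (antipodeGen q) where
  K_Kinv i := by simp only [antipodeGen, ← op_mul, K_mul_Kinv, op_one]
  Kinv_K i := by simp only [antipodeGen, ← op_mul, Kinv_mul_K, op_one]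
  K_K i j := by simp only [antipodeGen, ← op_mul, Kinv_mul_Kinv]
  K_E i j := by
    simp only [antipodeGen, ← op_mul, ← op_smul]
    congr 1
    have h : (Kinv i * (E j * Kinv j) : Uq q) =
        q.c ^ (-cartanA2 i j) • (E j * Kinv j * Kinv i) := by
      rw [← mul_assoc, Kinv_mul_E, smul_mul_assoc, mul_assoc, Kinv_mul_Kinv, ← mul_assoc]
    rw [mul_neg, neg_mul, h, smul_neg, smul_smul, ← zpow_add₀ q.c_ne_zero]
    simp
  K_F i j := by
    simp only [antipodeGen, ← op_mul, ← op_smul]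
    congr 1
    have h : (Kinv i * (K j * F j) : Uq q) =
        q.c ^ (cartanA2 i j) • (K j * F j * Kinv i) := by
      rw [← mul_assoc, Kinv_mul_K', mul_assoc, Kinv_mul_F, mul_smul_comm, mul_assoc]
    rw [mul_neg, neg_mul, h, smul_neg, smul_smul, ← zpow_add₀ q.c_ne_zero]
    simp
  E_F i j := by
    have h1 : (K j * F j * (E i * Kinv i) : Uq q) =
        (q.c ^ (-cartanA2 j j) * q.c ^ cartanA2 i j) • (F j * E i * (K j * Kinv i)) := by
      have : (K j * F j * (E i * Kinv i) : Uq q) = K j * (F j * E i) * Kinv i := by noncomm_ring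
      rw [this, K_mul_mul (K_mul_F j j) (K_mul_E j i), smul_mul_assoc, mul_assoc (F j * E i),
        cartanA2_symm j i]
    have h2 : (E i * Kinv i * (K j * F j) : Uq q) =
        (q.c ^ (-cartanA2 j j) * q.c ^ cartanA2 i j) • (E i * F j * (K j * Kinv i)) := by
      have : (E i * Kinv i * (K j * F j) : Uq q) = E i * (Kinv i * K j * F j) := by noncomm_ring
      rw [this, Kinv_mul_K', mul_assoc, Kinv_mul_F, mul_smul_comm, ← mul_assoc (K j), K_mul_F,
        smul_mul_assoc, smul_smul, mul_smul_comm, mul_comm (q.c ^ cartanA2 i j)]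
      simp only [mul_assoc]
    have h3 : (-(K j * F j) * -(E i * Kinv i) - -(E i * Kinv i) * -(K j * F j) : Uq q) =
        -(q.c ^ (-cartanA2 j j) * q.c ^ cartanA2 i j) •
          ((E i * F j - F j * E i) * (K j * Kinv i)) := by
      rw [neg_mul_neg, neg_mul_neg, h1, h2, sub_mul, smul_sub, neg_smul, neg_smul]
      abel
    simp only [antipodeGen, ← op_mul, ← op_smul, ← op_sub]
    rw [h3, E_mul_F]
    split_ifs with h
    · subst h
      rw [← zpow_add₀ q.c_ne_zero, K_mul_Kinv]
      simp [← smul_neg]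
    · simp
  serreE i j h := by
    have hc : cartanA2 i j = -1 := by simp [cartanA2, h]
    have hc' : cartanA2 j i = -1 := by simp [cartanA2, h.symm]
    have hc2 : cartanA2 i i = 2 := by simp [cartanA2]
    have hq := q.c_ne_zero
    have e := serreE (q := q) i j h
    have := serre_mul (R := Uq q) (p := q.c + q.c⁻¹) (c := q.c) (d := q.c ^ (-2 : ℤ))
      (x := E i) (y := E j) (k := Kinv i) (l := Kinv j)
      (by rw [zpow_neg]; norm_cast; exact mul_inv_cancel₀ (pow_ne_zero _ hq))
      (by rw [Kinv_mul_E, hc2])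
      (by rw [Kinv_mul_E, hc]; simp) (by rw [Kinv_mul_E, hc']; simp)
      (Kinv_mul_Kinv j i) (by rw [← e]; abel)
    simp only [antipodeGen, ← op_mul, ← op_smul, ← op_sub, ← op_add]
    rw [← op_zero, ← neg_zero, ← this]
    congr 1
    simp only [mul_neg, neg_mul, neg_neg, smul_neg, mul_assoc]
    abel
  serreF i j h := by
    have hc : cartanA2 i j = -1 := by simp [cartanA2, h]
    have hc' : cartanA2 j i = -1 := by simp [cartanA2, h.symm]
    have hc2 : cartanA2 i i = 2 := by simp [cartanA2]
    have hq := q.c_ne_zero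
    have e := serreF (q := q) i j h
    have := serre_mul (R := Uq q) (p := q.c + q.c⁻¹) (c := q.c) (d := q.c ^ (-2 : ℤ))
      (x := F i) (y := F j) (k := K i) (l := K j)
      (by rw [zpow_neg]; norm_cast; exact mul_inv_cancel₀ (pow_ne_zero _ hq))
      (by rw [K_mul_F, hc2])
      (by rw [K_mul_F, hc]; simp) (by rw [K_mul_F, hc']; simp)
      (K_mul_K j i) (by rw [← e]; abel)
    have hs : ∀ r : Fin 2, (K r * F r : Uq q) = q.c ^ (-2 : ℤ) • (F r * K r) := by
      intro r
      rw [K_mul_F]; simp [cartanA2]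
    simp only [antipodeGen, ← op_mul, ← op_smul, ← op_sub, ← op_add]
    -- S(F_r) = -K_r F_r = -q⁻² F_r K_r, so three such factors contribute the overall scalar -q⁻⁶.
    rw [← op_zero, ← smul_zero (-(q.c ^ (-2 : ℤ) * (q.c ^ (-2 : ℤ) * q.c ^ (-2 : ℤ)))), ← this]
    congr 1
    simp only [hs, mul_neg, neg_mul, neg_neg, smul_neg, mul_smul_comm, smul_mul_assoc,
      smul_smul, smul_add, smul_sub, neg_smul, mul_assoc]
    rw [mul_comm (q.c + q.c⁻¹)]
    simp only [mul_assoc]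

end Uq
end

noncomputable section

namespace Uq

variable {q : DefParam}

variable (q) in
/-- The antipode of `U_q(sl_3)`. -/
def antipode : Uq q →ₗ[ℂ] Uq q :=
  (MulOpposite.opLinearEquiv ℂ).symm.toLinearMap ∘ₗ (lift isRep_antipodeGen).toLinearMap

theorem antipode_apply (x : Uq q) : antipode q x = (lift isRep_antipodeGen x).unop := rfl

@[simp] theorem antipode_mul (x y : Uq q) : antipode q (x * y) = antipode q y * antipode q x := by
  simp [antipode_apply]

@[simp] theorem antipode_one : antipode q 1 = 1 := by simp [antipode_apply]

@[simp] theorem antipode_algebraMap (c : ℂ) :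
    antipode q (algebraMap ℂ _ c) = algebraMap ℂ _ c := by
  simp [Algebra.algebraMap_eq_smul_one]

@[simp] theorem antipode_E (i : Fin 2) : antipode q (E i) = -(E i * Kinv i) := by
  simp [antipode_apply, antipodeGen]
@[simp] theorem antipode_F (i : Fin 2) : antipode q (F i) = -(K i * F i) := by
  simp [antipode_apply, antipodeGen]
@[simp] theorem antipode_K (i : Fin 2) : antipode q (K i) = Kinv i := by
  simp [antipode_apply, antipodeGen]
@[simp] theorem antipode_Kinv (i : Fin 2) : antipode q (Kinv i) = K i := by
  simp [antipode_apply, antipodeGen]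

variable (q) in
/-- The map `x ⊗ y ↦ S(y) ⊗ S(x)`. -/
def antipodeTensor : Uq q ⊗[ℂ] Uq q →ₗ[ℂ] Uq q ⊗[ℂ] Uq q :=
  TensorProduct.map (antipode q) (antipode q) ∘ₗ (TensorProduct.comm ℂ (Uq q) (Uq q)).toLinearMap

@[simp] theorem antipodeTensor_tmul (x y : Uq q) :
    antipodeTensor q (x ⊗ₜ y) = antipode q y ⊗ₜ antipode q x := rfl

theorem antipodeTensor_mul (s t : Uq q ⊗[ℂ] Uq q) :
    antipodeTensor q (s * t) = antipodeTensor q t * antipodeTensor q s := by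
  induction s using TensorProduct.induction_on with
  | zero => simp
  | add x y hx hy => rw [add_mul, map_add, hx, hy, map_add, mul_add]
  | tmul a b =>
    induction t using TensorProduct.induction_on with
    | zero => simp
    | add x y hx hy => rw [mul_add, map_add, hx, hy, map_add, add_mul]
    | tmul c d => simp

/-- The antipode reverses the coproduct. -/
theorem comul_antipode (x : Uq q) : Coalgebra.comul (R := ℂ) (antipode q x) =
    antipodeTensor q (Coalgebra.comul (R := ℂ) x) := by
  induction x using Uq.induction with
  | hs c => simp [Algebra.algebraMap_eq_smul_one, Algebra.TensorProduct.one_def]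
  | hE i =>
    simp [add_mul, K_mul_Kinv, TensorProduct.tmul_neg, TensorProduct.neg_tmul, add_comm]
  | hF i =>
    simp [mul_add, K_mul_Kinv, TensorProduct.tmul_neg, TensorProduct.neg_tmul, add_comm]
  | hK i => simp
  | hKi i => simp
  | hm x y hx hy =>
    rw [antipode_mul, Bialgebra.comul_mul, hx, hy, Bialgebra.comul_mul, antipodeTensor_mul]
  | ha x y hx hy => simp only [map_add, hx, hy]

/-- The antipode axiom `S(x_(1)) x_(2) = ε(x)`. -/
theorem antipode_mul_comul (x : Uq q) :
    LinearMap.mul' ℂ (Uq q) (LinearMap.rTensor (Uq q) (antipode q) (Coalgebra.comul (R := ℂ) x)) =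
      algebraMap ℂ (Uq q) (Coalgebra.counit (R := ℂ) x) := by
  induction x using Uq.induction with
  | hs c => simp [Algebra.algebraMap_eq_smul_one, Algebra.TensorProduct.one_def]
  | hE i => simp [mul_assoc, Kinv_mul_K]
  | hF i => simp
  | hK i => simp [Kinv_mul_K]
  | hKi i => simp [K_mul_Kinv]
  | ha x y hx hy => simp only [map_add, hx, hy]
  | hm x y hx hy =>
    -- In S(x_(1)y_(1)) x_(2)y_(2) the factor S(x_(1)) x_(2) is enclosed between S(y_(1)) and y_(2).
    -- It can be pulled out once it is known to be a scalar, hence the hypothesis on `t`.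
    have h : ∀ s t : Uq q ⊗[ℂ] Uq q, LinearMap.mul' ℂ (Uq q)
        (LinearMap.rTensor (Uq q) (antipode q) t) ∈ Set.range (algebraMap ℂ (Uq q)) → 
        LinearMap.mul' ℂ (Uq q) (LinearMap.rTensor (Uq q) (antipode q) (t * s)) =
        LinearMap.mul' ℂ (Uq q) (LinearMap.rTensor (Uq q) (antipode q) t) *
        LinearMap.mul' ℂ (Uq q) (LinearMap.rTensor (Uq q) (antipode q) s) := by
      intro s t ht
      induction s using TensorProduct.induction_on with
      | zero => simp
      | add x y hx hy => rw [mul_add, map_add, map_add, hx, hy, map_add, map_add, mul_add]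
      | tmul a b =>
        have : LinearMap.mul' ℂ (Uq q) (LinearMap.rTensor (Uq q) (antipode q) (t * a ⊗ₜ b)) =
            antipode q a * LinearMap.mul' ℂ (Uq q)
              (LinearMap.rTensor (Uq q) (antipode q) t) * b := by
          clear ht
          induction t using TensorProduct.induction_on with
          | zero => simp
          | add x y hx hy => rw [add_mul, map_add, map_add, hx, hy, map_add, map_add, mul_add,
              add_mul]
          | tmul c d => simp [mul_assoc]
        obtain ⟨c, hc⟩ := ht
        rw [this, ← hc, ← Algebra.commutes]
        simp [mul_assoc]
    rw [Bialgebra.comul_mul, h _ _ (by rw [hx]; exact ⟨_, rfl⟩), hx, hy, ← map_mul,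
      Bialgebra.counit_mul]

/-- Both sides are complex linear and reverse products, so the generators suffice. Dually this is
S(u_ij) = u_ji^*. -/
theorem vecRep_antipode (x : Uq q) :
    vecRep q (antipode q x) = (vecRep q (theta q x)).conjTranspose := by
  have hq := q.c_ne_zero
  induction x using Uq.induction with
  | hs c => simp [Algebra.algebraMap_eq_smul_one]
  | hE i =>
    ext a b
    fin_cases i <;> fin_cases a <;> fin_cases b <;>
      simp [vecGen, Matrix.single, Matrix.mul_apply, Matrix.diagonal]
  | hF i =>
    ext a b
    fin_cases i <;> fin_cases a <;> fin_cases b <;>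
      simp [vecGen, Matrix.single, Matrix.mul_apply, Matrix.diagonal]
  | hK i =>
    ext a b
    fin_cases i <;> fin_cases a <;> fin_cases b <;> simp [vecGen, Matrix.diagonal]
  | hKi i =>
    ext a b
    fin_cases i <;> fin_cases a <;> fin_cases b <;> simp [vecGen, Matrix.diagonal]
  | hm x y hx hy => simp [hx, hy]
  | ha x y hx hy => simp [hx, hy]

end Uq

/-! ### The antipode of `O_q(SU_3)` -/

namespace Oq

open Uq UqDual

variable {q : DefParam}

variable (q) in
/-- The functional `X ↦ a(S(X))`. -/
def dualAntipode : UqDual q →ₗ[ℂ] UqDual q where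
  toFun a := toConv (a.ofConv ∘ₗ antipode q)
  map_add' _ _ := rfl
  map_smul' _ _ := rfl

theorem dualAntipode_apply (a : UqDual q) (X : Uq q) : dualAntipode q a X = a (antipode q X) := rfl

theorem dualAntipode_mul (a b : UqDual q) :
    dualAntipode q (a * b) = dualAntipode q b * dualAntipode q a := by
  apply UqDual.ext
  intro X
  rw [dualAntipode_apply, LinearMap.convMul_apply, LinearMap.convMul_apply, comul_antipode]
  generalize Coalgebra.comul (R := ℂ) X = t
  induction t using TensorProduct.induction_on with
  | zero => simp
  | tmul x y =>
    rw [antipodeTensor_tmul]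
    exact mul_comm (a (antipode q y)) (b (antipode q x))
  | add s t hs ht => rw [map_add, map_add, map_add, map_add, map_add, hs, ht]

/-- S reverses products and sends u_ij to u_ji^*, which is already known to be a polynomial in the
generators, namely a multiple of a quantum minor. -/
theorem dualAntipode_mem {a : UqDual q} (h : a ∈ OqSub q) : dualAntipode q a ∈ OqSub q := by
  induction h using Algebra.adjoin_induction with
  | mem x hx =>
    obtain ⟨p, rfl⟩ := hx
    have : dualAntipode q (UqDual.u q p.1 p.2) = dualStar (UqDual.u q p.2 p.1) := by
      apply UqDual.ext
      intro X
      rw [dualAntipode_apply, UqDual.u_apply, vecRep_antipode]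
      rfl
    change dualAntipode q (UqDual.u q p.1 p.2) ∈ _
    rw [this]
    exact dualStar_u_mem _ _
  | algebraMap c =>
    have : dualAntipode q (algebraMap ℂ (UqDual q) c) = algebraMap ℂ (UqDual q) c := by
      apply UqDual.ext
      intro X
      have h2 : Coalgebra.counit (R := ℂ) (antipode q X) = Coalgebra.counit (R := ℂ) X := by
        induction X using Uq.induction with
        | hs c => simp
        | hE i => simp
        | hF i => simp
        | hK i => simp
        | hKi i => simp
        | hm x y h1 h2 => simp [h1, h2, mul_comm]
        | ha x y h1 h2 => simp [h1, h2]
      simp [dualAntipode_apply, Algebra.algebraMap_eq_smul_one, h2]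
    rw [this]
    exact Subalgebra.algebraMap_mem _ _
  | add x y hx hy h1 h2 => rw [map_add]; exact Subalgebra.add_mem _ h1 h2
  | mul x y hx hy h1 h2 => rw [dualAntipode_mul]; exact Subalgebra.mul_mem _ h2 h1

variable (q) in
/-- The antipode of `O_q(SU_3)`. -/
def antipode : Oq q →ₗ[ℂ] Oq q where
  toFun a := ⟨dualAntipode q (val q a), dualAntipode_mem a.2⟩
  map_add' _ _ := rfl
  map_smul' _ _ := rfl

theorem pair_antipode (X : Uq q) (a : Oq q) : pair X (antipode q a) = pair (Uq.antipode q X) a :=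
  rfl

/-- The antipode axiom `S(a_(1)) a_(2) = ε(a)`. -/
theorem antipode_mul_comul (a : Oq q) :
    LinearMap.mul' ℂ (Oq q) (LinearMap.rTensor (Oq q) (antipode q) (Coalgebra.comul (R := ℂ) a)) =
      algebraMap ℂ (Oq q) (Coalgebra.counit (R := ℂ) a) := by
  apply ext_pair
  intro X
  -- By duality the axiom is transferred to U_q(sl_3): pairing S(t_(1)) t_(2) with X amounts to
  -- pairing t with S(X_(1)) ⊗ X_(2).
  have h1 : ∀ t : Oq q ⊗[ℂ] Oq q,
      pair X (LinearMap.mul' ℂ (Oq q) (LinearMap.rTensor (Oq q) (antipode q) t)) =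
      pairTwo q t (LinearMap.rTensor (Uq q) (Uq.antipode q) (Coalgebra.comul (R := ℂ) X)) := by
    intro t
    induction t using TensorProduct.induction_on with
    | zero => simp
    | add s t hs ht =>
      rw [map_add, map_add, map_add, hs, ht, map_add, WithConv.ofConv_add, LinearMap.add_apply]
    | tmul b c =>
      rw [LinearMap.rTensor_tmul, LinearMap.mul'_apply, pair_mul]
      generalize Coalgebra.comul (R := ℂ) X = s
      induction s using TensorProduct.induction_on with
      | zero => simp
      | tmul x y => simp [pair_antipode]
      | add s t hs ht => rw [map_add, map_add, map_add, hs, ht]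
  have h2 : ∀ s : Uq q ⊗[ℂ] Uq q, pairTwo q (comulHom q a) s =
      pair (LinearMap.mul' ℂ (Uq q) s) a := by
    intro s
    rw [pairTwo_comulHom]
    induction s using TensorProduct.induction_on with
    | zero => simp [pair_apply]
    | tmul x y => rfl
    | add s t hs ht => rw [map_add, map_add, pair_add, hs, ht]
  rw [h1, comul_eq, h2, Uq.antipode_mul_comul]
  simp only [Algebra.algebraMap_eq_smul_one, pair_smul, map_smul, counit_eq, smul_eq_mul]
  rw [mul_comm]
  congr 1

end Oq
end

noncomputable section

/-- A sum of elements of smaller subspaces that lies in one of an independent family of subspaces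
lies in the smaller subspace. -/
theorem iSupIndep.mem_of_mem_iSup {ι R M : Type*} [Ring R] [AddCommGroup M] [Module R M]
    {p r : ι → Submodule R M} (hp : iSupIndep p) (h : ∀ i, r i ≤ p i) {x : M}
    (hx : x ∈ ⨆ i, r i) {j : ι} (hj : x ∈ p j) : x ∈ r j := by
  have hle : ⨆ i, r i ≤ r j ⊔ ⨆ (i) (_ : i ≠ j), p i := by
    refine iSup_le fun i => ?_
    by_cases hij : i = j
    · subst hij; exact le_sup_left
    · exact le_sup_of_le_right ((h i).trans (le_iSup₂_of_le i hij le_rfl))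
  obtain ⟨y, hy, z, hz, rfl⟩ := Submodule.mem_sup.mp (hle hx)
  -- The remainder z = x - y lies in `p j` and in the sum of the other `p i`, so independence makes
  -- it vanish.
  have hz' : z ∈ p j := by simpa using Submodule.sub_mem _ hj (h j hy)
  have : z = 0 := by
    have := (hp j).le_bot ⟨hz', hz⟩
    simpa using this
  rwa [this, add_zero]

namespace Oq

open Uq

variable {q : DefParam}

/-! ### Weight spaces -/

variable (q) in
/-- The weight spaces of `O_q(SU_3)` under the left action of the `K_i`. -/
def wtSpace (χ : Fin 2 → ℂ) : Submodule ℂ (Oq q) where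
  carrier := {a | ∀ i, act (K i) a = χ i • a}
  add_mem' ha hb i := by rw [map_add, ha i, hb i, smul_add]
  zero_mem' i := by simp
  smul_mem' c a ha i := by rw [map_smul, ha i, smul_comm]

theorem mem_wtSpace {χ : Fin 2 → ℂ} {a : Oq q} :
    a ∈ wtSpace q χ ↔ ∀ i, act (K i) a = χ i • a := Iff.rfl

theorem mul_mem_wtSpace {χ ψ : Fin 2 → ℂ} {a b : Oq q} (ha : a ∈ wtSpace q χ)
    (hb : b ∈ wtSpace q ψ) : a * b ∈ wtSpace q (χ * ψ) := fun i => by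
  rw [act_K_mul, ha i, hb i, smul_mul_smul_comm, Pi.mul_apply]

theorem act_Kinv_of_mem {χ : Fin 2 → ℂ} {a : Oq q} (ha : a ∈ wtSpace q χ) {i : Fin 2}
    (h : χ i ≠ 0) : act (Kinv i) a = (χ i)⁻¹ • a := by
  have : act (Kinv i) (act (K i) a) = a := by rw [← act_mul, Kinv_mul_K, act_one]
  rw [ha i, map_smul] at this
  rw [eq_inv_smul_iff₀ h, this]

/-- An element fixed by K_i is automatically fixed by K_i⁻¹. From here on B is treated as the weight
zero part of A. -/
theorem mem_flag_iff_wtSpace {b : Oq q} : b ∈ flag q ↔ b ∈ wtSpace q 1 := by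
  rw [mem_flag_iff]
  constructor
  · intro h i
    simpa using h.1 i
  · intro h
    exact ⟨fun i => by simpa using h i, fun i => by simpa using act_Kinv_of_mem h (i := i) (by simp)⟩

theorem act_u (X : Uq q) (i j : Fin 3) : act X (u i j) = ∑ k, vecRep q X k j • u i k := by
  rw [act_eq, comul_u]
  simp

variable (q) in
/-- The weights of the vector representation. -/
def vecWeight (j : Fin 3) (i : Fin 2) : ℂ :=
  if j = i.succ then q.c else if j = i.castSucc then q.c⁻¹ else 1

theorem vecWeight_ne_zero (j : Fin 3) (i : Fin 2) : vecWeight q j i ≠ 0 := by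
  have := q.c_ne_zero
  unfold vecWeight
  split_ifs <;> simp [this]

theorem u_mem_wtSpace (i j : Fin 3) : (u i j : Oq q) ∈ wtSpace q (vecWeight q j) := fun l => by
  rw [act_u]
  simp only [vecRep_K, vecGen, Matrix.diagonal_apply, ite_smul, zero_smul, Finset.sum_ite_eq',
    Finset.mem_univ, if_true]
  simp only [vecWeight, ite_smul]

theorem star_mem_wtSpace {χ : Fin 2 → ℂ} {a : Oq q} (ha : a ∈ wtSpace q χ) (h : ∀ i, χ i ≠ 0) :
    star q a ∈ wtSpace q (fun i => conj (χ i)⁻¹) := fun i => by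
  rw [act_star, theta_K, act_Kinv_of_mem ha (h i), LinearMap.map_smulₛₗ]

/-- The generators u_ij are weight vectors and products of weight vectors are weight vectors. -/
theorem iSup_wtSpace : ⨆ χ, wtSpace q χ = ⊤ := by
  have hle : ∀ χ, wtSpace q χ ≤ ⨆ χ, wtSpace q χ := le_iSup _
  have h1 : (1 : Oq q) ∈ wtSpace q 1 := mem_flag_iff_wtSpace.mp (one_mem _)
  rw [eq_top_iff]
  suffices h : ∀ a : Oq q, a ∈ ⨆ χ, wtSpace q χ from fun a _ => h a
  intro a
  induction a using Oq.induction with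
  | hu i j => exact hle _ (u_mem_wtSpace i j)
  | hs c => rw [Algebra.algebraMap_eq_smul_one]; exact Submodule.smul_mem _ _ (hle _ h1)
  | ha a b h1 h2 => exact Submodule.add_mem _ h1 h2
  | hm a b h1 h2 =>
    induction h1 using Submodule.iSup_induction' with
    | zero => simp
    | add x y _ _ hx hy => rw [add_mul]; exact Submodule.add_mem _ hx hy
    | mem χ x hx =>
      induction h2 using Submodule.iSup_induction' with
      | zero => simp
      | add y z _ _ hy hz => rw [mul_add]; exact Submodule.add_mem _ hy hz
      | mem ψ y hy => exact hle _ (mul_mem_wtSpace hx hy)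

/-- Coassociativity, tested by pairing: both sides evaluate `a` at Y Z X. The action thus affects
only the second leg of the coproduct. -/
theorem comul_act (X : Uq q) (a : Oq q) : Coalgebra.comul (R := ℂ) (act X a) =
    LinearMap.lTensor (Oq q) (act X) (Coalgebra.comul (R := ℂ) a) := by
  apply pairTwo_injective
  refine WithConv.ext (TensorProduct.ext' fun Y Z => ?_)
  have h : ∀ t : Oq q ⊗[ℂ] Oq q, pairTwo q (LinearMap.lTensor (Oq q) (act X) t) (Y ⊗ₜ Z) =
      pairTwo q t (Y ⊗ₜ (Z * X)) := by
    intro t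
    induction t using TensorProduct.induction_on with
    | zero => simp
    | tmul x y => simp [pair_act]
    | add s t hs ht =>
      rw [map_add, map_add, map_add, WithConv.ofConv_add, WithConv.ofConv_add,
        LinearMap.add_apply, LinearMap.add_apply, hs, ht]
  refine Eq.trans ?_ (h _).symm
  rw [comul_eq, comul_eq, pairTwo_comulHom, pairTwo_comulHom]
  change pair (Y * Z) (act X a) = pair (Y * (Z * X)) a
  rw [pair_act, mul_assoc]

/-- The coproduct maps a weight space `W` into `A ⊗ W`. -/
theorem comul_mem_wtSpace {χ : Fin 2 → ℂ} {a : Oq q} (ha : a ∈ wtSpace q χ) :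
    Coalgebra.comul (R := ℂ) a ∈
      LinearMap.range (LinearMap.lTensor (Oq q) (wtSpace q χ).subtype) := by
  let g : Fin 2 → (Oq q →ₗ[ℂ] Oq q) := fun i => act (K i) - χ i • LinearMap.id
  -- The weight space is the kernel of the single map `f`; over a field A ⊗ - is exact, so the
  -- kernel of id ⊗ `f` is A ⊗ W.
  let f : Oq q →ₗ[ℂ] Oq q × Oq q := (g 0).prod (g 1)
  have hk : LinearMap.ker f = wtSpace q χ := by
    ext b
    simp [f, g, mem_wtSpace, Fin.forall_fin_two, sub_eq_zero]
  have hg : ∀ i, LinearMap.lTensor (Oq q) (g i) (Coalgebra.comul (R := ℂ) a) = 0 := by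
    intro i
    simp only [g, LinearMap.lTensor_sub, LinearMap.lTensor_smul, LinearMap.lTensor_id,
      LinearMap.sub_apply, LinearMap.smul_apply, LinearMap.id_apply]
    rw [← comul_act, ha i, map_smul, sub_self]
  have hf : LinearMap.lTensor (Oq q) f (Coalgebra.comul (R := ℂ) a) = 0 := by
    have : f = LinearMap.inl ℂ _ _ ∘ₗ g 0 + LinearMap.inr ℂ _ _ ∘ₗ g 1 := by
      ext b <;> simp [f]
    rw [this, LinearMap.lTensor_add, LinearMap.lTensor_comp, LinearMap.lTensor_comp,
      LinearMap.add_apply, LinearMap.comp_apply, LinearMap.comp_apply, hg, hg, map_zero, map_zero,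
      add_zero]
  have := Module.Flat.ker_lTensor_eq ℂ (Oq q) f
  rw [hk] at this
  have h2 : Coalgebra.comul (R := ℂ) a ∈
      LinearMap.ker (TensorProduct.AlgebraTensorModule.lTensor ℂ (Oq q) f) := hf
  rw [this] at h2
  exact h2

/-! ### Weights of one-forms -/

variable (q) in
/-- The weight spaces of `Ω¹_q(SU_3)`, where `1 ⊗ e_γ` has the weight `-γ`. -/
def formSpace (χ : Fin 2 → ℂ) : Submodule ℂ (FormsA q) where
  carrier := {ω | ∀ γ, comp γ ω ∈ wtSpace q (χ * weight q γ)}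
  add_mem' ha hb γ := by rw [map_add]; exact Submodule.add_mem _ (ha γ) (hb γ)
  zero_mem' γ := by simp
  smul_mem' c a ha γ := by rw [map_smul]; exact Submodule.smul_mem _ _ (ha γ)

theorem mem_formSpace {χ : Fin 2 → ℂ} {ω : FormsA q} :
    ω ∈ formSpace q χ ↔ ∀ γ, comp γ ω ∈ wtSpace q (χ * weight q γ) := Iff.rfl

/-- The operator whose eigenspaces are the weight spaces of one-forms. -/
def formK (i : Fin 2) : Module.End ℂ (FormsA q) :=
  ∑ γ, (weight q γ i)⁻¹ •
    ((TensorProduct.mk ℂ (Oq q) (Cot q)).flip (cotVec γ) ∘ₗ act (K i) ∘ₗ comp γ)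

theorem comp_sum_tmul (β : Root) (f : Root → Oq q) :
    comp β (∑ γ, f γ ⊗ₜ[ℂ] cotVec γ) = f β := by
  simp only [map_sum, comp_tmul, coord_cotVec, ite_smul, one_smul, zero_smul, Finset.sum_ite_eq,
    Finset.mem_univ, if_true]

theorem comp_formK (i : Fin 2) (β : Root) (ω : FormsA q) :
    comp β (formK i ω) = (weight q β i)⁻¹ • act (K i) (comp β ω) := by
  rw [← comp_sum_tmul β (fun β => (weight q β i)⁻¹ • act (K i) (comp β ω))]
  congr 1

theorem formK_comm (i j : Fin 2) : Commute (formK (q := q) i) (formK j) := by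
  refine LinearMap.ext fun ω => forms_ext fun β => ?_
  rw [Module.End.mul_apply, Module.End.mul_apply]
  simp only [comp_formK, map_smul]
  rw [← act_mul, ← act_mul, K_mul_K, smul_comm]

/-- `formK i` multiplies the γ-part of the K_i-action by the inverse weight of γ, so a simultaneous
eigenvalue χ means that the γ-coefficient has weight χ times that of γ. -/
theorem formSpace_eq (χ : Fin 2 → ℂ) :
    formSpace q χ = ⨅ i, (formK (q := q) i).eigenspace (χ i) := by
  ext ω
  simp only [Submodule.mem_iInf, Module.End.mem_eigenspace_iff, mem_formSpace, mem_wtSpace]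
  constructor
  · intro h i
    apply forms_ext
    intro γ
    rw [comp_formK, h, map_smul, smul_smul, Pi.mul_apply, mul_comm (χ i),
      inv_mul_cancel_left₀ (weight_ne_zero γ i)]
  · intro h γ i
    have := congrArg (comp γ) (h i)
    rw [comp_formK, map_smul, inv_smul_eq_iff₀ (weight_ne_zero γ i), smul_smul] at this
    rw [this, Pi.mul_apply, mul_comm]

/-- Joint eigenspaces of commuting operators are independent. -/
theorem iSupIndep_formSpace : iSupIndep (formSpace q) := by
  refine (Module.End.independent_iInf_maxGenEigenspace_of_forall_mapsTo (formK (q := q))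
    fun i j φ => Module.End.mapsTo_maxGenEigenspace_of_comm (formK_comm j i) φ).mono fun χ => ?_
  rw [formSpace_eq]
  exact iInf_mono fun i => Module.End.eigenspace_le_maxGenEigenspace

theorem smul_mem_formSpace {χ ψ : Fin 2 → ℂ} {a : Oq q} {ω : FormsA q} (ha : a ∈ wtSpace q χ)
    (hω : ω ∈ formSpace q ψ) : a • ω ∈ formSpace q (χ * ψ) := fun γ => by
  rw [comp_smul, mul_assoc]
  exact mul_mem_wtSpace ha (hω γ)

theorem tmul_cotVec_mem {χ : Fin 2 → ℂ} {a : Oq q} {γ : Root} (ha : a ∈ wtSpace q (χ * weight q γ)) :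
    a ⊗ₜ cotVec γ ∈ formSpace q χ := fun β => by
  rw [comp_tmul, coord_cotVec]
  split_ifs with h
  · subst h; rwa [one_smul]
  · simp

/-- If `1 ⊗ e_γ` is an `A`-combination of elements of `N`, the coefficients may be taken to have the
weight `-γ`. -/
theorem one_tmul_mem_span {N : Submodule ℂ (FormsA q)} (hN : N ≤ formSpace q 1) {γ : Root}
    (h : (1 : Oq q) ⊗ₜ cotVec γ ∈ Submodule.span ℂ {ω | ∃ s : Oq q, ∃ n ∈ N, ω = s • n}) :
    (1 : Oq q) ⊗ₜ cotVec γ ∈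
      Submodule.span ℂ {ω | ∃ s ∈ wtSpace q (weight q γ)⁻¹, ∃ n ∈ N, ω = s • n} := by
  -- The A-span of N is sorted by the weight of the multiplier. Elements of N have weight zero, so
  -- `r χ` lies in the form space of χ, and 1 ⊗ e_γ itself lies in the one of weight -γ.
  let r : (Fin 2 → ℂ) → Submodule ℂ (FormsA q) := fun χ =>
    Submodule.span ℂ {ω | ∃ s ∈ wtSpace q χ, ∃ n ∈ N, ω = s • n}
  refine iSupIndep_formSpace.mem_of_mem_iSup (r := r) ?_ ?_ (tmul_cotVec_mem ?_)
  · intro χ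
    rw [Submodule.span_le]
    rintro _ ⟨s, hs, n, hn, rfl⟩
    simpa using smul_mem_formSpace hs (hN hn)
  · refine Submodule.span_le.mpr ?_ h
    rintro _ ⟨s, n, hn, rfl⟩
    have hs : s ∈ ⨆ χ, wtSpace q χ := by rw [iSup_wtSpace]; trivial
    induction hs using Submodule.iSup_induction' with
    | zero => simp
    | add x y _ _ hx hy => rw [add_smul]; exact Submodule.add_mem _ hx hy
    | mem χ x hx =>
      exact Submodule.mem_iSup_of_mem (p := r) χ (Submodule.subset_span ⟨x, hx, n, hn, rfl⟩)
  · have : (weight q γ)⁻¹ * weight q γ = 1 := by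
      ext i
      simp [weight_ne_zero]
    rw [this]
    exact mem_flag_iff_wtSpace.mp (one_mem _)

/-- For multipliers s of weight -γ and a of weight γ the product as has weight zero, hence lies in
B; moreover ε(as) = ε(a) ε(s). This turns an A-combination into a B-combination, and into a
B⁺-combination if ε(a) = 0. -/
theorem tmul_cotVec_mem_span {N : Submodule ℂ (FormsA q)} {γ : Root}
    (h : (1 : Oq q) ⊗ₜ cotVec γ ∈
      Submodule.span ℂ {ω | ∃ s ∈ wtSpace q (weight q γ)⁻¹, ∃ n ∈ N, ω = s • n})
    {a : Oq q} (ha : a ∈ wtSpace q (weight q γ)) :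
    a ⊗ₜ cotVec γ ∈ Submodule.span ℂ {ω | ∃ b ∈ flag q,
      (pair 1 a = 0 → b ∈ aug q) ∧ ∃ n ∈ N, ω = b • n} := by
  have h1 : a ⊗ₜ cotVec γ = a • ((1 : Oq q) ⊗ₜ[ℂ] (cotVec γ : Cot q)) := by
    rw [TensorProduct.smul_tmul', smul_eq_mul, mul_one]
  rw [h1]
  generalize (1 : Oq q) ⊗ₜ[ℂ] (cotVec γ : Cot q) = η at h
  clear h1
  induction h using Submodule.span_induction with
  | zero => rw [smul_zero]; exact Submodule.zero_mem _
  | add x y _ _ hx hy => rw [smul_add]; exact Submodule.add_mem _ hx hy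
  | smul c x _ hx => rw [smul_comm]; exact Submodule.smul_mem _ _ hx
  | mem x hx =>
    obtain ⟨s, hs, n, hn, rfl⟩ := hx
    rw [smul_smul]
    refine Submodule.subset_span ⟨a * s, ?_, ?_, n, hn, rfl⟩
    · rw [mem_flag_iff_wtSpace]
      have := mul_mem_wtSpace ha hs
      have h1 : weight q γ * (weight q γ)⁻¹ = 1 := by
        ext i
        simp [weight_ne_zero]
      rwa [h1] at this
    · intro h0
      rw [mem_aug, Bialgebra.counit_mul, counit_eq, h0, zero_mul]

/-! ### The coaction -/

theorem coactA_tmul (a : Oq q) (v : Cot q) : coactA q (a ⊗ₜ v) =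
    TensorProduct.assoc ℂ (Oq q) (Oq q) (Cot q) (Coalgebra.comul (R := ℂ) a ⊗ₜ v) := by
  simp [coactA]

/-- Coassociativity: d is left covariant. -/
theorem coactA_dA (b : Oq q) :
    coactA q (dA q b) = LinearMap.lTensor (Oq q) (dA q) (Coalgebra.comul (R := ℂ) b) := by
  have h1 : ∀ t : Oq q ⊗[ℂ] Oq q, coactA q (LinearMap.lTensor (Oq q) (cls q) t) =
      LinearMap.lTensor (Oq q) (LinearMap.lTensor (Oq q) (cls q))
        (TensorProduct.assoc ℂ (Oq q) (Oq q) (Oq q)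
          (LinearMap.rTensor (Oq q) (Coalgebra.comul (R := ℂ)) t)) := by
    intro t
    induction t using TensorProduct.induction_on with
    | zero => simp
    | add x y hx hy => simp only [map_add, hx, hy]
    | tmul x y =>
      rw [LinearMap.lTensor_tmul, coactA_tmul, LinearMap.rTensor_tmul]
      generalize Coalgebra.comul (R := ℂ) x = s
      induction s using TensorProduct.induction_on with
      | zero => simp
      | add x y hx hy => simp only [map_add, TensorProduct.add_tmul, hx, hy]
      | tmul x y => simp
  rw [dA, LinearMap.comp_apply, h1, Coalgebra.coassoc_apply, ← LinearMap.comp_apply,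
    ← LinearMap.lTensor_comp]

variable (q) in
/-- The map `a ⊗ ω ↦ S(a) ω`. -/
def antipodeSmul : Oq q ⊗[ℂ] FormsA q →ₗ[ℂ] FormsA q :=
  TensorProduct.lift <| LinearMap.mk₂ ℂ (fun a ω => antipode q a • ω)
    (fun a a' ω => by rw [map_add, add_smul])
    (fun c a ω => by rw [map_smul, smul_assoc])
    (fun a ω ω' => by rw [smul_add])
    (fun c a ω => by rw [smul_comm])

@[simp] theorem antipodeSmul_tmul (a : Oq q) (ω : FormsA q) :
    antipodeSmul q (a ⊗ₜ ω) = antipode q a • ω := rfl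

/-- `S(ω_(-1)) ω_(0) = 1 ⊗ ε(ω)`. -/
theorem antipodeSmul_coactA (ω : FormsA q) :
    antipodeSmul q (coactA q ω) = (1 : Oq q) ⊗ₜ evalA q ω := by
  induction ω using TensorProduct.induction_on with
  | zero => simp
  | add x y hx hy => rw [map_add, map_add, hx, hy, map_add, TensorProduct.tmul_add]
  | tmul a v =>
    have h : ∀ t : Oq q ⊗[ℂ] Oq q,
        antipodeSmul q (TensorProduct.assoc ℂ (Oq q) (Oq q) (Cot q) (t ⊗ₜ v)) =
        LinearMap.mul' ℂ (Oq q) (LinearMap.rTensor (Oq q) (antipode q) t) ⊗ₜ v := by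
      intro t
      induction t using TensorProduct.induction_on with
      | zero => simp
      | add x y hx hy => simp only [map_add, TensorProduct.add_tmul, hx, hy]
      | tmul x y => simp [TensorProduct.smul_tmul']
    rw [coactA_tmul, h, antipode_mul_comul, Algebra.algebraMap_eq_smul_one]
    simp [evalA, TensorProduct.smul_tmul]

/-- By the antipode identity 1 ⊗ ε(ω) = S(ω_(-1)) ω_(0), the value of a form in a subcomodule is
recovered, as an invariant form, in the A-span of the subcomodule. -/
theorem one_tmul_evalA_mem {M : Type*} [AddCommGroup M] [Module ℂ M] (f : M →ₗ[ℂ] FormsA q)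
    {ω : FormsA q} (h : coactA q ω ∈ LinearMap.range (LinearMap.lTensor (Oq q) f)) :
    (1 : Oq q) ⊗ₜ evalA q ω ∈
      Submodule.span ℂ {ω | ∃ s : Oq q, ∃ n ∈ LinearMap.range f, ω = s • n} := by
  rw [← antipodeSmul_coactA]
  obtain ⟨t, ht⟩ := h
  rw [← ht]
  clear ht
  induction t using TensorProduct.induction_on with
  | zero => simp
  | add x y hx hy => rw [map_add, map_add]; exact Submodule.add_mem _ hx hy
  | tmul a m =>
    exact Submodule.subset_span ⟨antipode q a, f m, ⟨m, rfl⟩, by simp⟩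

/-- The left action `ω ↦ ⟨Z, ω_(-1)⟩ ω_(0)` of `U_q(sl_3)` on one-forms. -/
def formAct (Z : Uq q) : FormsA q →ₗ[ℂ] FormsA q :=
  (TensorProduct.lid ℂ (FormsA q)).toLinearMap ∘ₗ LinearMap.rTensor (FormsA q) (pair Z) ∘ₗ coactA q

/-- Pairing the A-leg of the coaction with Z stays inside a subcomodule, so subcomodules are stable
under U_q(sl_3). -/
theorem formAct_mem {M : Type*} [AddCommGroup M] [Module ℂ M] (f : M →ₗ[ℂ] FormsA q)
    {ω : FormsA q} (h : coactA q ω ∈ LinearMap.range (LinearMap.lTensor (Oq q) f)) (Z : Uq q) :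
    formAct Z ω ∈ LinearMap.range f := by
  change TensorProduct.lid ℂ (FormsA q) (LinearMap.rTensor (FormsA q) (pair Z) (coactA q ω)) ∈ _
  obtain ⟨t, ht⟩ := h
  rw [← ht]
  clear ht
  induction t using TensorProduct.induction_on with
  | zero => simp
  | add x y hx hy => rw [map_add, map_add, map_add]; exact Submodule.add_mem _ hx hy
  | tmul a m => exact ⟨pair Z a • m, by simp⟩

/-- Translating by Z before applying ε pairs each coefficient with Z. The coefficients, being
functionals on U_q(sl_3), are thus determined by the values of all translates in Λ¹. -/
theorem coord_evalA_formAct (γ : Root) (Z : Uq q) (ω : FormsA q) :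
    coord γ (evalA q (formAct Z ω)) = pair Z (comp γ ω) := by
  rw [coord_evalA]
  induction ω using TensorProduct.induction_on with
  | zero => simp
  | add x y hx hy => simp only [map_add, hx, hy]
  | tmul a v =>
    have h : ∀ t : Oq q ⊗[ℂ] Oq q, pair 1 (comp γ (TensorProduct.lid ℂ (FormsA q)
        (LinearMap.rTensor (FormsA q) (pair Z)
        (TensorProduct.assoc ℂ (Oq q) (Oq q) (Cot q) (t ⊗ₜ v))))) =
        coord γ v * pairTwo q t (Z ⊗ₜ 1) := by
      intro t
      induction t using TensorProduct.induction_on with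
      | zero => simp
      | add x y hx hy =>
        simp only [map_add, TensorProduct.add_tmul, hx, hy, WithConv.ofConv_add,
          LinearMap.add_apply, mul_add]
      | tmul x y => simp; ring
    change pair 1 (comp γ (TensorProduct.lid ℂ (FormsA q)
      (LinearMap.rTensor (FormsA q) (pair Z) (coactA q (a ⊗ₜ v))))) = _
    rw [coactA_tmul, h, comul_eq, pairTwo_comulHom, comp_tmul, map_smul, smul_eq_mul]
    change _ * pair (Z * 1) a = _
    rw [mul_one]

end Oq
end

noncomputable section

namespace Oq

open Uq

variable {q : DefParam}

/-! ### The cotangent space of `O_q(F_3)` -/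

theorem act_rootVec_mem {χ : Fin 2 → ℂ} (γ : Root) {a : Oq q} (ha : a ∈ wtSpace q χ) :
    act (rootVec γ) a ∈ wtSpace q (χ * weight q γ) := fun i => by
  rw [← act_mul, K_mul_rootVec, act_smul, act_mul, ha i, map_smul, smul_smul, Pi.mul_apply,
    mul_comm]

/-- The γ-coefficient of b db' is b (X_γ ▷ b'), and X_γ shifts weights by γ. -/
theorem forms_le_formSpace : forms q ≤ formSpace q 1 := by
  rw [forms, Submodule.span_le]
  rintro _ ⟨b, b', rfl⟩ γ
  rw [comp_smul, comp_dA]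
  have h := mul_mem_wtSpace (mem_flag_iff_wtSpace.mp b.2)
    (act_rootVec_mem γ (mem_flag_iff_wtSpace.mp b'.2))
  rwa [one_mul] at h

theorem pair_rootK_star_u_ne_zero (γ : PosRoot) (j : Fin 3) :
    pair (rootK γ) (star q (u j j)) ≠ 0 := by
  have hq := q.c_ne_zero
  rw [pair_star]
  cases γ <;> fin_cases j <;> simp [rootK, vecGen, Matrix.diagonal, Matrix.mul_apply, hq]

/-- Pairing with u_jj^* reads a diagonal entry of ρ(θ(X)). For the X in the off-diagonal terms, E_2
K_1 and K_2 F_2 K_1, the matrix ρ(θ(X)) has zero diagonal, so u_jj^* acts diagonally on Λ¹. -/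
theorem coord_cotMul_star_u (β : Root) (v : Cot q) (j : Fin 3) :
    coord β (cotMul q v (star q (u j j))) =
      coord β v * pair (rootK (Sum.elim id id β)) (star q (u j j)) := by
  rcases β with β | β <;> cases β
  · exact coord_cotMul_E 0 .a1 rfl rfl _ _
  · exact coord_cotMul_E 1 .a2 rfl rfl _ _
  · have : pair (E 1 * K 0) (star q (u j j)) = 0 := by
      rw [pair_star]
      fin_cases j <;> simp [vecGen, Matrix.single, Matrix.diagonal, Matrix.mul_apply]
    rw [coord_cotMul_E12, this]
    simp
  · exact coord_cotMul_F 0 .a1 rfl rfl _ _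
  · exact coord_cotMul_F 1 .a2 rfl rfl _ _
  · have : pair (K 1 * F 1 * K 0) (star q (u j j)) = 0 := by
      rw [pair_star]
      fin_cases j <;> simp [vecGen, Matrix.single, Matrix.diagonal, Matrix.mul_apply]
    rw [coord_cotMul_F12, this]
    simp

/-- The weight of u_ij depends only on the column j, and the involution inverts it, since the
weights are real. -/
theorem u_mul_star_mem_flag (i j : Fin 3) : (u i j * star q (u j j) : Oq q) ∈ flag q := by
  rw [mem_flag_iff_wtSpace]
  have h := mul_mem_wtSpace (u_mem_wtSpace (q := q) i j)
    (star_mem_wtSpace (u_mem_wtSpace (q := q) j j) (vecWeight_ne_zero j))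
  have h1 : vecWeight q j * (fun i => conj (vecWeight q j i)⁻¹) = 1 := by
    ext i
    have hc : conj (vecWeight q j i) = vecWeight q j i := by
      unfold vecWeight
      split_ifs <;> simp
    simp [hc, vecWeight_ne_zero]
  rwa [h1] at h

theorem exists_cotVec_eq (γ : Root) :
    ∃ (c : ℂ) (i j : Fin 3), i ≠ j ∧ (cotVec γ : Cot q) = c • cls q (u i j) := by
  rcases γ with γ | γ <;> cases γ
  · exact ⟨1, 1, 0, by decide, (one_smul _ _).symm⟩
  · exact ⟨1, 2, 1, by decide, (one_smul _ _).symm⟩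
  · exact ⟨1, 2, 0, by decide, (one_smul _ _).symm⟩
  · exact ⟨q.c, 0, 1, by decide, map_smul _ _ _⟩
  · exact ⟨q.c, 1, 2, by decide, map_smul _ _ _⟩
  · exact ⟨q.c ^ 2, 0, 2, by decide, map_smul _ _ _⟩

/-- e_γ is a multiple of some [u_ij] with i ≠ j, but u_ij is not in B. Multiplying on the right by
u_jj^* brings it into B; as ε(u_ij) = 0 its class becomes [u_ij] u_jj^*, which is a nonzero multiple
of e_γ because u_jj^* acts diagonally. The constant κ⁻¹ c normalises it. -/
theorem exists_flag_cls_eq (γ : Root) : ∃ b : flag q, cls q (b : Oq q) = cotVec γ := by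
  obtain ⟨c, i, j, hij, hγ⟩ := exists_cotVec_eq (q := q) γ
  set κ := pair (rootK (Sum.elim id id γ)) (star q (u j j)) with hκ
  refine ⟨(κ⁻¹ * c) • ⟨_, u_mul_star_mem_flag i j⟩, ?_⟩
  have h0 : Coalgebra.counit (R := ℂ) (u i j : Oq q) = 0 := by
    change counitHom q (u i j) = 0
    rw [counitHom_u, if_neg hij]
  have h1 : c • cotMul q (cls q (u i j)) (star q (u j j)) =
      cotMul q (cotVec γ) (star q (u j j)) := by
    rw [hγ, map_smul, LinearMap.smul_apply]
  rw [Subalgebra.coe_smul, map_smul, cls_mul, h0, zero_smul, add_zero, mul_smul, h1]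
  apply cot_ext
  intro β
  rw [map_smul, coord_cotMul_star_u, coord_cotVec]
  split_ifs with h
  · rw [h, one_mul, ← hκ, smul_eq_mul, inv_mul_cancel₀ (pair_rootK_star_u_ne_zero _ _)]
  · simp

theorem dA_mem_forms (b : flag q) : dA q b ∈ forms q := by
  simpa using smul_dA_mem (1 : flag q) b

variable (q) in
/-- The restriction of the derivation to the weight zero part of `A`. -/
def dFlag : wtSpace q 1 →ₗ[ℂ] FormsA q := dA q ∘ₗ (wtSpace q 1).subtype

theorem dFlag_mem_forms (b : wtSpace q 1) : dFlag q b ∈ forms q := by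
  have hb : (b : Oq q) ∈ flag q := mem_flag_iff_wtSpace.mpr b.2
  rw [dFlag, LinearMap.comp_apply, Submodule.subtype_apply]
  exact dA_mem_forms ⟨(b : Oq q), hb⟩

/-- The coproduct maps B into A ⊗ B, and the coaction of db is obtained by applying d to the second
leg. -/
theorem coactA_dA_mem {b : Oq q} (hb : b ∈ wtSpace q 1) : coactA q (dA q b) ∈
    LinearMap.range (LinearMap.lTensor (Oq q) (dFlag q)) := by
  obtain ⟨t, ht⟩ := comul_mem_wtSpace hb
  refine ⟨t, ?_⟩
  rw [coactA_dA, dFlag, LinearMap.lTensor_comp, LinearMap.comp_apply, ht]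

/-- The antipode identity applied to db with [b⁺] = e_γ; weights then restrict the multipliers. -/
theorem one_tmul_cotVec_mem_forms (γ : Root) : (1 : Oq q) ⊗ₜ cotVec γ ∈
    Submodule.span ℂ {ω | ∃ s ∈ wtSpace q (weight q γ)⁻¹, ∃ n ∈ forms q, ω = s • n} := by
  refine one_tmul_mem_span forms_le_formSpace ?_
  obtain ⟨b, hb⟩ := exists_flag_cls_eq (q := q) γ
  have h2 := one_tmul_evalA_mem (dFlag q) (coactA_dA_mem (mem_flag_iff_wtSpace.mp b.2))
  rw [evalA_dA, hb] at h2
  refine Submodule.span_mono ?_ h2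
  rintro _ ⟨s, n, ⟨b', hb'⟩, rfl⟩
  refine ⟨s, n, ?_, rfl⟩
  rw [← hb']
  exact dFlag_mem_forms b'

theorem tmul_cotVec_mem_forms {γ : Root} {a : Oq q} (ha : a ∈ wtSpace q (weight q γ)) :
    a ⊗ₜ cotVec γ ∈ forms q := by
  refine Submodule.span_le.mpr ?_ (tmul_cotVec_mem_span (one_tmul_cotVec_mem_forms γ) ha)
  rintro _ ⟨b, hb, -, n, hn, rfl⟩
  exact smul_mem_forms ⟨b, hb⟩ hn

/-- The one-forms of `O_q(F_3)` are the one-forms of `O_q(SU_3)` of weight zero. -/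
theorem forms_eq : forms q = formSpace q 1 := by
  refine le_antisymm forms_le_formSpace fun ω h => ?_
  rw [← sum_comp_tmul ω]
  refine Submodule.sum_mem _ fun γ _ => tmul_cotVec_mem_forms ?_
  simpa using h γ

theorem mem_forms_iff {ω : FormsA q} :
    ω ∈ forms q ↔ ∀ γ, comp γ ω ∈ wtSpace q (weight q γ) := by
  rw [forms_eq, mem_formSpace]
  simp

theorem comp_incl_mem (ω : FormsB q) (γ : Root) : comp γ (incl q ω) ∈ wtSpace q (weight q γ) :=
  mem_forms_iff.mp (incl_mem ω) γ

theorem span_cotVec : Submodule.span ℂ (Set.range cotVec) = (⊤ : Submodule ℂ (Cot q)) := by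
  rw [eq_top_iff]
  intro v _
  rw [← sum_coord_smul v]
  exact Submodule.sum_mem _ fun γ _ => Submodule.smul_mem _ _ (Submodule.subset_span ⟨γ, rfl⟩)

/-- For injectivity: if ε kills ω, each coefficient of ω lies in ker ε, so each a ⊗ e_γ in its
expansion is a B⁺-combination of forms on B. Surjectivity holds because every e_γ is the class of an
element of B. -/
theorem cotMap_bijective : Function.Bijective (cotMap q) := by
  constructor
  · rw [injective_iff_map_eq_zero]
    intro x hx
    obtain ⟨ω, rfl⟩ := (augForms q).mkQ_surjective x
    have hx : evalA q (incl q ω) = 0 := hx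
    rw [Submodule.mkQ_apply, Submodule.Quotient.mk_eq_zero]
    have h : incl q ω ∈ (augForms q).map (incl q) := by
      rw [← sum_comp_tmul (incl q ω)]
      refine Submodule.sum_mem _ fun γ _ => ?_
      have h0 : pair 1 (comp γ (incl q ω)) = 0 := by rw [← coord_evalA, hx, map_zero]
      refine Submodule.span_le.mpr ?_
        (tmul_cotVec_mem_span (one_tmul_cotVec_mem_forms γ) (comp_incl_mem ω γ))
      rintro _ ⟨b, hb, hb', n, hn, rfl⟩
      exact ⟨lmulB ⟨b, hb⟩ (FormsB.mk n hn),
        Submodule.subset_span ⟨⟨b, hb⟩, hb' h0, _, rfl⟩, rfl⟩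
    obtain ⟨η, hη, he⟩ := h
    rwa [← incl_injective he]
  · rw [← LinearMap.range_eq_top, eq_top_iff, ← span_cotVec, Submodule.span_le]
    rintro _ ⟨γ, rfl⟩
    obtain ⟨b, hb⟩ := exists_flag_cls_eq (q := q) γ
    exact ⟨(augForms q).mkQ (lmulB 1 (dB b)), by rw [cotMap_mk, hb]; simp⟩

/-! ### Subbimodules and subcomodules -/

variable (q) in
/-- The one-forms all of whose coefficients outside a set `S` of roots vanish. -/
def coordForms (S : Set Root) : Submodule ℂ (FormsB q) where
  carrier := {ω | ∀ γ ∉ S, comp γ (incl q ω) = 0}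
  add_mem' ha hb γ hγ := by rw [map_add, map_add, ha γ hγ, hb γ hγ, add_zero]
  zero_mem' γ _ := by simp
  smul_mem' c a ha γ hγ := by rw [map_smul, map_smul, ha γ hγ, smul_zero]

theorem formsB_ext {ω η : FormsB q} (h : ∀ γ, comp γ (incl q ω) = comp γ (incl q η)) : ω = η :=
  incl_injective (forms_ext h)

/-- The one-form `a ⊗ e_γ`. -/
def formOf (γ : Root) (a : Oq q) (ha : a ∈ wtSpace q (weight q γ)) : FormsB q :=
  FormsB.mk (a ⊗ₜ cotVec γ) (tmul_cotVec_mem_forms ha)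

theorem comp_formOf (β γ : Root) (a : Oq q) (ha : a ∈ wtSpace q (weight q γ)) :
    comp β (incl q (formOf γ a ha)) = if β = γ then a else 0 := by
  rw [formOf, incl_mk, comp_tmul, coord_cotVec]
  split_ifs <;> simp

theorem sum_formOf (ω : FormsB q) :
    ∑ γ, formOf γ (comp γ (incl q ω)) (comp_incl_mem ω γ) = ω := by
  apply incl_injective
  rw [map_sum]
  exact sum_comp_tmul _

theorem formOf_mem {S : Set Root} {γ : Root} (h : γ ∈ S) (a : Oq q)
    (ha : a ∈ wtSpace q (weight q γ)) : formOf γ a ha ∈ coordForms q S := by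
  intro β hβ
  rw [comp_formOf, if_neg]
  rintro rfl
  exact hβ h

/-- Every basis vector of `Λ¹` is the value of a one-form with a single coefficient. -/
theorem exists_formOf_eval (γ : Root) :
    ∃ (a : Oq q) (ha : a ∈ wtSpace q (weight q γ)),
      evalA q (incl q (formOf γ a ha)) = cotVec γ := by
  obtain ⟨b, hb⟩ := exists_flag_cls_eq (q := q) γ
  have ha : act (rootVec γ) (b : Oq q) ∈ wtSpace q (weight q γ) := by
    simpa using act_rootVec_mem γ (mem_flag_iff_wtSpace.mp b.2)
  refine ⟨_, ha, cot_ext fun β => ?_⟩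
  rw [coord_evalA, comp_formOf, coord_cotVec]
  split_ifs with h
  · rw [pair_one_act, ← coord_cls, hb, coord_cotVec, if_pos rfl]
  · simp

theorem mem_cotSub {N : Submodule ℂ (FormsB q)} {v : Cot q} :
    v ∈ cotSub N ↔ ∃ ω ∈ N, evalA q (incl q ω) = v := by
  constructor
  · rintro ⟨_, ⟨ω, hω, rfl⟩, rfl⟩
    exact ⟨ω, hω, rfl⟩
  · rintro ⟨ω, hω, rfl⟩
    exact ⟨_, ⟨ω, hω, rfl⟩, rfl⟩

theorem cotVec_mem_cotSub_coordForms {S : Set Root} {γ : Root} :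
    cotVec γ ∈ cotSub (coordForms q S) ↔ γ ∈ S := by
  rw [mem_cotSub]
  constructor
  · rintro ⟨ω, hω, h⟩
    by_contra hγ
    have := coord_evalA γ (incl q ω)
    rw [hω γ hγ, h, coord_cotVec] at this
    simp at this
  · intro h
    obtain ⟨a, ha, he⟩ := exists_formOf_eval (q := q) γ
    exact ⟨_, formOf_mem h a ha, he⟩

/-- S is read off from the basis vectors in the image in Λ¹. -/
theorem coordForms_injective : Function.Injective (coordForms q) := by
  intro S S' h
  ext γ
  rw [← cotVec_mem_cotSub_coordForms (q := q), h, cotVec_mem_cotSub_coordForms]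

theorem cotSub_coordForms (S : Set Root) :
    cotSub (coordForms q S) = Submodule.span ℂ (cotVec '' S) := by
  apply le_antisymm
  · intro v hv
    obtain ⟨ω, hω, rfl⟩ := mem_cotSub.mp hv
    rw [← sum_coord_smul (evalA q (incl q ω))]
    refine Submodule.sum_mem _ fun γ _ => ?_
    by_cases h : γ ∈ S
    · exact Submodule.smul_mem _ _ (Submodule.subset_span ⟨γ, h, rfl⟩)
    · rw [coord_evalA, hω γ h, map_zero, zero_smul]
      exact Submodule.zero_mem _
  · rw [Submodule.span_le]
    rintro _ ⟨γ, h, rfl⟩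
    exact cotVec_mem_cotSub_coordForms.mpr h

/-- The value of a subcomodule is stable under the weight operators of `Λ¹`. -/
theorem coord_mul_mem_cotSub {N : Submodule ℂ (FormsB q)} (hN : IsSubComodule N) (i : Fin 2)
    {v : Cot q} (hv : v ∈ cotSub N) :
    ∃ w ∈ cotSub N, ∀ γ, coord γ w = weight q γ i * coord γ v := by
  obtain ⟨ω, hω, rfl⟩ := mem_cotSub.mp hv
  obtain ⟨n, hn⟩ := formAct_mem _ (hN ω hω) (K i)
  refine ⟨_, mem_cotSub.mpr ⟨n, n.2, rfl⟩, fun γ => ?_⟩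
  have hn : incl q n = formAct (K i) (incl q ω) := hn
  -- The coefficient a at γ has weight γ, so ⟨K_i, a⟩ = ε(K_i ▷ a) is the weight times ε(a). Here a
  -- translation by the coaction becomes an operator on Λ¹.
  rw [hn, coord_evalA_formAct, coord_evalA, ← pair_one_act, comp_incl_mem ω γ i, map_smul,
    smul_eq_mul]

/-- The value of a subcomodule is spanned by basis vectors. -/
theorem cotVec_mem_cotSub {N : Submodule ℂ (FormsB q)} (hN : IsSubComodule N)
    {v : Cot q} (hv : v ∈ cotSub N) {γ : Root} (hγ : coord γ v ≠ 0) : cotVec γ ∈ cotSub N := by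
  -- Elimination: `s` contains every root other than γ at which v may still have a nonzero
  -- coordinate, and it shrinks by one root at each step.
  have step : ∀ (s : Finset Root) (v : Cot q), v ∈ cotSub N → coord γ v ≠ 0 →
      (∀ β, β ∉ s → β ≠ γ → coord β v = 0) → cotVec γ ∈ cotSub N := by
    intro s
    induction s using Finset.induction_on with
    | empty =>
      intro v hv h1 h2
      have : cotVec γ = (coord γ v)⁻¹ • v := by
        apply cot_ext
        intro β
        rw [coord_cotVec, map_smul, smul_eq_mul]
        split_ifs with h
        · rw [h, inv_mul_cancel₀ h1]
        · rw [h2 β (by simp) h, mul_zero]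
      rw [this]
      exact Submodule.smul_mem _ _ hv
    | insert β s hβ ih =>
      intro v hv h1 h2
      by_cases hβγ : β = γ
      · refine ih v hv h1 fun δ hδ hδγ => h2 δ ?_ hδγ
        rw [Finset.mem_insert, not_or]
        exact ⟨by rw [hβγ]; exact hδγ, hδ⟩
      · obtain ⟨i, hi⟩ : ∃ i, weight q β i ≠ weight q γ i := by
          by_contra! h
          exact hβγ (weight_injective (funext h))
        obtain ⟨w, hw, hw'⟩ := coord_mul_mem_cotSub hN i hv
        -- The weight operator minus its eigenvalue at β kills the β-coordinate, multiplies the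
        -- γ-coordinate by a nonzero difference of weights, and creates no new nonzero coordinates.
        refine ih (w - weight q β i • v)
          (Submodule.sub_mem _ hw (Submodule.smul_mem _ _ hv)) ?_ ?_
        · rw [map_sub, map_smul, hw', smul_eq_mul, ← sub_mul]
          exact mul_ne_zero (sub_ne_zero.mpr hi.symm) h1
        · intro δ hδ hδγ
          rw [map_sub, map_smul, hw', smul_eq_mul, ← sub_mul]
          by_cases hδβ : δ = β
          · rw [hδβ, sub_self, zero_mul]
          · rw [h2 δ (by simp [hδβ, hδ]) hδγ, mul_zero]
  exact step Finset.univ v hv hγ (by simp)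

/-- A subcomodule and left submodule of `Ω¹_q(F_3)` is determined by a set of roots. -/
theorem eq_coordForms {N : Submodule ℂ (FormsB q)} (hN : IsSubComodule N)
    (hl : ∀ b, ∀ ω ∈ N, lmulB b ω ∈ N) : N = coordForms q {γ | cotVec γ ∈ cotSub N} := by
  apply le_antisymm
  · intro ω hω γ hγ
    -- The value at Z of the γ-coefficient is the γ-coordinate of ε(Z·ω). Since Z·ω is again in N, a
    -- nonzero value would put e_γ into the image of N.
    apply ext_pair
    intro Z
    rw [map_zero, ← coord_evalA_formAct]
    by_contra h
    obtain ⟨n, hn⟩ := formAct_mem _ (hN ω hω) Z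
    have hn : incl q n = formAct Z (incl q ω) := hn
    rw [← hn] at h
    exact hγ (cotVec_mem_cotSub hN (mem_cotSub.mpr ⟨n, n.2, rfl⟩) h)
  · intro ω hω
    rw [← sum_formOf ω]
    refine Submodule.sum_mem _ fun γ _ => ?_
    by_cases hγ : cotVec γ ∈ cotSub N
    · obtain ⟨n, hn, he⟩ := mem_cotSub.mp hγ
      have h1 := one_tmul_evalA_mem _ (hN n hn)
      rw [he] at h1
      have hle : LinearMap.range (incl q ∘ₗ N.subtype) ≤ formSpace q 1 := by
        rw [← forms_eq]
        rintro _ ⟨m, rfl⟩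
        exact incl_mem _
      have h2 := tmul_cotVec_mem_span (one_tmul_mem_span hle h1) (comp_incl_mem ω γ)
      have h3 : comp γ (incl q ω) ⊗ₜ cotVec γ ∈ N.map (incl q) := by
        refine Submodule.span_le.mpr ?_ h2
        rintro _ ⟨b, hb, -, _, ⟨m, rfl⟩, rfl⟩
        exact ⟨lmulB ⟨b, hb⟩ m, hl _ _ m.2, rfl⟩
      obtain ⟨m, hm, hm'⟩ := h3
      have : formOf γ (comp γ (incl q ω)) (comp_incl_mem ω γ) = m := incl_injective hm'.symm
      rwa [this]
    · have h0 : comp γ (incl q ω) = 0 := hω γ hγ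
      have : formOf γ (comp γ (incl q ω)) (comp_incl_mem ω γ) = 0 := by
        apply incl_injective
        rw [formOf, incl_mk, h0, TensorProduct.zero_tmul, map_zero]
      rw [this]
      exact Submodule.zero_mem _

/-- The coaction applies the coproduct to each coefficient, and the second leg keeps the weight γ,
so it is again the coefficient of a form on B at the same root. -/
theorem isSubComodule_coordForms (S : Set Root) : IsSubComodule (coordForms q S) := by
  intro ω hω
  rw [← sum_comp_tmul (incl q ω), map_sum]
  refine Submodule.sum_mem _ fun γ _ => ?_
  by_cases h : γ ∈ S
  · let f : wtSpace q (weight q γ) →ₗ[ℂ] coordForms q S :=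
      { toFun := fun a => ⟨formOf γ a a.2, formOf_mem h _ _⟩
        map_add' := fun a b => Subtype.ext (incl_injective (TensorProduct.add_tmul _ _ _))
        map_smul' := fun c a => Subtype.ext (incl_injective (TensorProduct.smul_tmul' _ _ _).symm) }
    obtain ⟨t, ht⟩ := comul_mem_wtSpace (comp_incl_mem ω γ)
    refine ⟨LinearMap.lTensor (Oq q) f t, ?_⟩
    rw [coactA_tmul, ← ht]
    clear ht
    induction t using TensorProduct.induction_on with
    | zero => simp
    | add x y hx hy => simp only [map_add, TensorProduct.add_tmul, hx, hy]
    | tmul a b => rfl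
  · rw [hω γ h, TensorProduct.zero_tmul, map_zero]
    exact Submodule.zero_mem _

end Oq
end

noncomputable section

namespace Uq

variable {q : DefParam}

/-! ### The map `θ` on the tangent space -/

theorem theta_sub (x y : Uq q) : theta q (x - y) = theta q x - theta q y := map_sub _ _ _

theorem theta_smul (c : ℂ) (x : Uq q) : theta q (c • x) = conj c • theta q x :=
  LinearMap.map_smulₛₗ _ _ _

theorem theta_K_mul_F (i : Fin 2) : theta q (K i * F i) = -(q.c⁻¹ • (Kinv i * E i)) := by
  rw [theta_mul, theta_K, theta_F, mul_neg, mul_smul_comm]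

theorem theta_E_eq (i : Fin 2) : theta q (E i) = -q.c • Kinv i * (K i * F i) := by
  rw [theta_E, smul_mul_assoc, ← mul_assoc, Kinv_mul_K, one_mul, neg_smul]

/-- θ(E_{α₁+α₂}) = q² F_2 F_1 - q F_1 F_2 is a different q-commutator from the one in F_{α₁+α₂}; the
difference (q² - 1) F_2 F_1 is a left multiple of F_{α₁}. The root vectors stand on the right so
that their left multipliers can act on the coefficients of any form. -/
theorem theta_rootE_a12 : theta q (rootE .a12) =
    ((q.c ^ 2 - 1) • (F 1 * Kinv 0)) * rootF .a1 +
      (-q.c ^ 2 • (Kinv 1 * Kinv 0)) * rootF .a12 := by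
  have hq := q.c_ne_zero
  have e1 : (F 1 * Kinv 0 * (K 0 * F 0) : Uq q) = F 1 * F 0 := by
    rw [mul_assoc, ← mul_assoc (Kinv 0), Kinv_mul_K, one_mul]
  have e2 : ∀ x : Uq q, Kinv 1 * Kinv 0 * (K 0 * K 1 * x) = x := by
    intro x
    have : (Kinv 1 * Kinv 0 * (K 0 * K 1 * x) : Uq q) =
        Kinv 1 * (Kinv 0 * K 0) * (K 1 * x) := by noncomm_ring
    rw [this, Kinv_mul_K, mul_one, ← mul_assoc, Kinv_mul_K, one_mul]
  simp only [rootE, rootF, theta_sub, theta_smul, theta_mul, theta_E, smul_mul_assoc, e1, e2,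
    mul_smul_comm, neg_mul_neg, smul_smul, map_inv₀, DefParam.conj_c]
  match_scalars <;> field_simp <;> ring1

theorem E_mul_Kinv {i j : Fin 2} (h : i ≠ j) :
    (E i * Kinv j : Uq q) = q.c⁻¹ • (Kinv j * E i) := by
  have hq := q.c_ne_zero
  rw [Kinv_mul_E, smul_smul]
  simp [cartanA2, h.symm, hq]

theorem theta_rootF_a12 : theta q (rootF .a12) =
    ((q.c⁻¹ ^ 3 * (q.c - q.c⁻¹)) • (Kinv 0 * Kinv 1 * E 1)) * rootE .a1 +
      (-q.c⁻¹ ^ 2 • (Kinv 0 * Kinv 1)) * rootE .a12 := by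
  have hq := q.c_ne_zero
  have e1 : (Kinv 0 * E 0 * (Kinv 1 * E 1) : Uq q) =
      q.c⁻¹ • (Kinv 0 * Kinv 1 * (E 0 * E 1)) := by
    have : (Kinv 0 * E 0 * (Kinv 1 * E 1) : Uq q) = Kinv 0 * (E 0 * Kinv 1) * E 1 := by
      noncomm_ring
    rw [this, E_mul_Kinv (by decide)]
    simp [mul_assoc]
  have e2 : (Kinv 1 * E 1 * (Kinv 0 * E 0) : Uq q) =
      q.c⁻¹ • (Kinv 0 * Kinv 1 * (E 1 * E 0)) := by
    have : (Kinv 1 * E 1 * (Kinv 0 * E 0) : Uq q) = Kinv 1 * (E 1 * Kinv 0) * E 0 := by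
      noncomm_ring
    rw [this, E_mul_Kinv (by decide), Kinv_mul_Kinv 0 1]
    simp [mul_assoc]
  rw [rootF_a12_eq]
  simp only [rootE, rootF, theta_sub, theta_smul, theta_mul (K 0 * F 0), theta_mul (K 1 * F 1),
    theta_K_mul_F, neg_mul_neg, smul_mul_assoc, mul_smul_comm, e1, e2, smul_smul, map_inv₀,
    DefParam.conj_c, mul_sub, mul_assoc (Kinv 0 * Kinv 1)]
  match_scalars <;> field_simp <;> ring1

end Uq

namespace Oq

open Uq

variable {q : DefParam}

/-! ### The involution of the calculus -/

theorem star_smul (c : ℂ) (a : Oq q) : star q (c • a) = conj c • star q a :=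
  LinearMap.map_smulₛₗ _ _ _

theorem star_add (a b : Oq q) : star q (a + b) = star q a + star q b := map_add _ _ _

variable (q) in
/-- The adjoints of the coefficients of the involution of one-forms. -/
def starComp : Root → FormsA q →ₗ[ℂ] Oq q
  | .inl .a1 => act (-q.c • Kinv 0) ∘ₗ comp (.inr .a1)
  | .inl .a2 => act (-q.c • Kinv 1) ∘ₗ comp (.inr .a2)
  | .inl .a12 => act ((q.c ^ 2 - 1) • (F 1 * Kinv 0)) ∘ₗ comp (.inr .a1) +
      act (-q.c ^ 2 • (Kinv 1 * Kinv 0)) ∘ₗ comp (.inr .a12)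
  | .inr .a1 => act (-q.c⁻¹ • Kinv 0) ∘ₗ comp (.inl .a1)
  | .inr .a2 => act (-q.c⁻¹ • Kinv 1) ∘ₗ comp (.inl .a2)
  | .inr .a12 => act ((q.c⁻¹ ^ 3 * (q.c - q.c⁻¹)) • (Kinv 0 * Kinv 1 * E 1)) ∘ₗ comp (.inl .a1) +
      act (-q.c⁻¹ ^ 2 • (Kinv 0 * Kinv 1)) ∘ₗ comp (.inl .a12)

/-- Since the coefficients of da are X_β ▷ a, the multipliers in `starComp` reassemble θ(X_γ). -/
theorem starComp_dA (γ : Root) (a : Oq q) :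
    starComp q γ (dA q a) = act (theta q (rootVec γ)) a := by
  rcases γ with γ | γ <;> cases γ <;>
    simp only [starComp, LinearMap.add_apply, LinearMap.comp_apply, comp_dA, ← act_mul, ← act_add,
      rootVec, Sum.elim_inl, Sum.elim_inr]
  · rw [rootE, theta_E_eq, rootF]
  · rw [rootE, theta_E_eq, rootF]
  · rw [theta_rootE_a12]
  · rw [rootF, theta_K_mul_F, rootE, smul_mul_assoc, neg_smul]
  · rw [rootF, theta_K_mul_F, rootE, smul_mul_assoc, neg_smul]
  · rw [theta_rootF_a12]

variable (q) in
/-- The involution of `Ω¹_q(SU_3)`. -/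
def formStarA : FormsA q →ₛₗ[starRingEnd ℂ] FormsA q where
  toFun ω := ∑ γ, star q (starComp q γ ω) ⊗ₜ cotVec γ
  map_add' ω η := by
    simp only [map_add, TensorProduct.add_tmul, Finset.sum_add_distrib]
  map_smul' c ω := by
    simp only [map_smul, star_smul, ← TensorProduct.smul_tmul', Finset.smul_sum]

theorem comp_formStarA (γ : Root) (ω : FormsA q) :
    comp γ (formStarA q ω) = star q (starComp q γ ω) :=
  comp_sum_tmul γ fun γ => star q (starComp q γ ω)

theorem formStarA_dA (a : Oq q) : formStarA q (dA q a) = dA q (star q a) :=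
  forms_ext fun γ => by rw [comp_formStarA, starComp_dA, comp_dA, act_star]

/-- At ±α₁ and ±α₂ the multipliers are group-like up to scalars. At ±(α₁+α₂) the skew-primitive
factor acting on `a` yields an extra term, which matches the off-diagonal term of the right
multiplication. -/
theorem formStarA_smul (a : Oq q) (ω : FormsA q) :
    formStarA q (a • ω) = rmulA (formStarA q ω) (star q a) := by
  have hq := q.c_ne_zero
  apply forms_ext
  intro γ
  rcases γ with γ | γ <;> cases γ
  · rw [comp_rmulA_E1]
    simp only [comp_formStarA, starComp, LinearMap.comp_apply, comp_smul, act_smul, act_Kinv_mul,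
      act_star, theta_K, star_smul, star_mul, smul_mul_assoc]
  · rw [comp_rmulA_E2]
    simp only [comp_formStarA, starComp, LinearMap.comp_apply, comp_smul, act_smul, act_Kinv_mul,
      act_star, theta_K, star_smul, star_mul, smul_mul_assoc]
  · rw [comp_rmulA_E12]
    simp only [comp_formStarA, starComp, LinearMap.comp_apply, LinearMap.add_apply, comp_smul,
      act_smul, act_mul, act_Kinv_mul, act_F_mul, act_star, theta_mul, theta_K, theta_E, star_smul,
      star_mul, star_add, smul_mul_assoc, mul_smul_comm, act_neg, map_neg, Kinv_mul_Kinv 0 1,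
      add_mul, mul_neg, smul_add, smul_neg]
    simp only [map_sub, map_pow, map_one, DefParam.conj_c]
    match_scalars <;> field_simp
  · rw [comp_rmulA_F1]
    simp only [comp_formStarA, starComp, LinearMap.comp_apply, comp_smul, act_smul, act_Kinv_mul,
      act_star, theta_K, star_smul, star_mul, smul_mul_assoc]
  · rw [comp_rmulA_F2]
    simp only [comp_formStarA, starComp, LinearMap.comp_apply, comp_smul, act_smul, act_Kinv_mul,
      act_star, theta_K, star_smul, star_mul, smul_mul_assoc]
  · rw [comp_rmulA_F12]
    have e1 : ∀ x : Oq q, act (Kinv 1) (act (K 1) x) = x := fun x => by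
      rw [← act_mul, Kinv_mul_K, act_one]
    have e2 : ∀ x : Oq q, act (Kinv 1) (act (E 1) (act (Kinv 0) x)) =
        q.c⁻¹ • act (Kinv 0) (act (Kinv 1) (act (E 1) x)) := fun x => by
      rw [← act_mul, ← act_mul, ← act_mul, ← act_mul, mul_assoc (Kinv 1), E_mul_Kinv (by decide),
        mul_smul_comm, act_smul, ← mul_assoc, Kinv_mul_Kinv 0 1]
    simp only [comp_formStarA, starComp, LinearMap.comp_apply, LinearMap.add_apply, comp_smul,
      act_smul, act_mul, act_Kinv_mul, act_E_mul, act_star, theta_mul, theta_K, theta_F, star_smul,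
      star_mul, smul_mul_assoc, mul_smul_comm, act_neg, map_neg, add_mul, mul_neg,
      smul_neg, smul_add, map_add, e1, e2]
    simp only [map_sub, map_pow, map_mul, map_inv₀, DefParam.conj_c]
    match_scalars <;> field_simp

theorem formStarA_mem {ω : FormsA q} (h : ω ∈ forms q) : formStarA q ω ∈ forms q := by
  induction h using Submodule.span_induction with
  | mem x hx =>
    obtain ⟨b, b', rfl⟩ := hx
    rw [formStarA_smul, formStarA_dA]
    exact rmulA_mem_forms (starB b) (dA_mem_forms (starB b'))
  | zero => rw [map_zero]; exact Submodule.zero_mem _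
  | add x y _ _ hx hy => rw [map_add]; exact Submodule.add_mem _ hx hy
  | smul c x _ hx => rw [LinearMap.map_smulₛₗ]; exact Submodule.smul_mem _ _ hx

/-- On forms b' db'' the Leibniz rule writes (db'') b as d(b''b) - b'' db, which reduces the claim
to left multiplication and exact forms. -/
theorem formStarA_rmulA {ω : FormsA q} (h : ω ∈ forms q) (b : Oq q) :
    formStarA q (rmulA ω b) = star q b • formStarA q ω := by
  induction h using Submodule.span_induction with
  | mem x hx =>
    obtain ⟨b', b'', rfl⟩ := hx
    have h : ∀ a : Oq q, rmulA (dA q a) b = dA q (a * b) - a • dA q b := fun a => by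
      rw [dA_mul, add_sub_cancel_right]
    rw [rmulA_smul_left, formStarA_smul, formStarA_smul, h, map_sub, formStarA_smul, formStarA_dA,
      formStarA_dA, formStarA_dA, star_mul, dA_mul, add_sub_cancel_left, rmulA_smul_left]
  | zero => simp [rmulA_zero_left]
  | add x y _ _ hx hy => rw [rmulA_add_left, map_add, hx, hy, map_add, smul_add]
  | smul c x _ hx =>
    rw [rmulA_csmul_left, LinearMap.map_smulₛₗ, hx, LinearMap.map_smulₛₗ, smul_comm]

theorem formStarA_formStarA {ω : FormsA q} (h : ω ∈ forms q) :
    formStarA q (formStarA q ω) = ω := by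
  induction h using Submodule.span_induction with
  | mem x hx =>
    obtain ⟨b, b', rfl⟩ := hx
    have h : dA q (star q b') ∈ forms q := dA_mem_forms (starB b')
    rw [formStarA_smul, formStarA_dA, formStarA_rmulA h, formStarA_dA, star_star, star_star]
  | zero => simp
  | add x y _ _ hx hy => rw [map_add, map_add, hx, hy]
  | smul c x _ hx =>
    rw [LinearMap.map_smulₛₗ, LinearMap.map_smulₛₗ, hx, Complex.conj_conj]

variable (q) in
/-- The involution of `Ω¹_q(F_3)`. -/
def formStar : FormsB q →ₛₗ[starRingEnd ℂ] FormsB q where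
  toFun ω := FormsB.mk (formStarA q (incl q ω)) (formStarA_mem (incl_mem ω))
  map_add' ω η := incl_injective (by simp)
  map_smul' c ω := incl_injective (by simp)

theorem incl_formStar (ω : FormsB q) : incl q (formStar q ω) = formStarA q (incl q ω) := rfl

theorem isFormStar_formStar : IsFormStar (formStar q) where
  star_star ω := incl_injective (formStarA_formStarA (incl_mem ω))
  star_d _ := incl_injective (formStarA_dA _)
  star_lmul _ _ := incl_injective (formStarA_smul _ _)
  star_rmul ω _ := incl_injective (formStarA_rmulA (incl_mem ω) _)

/-- The axioms prescribe the value (db')^* b^* on each b db', and these span. -/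
theorem IsFormStar.unique {σ τ : FormsB q →ₛₗ[starRingEnd ℂ] FormsB q} (hσ : IsFormStar σ)
    (hτ : IsFormStar τ) : σ = τ := by
  apply LinearMap.ext
  suffices h : ∀ (ω : FormsA q) (hω : ω ∈ forms q), σ (FormsB.mk ω hω) = τ (FormsB.mk ω hω) from
    fun ω => h _ (incl_mem ω)
  intro ω hω
  induction hω using Submodule.span_induction with
  | mem x hx =>
    obtain ⟨b, b', rfl⟩ := hx
    change σ (lmulB b (dB b')) = τ (lmulB b (dB b'))
    rw [hσ.star_lmul, hτ.star_lmul, hσ.star_d, hτ.star_d]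
  | zero => exact (map_zero σ).trans (map_zero τ).symm
  | add x y hx' hy' hx hy =>
    exact (map_add σ (FormsB.mk x hx') (FormsB.mk y hy')).trans
      ((congrArg₂ _ hx hy).trans (map_add τ (FormsB.mk x hx') (FormsB.mk y hy')).symm)
  | smul c x hx' hx =>
    exact (LinearMap.map_smulₛₗ σ c (FormsB.mk x hx')).trans
      ((congrArg _ hx).trans (LinearMap.map_smulₛₗ τ c (FormsB.mk x hx')).symm)

/-! ### Sets of roots that define subbimodules -/

/-- The sets of roots that contain `±(α₁ + α₂)` as soon as they contain `±α₁`. -/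
structure IsClosedSet (S : Set Root) : Prop where
  inl : .inl .a1 ∈ S → .inl .a12 ∈ S
  inr : .inr .a1 ∈ S → .inr .a12 ∈ S

theorem isSubBimodule_coordForms {S : Set Root} (hS : IsClosedSet S) :
    IsSubBimodule (coordForms q S) where
  lmul_mem b ω hω γ hγ := by
    change comp γ ((b : Oq q) • incl q ω) = 0
    rw [comp_smul, hω γ hγ, mul_zero]
  rmul_mem b ω hω γ hγ := by
    change comp γ (rmulA (incl q ω) (b : Oq q)) = 0
    rcases γ with γ | γ <;> cases γ
    · rw [comp_rmulA_E1, hω _ hγ, zero_mul]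
    · rw [comp_rmulA_E2, hω _ hγ, zero_mul]
    · rw [comp_rmulA_E12, hω _ hγ, hω _ (fun h => hγ (hS.inl h)), zero_mul, zero_mul, smul_zero,
        add_zero]
    · rw [comp_rmulA_F1, hω _ hγ, zero_mul]
    · rw [comp_rmulA_F2, hω _ hγ, zero_mul]
    · rw [comp_rmulA_F12, hω _ hγ, hω _ (fun h => hγ (hS.inr h)), zero_mul, zero_mul, smul_zero,
        add_zero]

theorem pair_one_mul (a b : Oq q) : pair 1 (a * b) = pair 1 a * pair 1 b :=
  map_mul (counitHom q) a b

theorem pair_mul_K {b : Oq q} (hb : b ∈ flag q) (X : Uq q) (i : Fin 2) :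
    pair (X * K i) b = pair X b := by
  rw [← pair_act, (mem_flag_iff.mp hb).1]

/-- A form with single coefficient at α₁ and value e_{α₁} is multiplied on the right by some b in B
of class e_{α₂}. Its α₁+α₂ coefficient then has counit q⁻¹(q - q⁻¹), since ⟨E_2 K_1, b⟩ = ⟨E_2, b⟩ =
1 by invariance of b. This is nonzero as q² ≠ 1. The negative roots are analogous. -/
theorem isClosedSet_of_isSubBimodule {S : Set Root} (h : IsSubBimodule (coordForms q S)) :
    IsClosedSet S where
  inl h1 := by
    by_contra h12
    obtain ⟨a, ha, he⟩ := exists_formOf_eval (q := q) (.inl .a1)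
    obtain ⟨b, hb⟩ := exists_flag_cls_eq (q := q) (.inl .a2)
    have h0 := congrArg (pair 1) (h.rmul_mem b _ (formOf_mem h1 a ha) _ h12)
    have hE : pair (E 1 * K 0) (b : Oq q) = 1 := by
      have := coord_cls (.inl .a2) (b : Oq q)
      rw [hb, coord_cotVec, if_pos rfl] at this
      rw [pair_mul_K b.2, this]
      rfl
    change pair 1 (comp (.inl .a12) (rmulA (incl q (formOf (.inl .a1) a ha)) (b : Oq q))) = _ at h0
    rw [comp_rmulA_E12, map_add, map_smul, pair_one_mul, pair_one_mul, ← coord_evalA,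
      ← coord_evalA, he, pair_one_act, pair_one_act, hE, coord_cotVec, coord_cotVec] at h0
    simp [q.c_ne_zero, q.c_sub_inv_ne_zero] at h0
  inr h1 := by
    by_contra h12
    obtain ⟨a, ha, he⟩ := exists_formOf_eval (q := q) (.inr .a1)
    obtain ⟨b, hb⟩ := exists_flag_cls_eq (q := q) (.inr .a2)
    have h0 := congrArg (pair 1) (h.rmul_mem b _ (formOf_mem h1 a ha) _ h12)
    have hF : pair (K 1 * F 1 * K 0) (b : Oq q) = 1 := by
      have := coord_cls (.inr .a2) (b : Oq q)
      rw [hb, coord_cotVec, if_pos rfl] at this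
      rw [pair_mul_K b.2, this]
      rfl
    change pair 1 (comp (.inr .a12) (rmulA (incl q (formOf (.inr .a1) a ha)) (b : Oq q))) = _ at h0
    rw [comp_rmulA_F12, map_add, map_smul, pair_one_mul, pair_one_mul, ← coord_evalA,
      ← coord_evalA, he, pair_one_act, pair_one_act, hF, coord_cotVec, coord_cotVec] at h0
    simp [q.c_sub_inv_ne_zero] at h0

theorem IsClosedSet.swap {S : Set Root} (hS : IsClosedSet S) : IsClosedSet (Sum.swap ⁻¹' S) :=
  ⟨hS.inr, hS.inl⟩

/-- The involution exchanges γ and -γ except that the coefficient at ±(α₁+α₂) also involves the one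
at ∓α₁. If ∓(α₁+α₂) is not in S, closedness excludes ∓α₁ as well, so the extra term vanishes. -/
theorem formStar_mem_coordForms {S : Set Root} (hS : IsClosedSet S) {ω : FormsB q}
    (hω : ω ∈ coordForms q S) : formStar q ω ∈ coordForms q (Sum.swap ⁻¹' S) := by
  intro γ hγ
  have h0 : comp γ.swap (incl q ω) = 0 := hω _ hγ
  rw [incl_formStar, comp_formStarA]
  suffices h : starComp q γ (incl q ω) = 0 by rw [h, map_zero]
  rcases γ with γ | γ <;> cases γ
  all_goals
    simp only [starComp, LinearMap.comp_apply, LinearMap.add_apply]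
    simp only [Sum.swap_inl, Sum.swap_inr] at h0
    rw [h0, map_zero]
  · rw [hω _ fun h => hγ (hS.inr h), map_zero, add_zero]
  · rw [hω _ fun h => hγ (hS.inl h), map_zero, add_zero]

theorem map_formStar_coordForms {S : Set Root} (hS : IsClosedSet S) :
    (coordForms q S).map (formStar q) = coordForms q (Sum.swap ⁻¹' S) := by
  apply le_antisymm
  · rintro _ ⟨ω, hω, rfl⟩
    exact formStar_mem_coordForms hS hω
  · intro ω hω
    have h := formStar_mem_coordForms hS.swap hω
    rw [← Set.preimage_comp, Sum.swap_swap_eq, Set.preimage_id] at h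
    exact ⟨_, h, isFormStar_formStar.star_star ω⟩

theorem isCompl_coordForms_compl (S : Set Root) :
    IsCompl (coordForms q S) (coordForms q Sᶜ) := by
  constructor
  · rw [Submodule.disjoint_def]
    intro ω h1 h2
    apply formsB_ext
    intro γ
    rw [map_zero, map_zero]
    by_cases h : γ ∈ S
    · exact h2 γ fun h' => h' h
    · exact h1 γ h
  · rw [codisjoint_iff, eq_top_iff]
    intro ω _
    rw [← sum_formOf ω]
    refine Submodule.sum_mem _ fun γ _ => ?_
    by_cases h : γ ∈ S
    · exact Submodule.mem_sup_left (formOf_mem h _ _)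
    · exact Submodule.mem_sup_right (formOf_mem h _ _)

/-- A form with one nonzero coefficient, at γ, would lie in both spaces if γ were in both sets, and
outside their sum if γ were in neither. -/
theorem eq_compl_of_isCompl {S S' : Set Root} (h : IsCompl (coordForms q S) (coordForms q S')) :
    S' = Sᶜ := by
  have hev : ∀ γ, ∃ ω, ∀ T : Set Root, γ ∈ T → ω ∈ coordForms q T ∧ ω ≠ 0 := by
    intro γ
    obtain ⟨a, ha, he⟩ := exists_formOf_eval (q := q) γ
    refine ⟨formOf γ a ha, fun T hT => ⟨formOf_mem hT a ha, fun h0 => ?_⟩⟩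
    have := congrArg (coord γ) he
    rw [h0, coord_cotVec] at this
    simp at this
  ext γ
  constructor
  · intro h' hγ
    obtain ⟨ω, hω⟩ := hev γ
    exact (hω S hγ).2 (Submodule.disjoint_def.mp h.disjoint ω (hω S hγ).1 (hω S' h').1)
  · intro hγ
    by_contra hγ'
    obtain ⟨a, ha, he⟩ := exists_formOf_eval (q := q) γ
    have htop : coordForms q S ⊔ coordForms q S' ≤ coordForms q {γ}ᶜ := by
      refine sup_le ?_ ?_
      · intro η hη β hβ
        refine hη β ?_
        rw [not_not.mp hβ]
        exact hγ
      · intro η hη β hβ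
        refine hη β ?_
        rw [not_not.mp hβ]
        exact hγ'
    rw [h.sup_eq_top] at htop
    have := mem_cotSub.mpr ⟨_, htop (Submodule.mem_top (x := formOf γ a ha)), he⟩
    exact cotVec_mem_cotSub_coordForms.mp this rfl

/-! ### Classification -/

theorem isCovariantFoacs_iff (P : Submodule ℂ (FormsB q) × Submodule ℂ (FormsB q)) :
    IsCovariantFoacs (formStar q) P ↔ ∃ S : Set Root, IsClosedSet S ∧ Sum.swap ⁻¹' S = Sᶜ ∧
      P = (coordForms q S, coordForms q Sᶜ) := by
  constructor
  · intro h
    obtain ⟨P₁, P₂⟩ := P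
    obtain ⟨S, rfl⟩ : ∃ S, P₁ = coordForms q S :=
      ⟨_, eq_coordForms h.comodule_fst h.bimodule_fst.lmul_mem⟩
    obtain ⟨S', rfl⟩ : ∃ S', P₂ = coordForms q S' :=
      ⟨_, eq_coordForms h.comodule_snd h.bimodule_snd.lmul_mem⟩
    have hS := isClosedSet_of_isSubBimodule h.bimodule_fst
    have h1 : S' = Sᶜ := eq_compl_of_isCompl h.isCompl
    have h2 := h.star_eq
    rw [map_formStar_coordForms hS] at h2
    exact ⟨S, hS, (coordForms_injective h2).trans h1, by rw [h1]⟩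
  · rintro ⟨S, hS, h, rfl⟩
    exact ⟨isSubBimodule_coordForms hS, isSubBimodule_coordForms (h ▸ hS.swap),
      isCompl_coordForms_compl S, by rw [map_formStar_coordForms hS, h],
      isSubComodule_coordForms _, isSubComodule_coordForms _⟩

/-- The positive roots. -/
def rootsPos : Set Root := {.inl .a1, .inl .a2, .inl .a12}

/-- The positive roots with `α₂` replaced by `-α₂`. -/
def rootsMixed : Set Root := {.inl .a1, .inr .a2, .inl .a12}

theorem compl_rootsPos : rootsPosᶜ = {.inr .a1, .inr .a2, .inr .a12} := by
  ext γ
  rcases γ with γ | γ <;> cases γ <;> simp [rootsPos]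

theorem compl_rootsMixed : rootsMixedᶜ = {.inr .a1, .inl .a2, .inr .a12} := by
  ext γ
  rcases γ with γ | γ <;> cases γ <;> simp [rootsMixed]

/-- The complement condition makes S a choice of sign for each positive root; closedness then ties
the sign of α₁+α₂ to that of α₁. -/
theorem isClosedSet_and_iff (S : Set Root) : IsClosedSet S ∧ Sum.swap ⁻¹' S = Sᶜ ↔
    S = rootsPos ∨ S = rootsPosᶜ ∨ S = rootsMixed ∨ S = rootsMixedᶜ := by
  constructor
  · rintro ⟨hS, h⟩
    have hswap : ∀ γ, Sum.inr γ ∈ S ↔ Sum.inl γ ∉ S := fun γ => Set.ext_iff.mp h (.inl γ)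
    have h12 : Sum.inl PosRoot.a12 ∈ S ↔ Sum.inl PosRoot.a1 ∈ S := by
      refine ⟨fun h1 => ?_, hS.inl⟩
      by_contra h2
      exact (hswap .a12).mp (hS.inr ((hswap .a1).mpr h2)) h1
    -- Under these constraints a set is determined by whether it contains α₁ and α₂.
    have key : ∀ T : Set Root, (∀ γ, Sum.inr γ ∈ T ↔ Sum.inl γ ∉ T) →
        (Sum.inl PosRoot.a12 ∈ T ↔ Sum.inl PosRoot.a1 ∈ T) →
        (Sum.inl PosRoot.a1 ∈ S ↔ Sum.inl PosRoot.a1 ∈ T) →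
        (Sum.inl PosRoot.a2 ∈ S ↔ Sum.inl PosRoot.a2 ∈ T) → S = T := by
      intro T t1 t2 t3 t4
      ext γ
      rcases γ with γ | γ <;> cases γ <;> simp only [hswap, t1, h12, t2, t3, t4]
    have kc : ∀ T : Set Root, (∀ γ, Sum.inr γ ∈ T ↔ Sum.inl γ ∉ T) →
        ∀ γ, Sum.inr γ ∈ Tᶜ ↔ Sum.inl γ ∉ Tᶜ := fun T hT γ => not_congr (hT γ)
    have kp : ∀ γ, Sum.inr γ ∈ rootsPos ↔ Sum.inl γ ∉ rootsPos := by
      intro γ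
      cases γ <;> simp [rootsPos]
    have km : ∀ γ, Sum.inr γ ∈ rootsMixed ↔ Sum.inl γ ∉ rootsMixed := by
      intro γ
      cases γ <;> simp [rootsMixed]
    by_cases e1 : Sum.inl PosRoot.a1 ∈ S <;> by_cases e2 : Sum.inl PosRoot.a2 ∈ S
    · exact .inl (key _ kp (by simp [rootsPos]) (by simp [rootsPos, e1]) (by simp [rootsPos, e2]))
    · exact .inr (.inr (.inl (key _ km (by simp [rootsMixed]) (by simp [rootsMixed, e1])
        (by simp [rootsMixed, e2]))))
    · exact .inr (.inr (.inr (key _ (kc _ km) (by simp [rootsMixed]) (by simp [rootsMixed, e1])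
        (by simp [rootsMixed, e2]))))
    · exact .inr (.inl (key _ (kc _ kp) (by simp [rootsPos]) (by simp [rootsPos, e1])
        (by simp [rootsPos, e2])))
  · rintro (rfl | rfl | rfl | rfl)
    all_goals
      refine ⟨⟨by simp [rootsPos, rootsMixed], by simp [rootsPos, rootsMixed]⟩, ?_⟩
      ext γ
      rcases γ with γ | γ <;> cases γ <;> simp [rootsPos, rootsMixed]

end Oq
end

/-! ### The main theorem -/

theorem mainTheorem7 (q : DefParam) :
    (∃! σ : Oq.FormsB q →ₛₗ[starRingEnd ℂ] Oq.FormsB q, Oq.IsFormStar σ) ∧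
    Function.Bijective (Oq.cotMap q) ∧
    ∀ σ : Oq.FormsB q →ₛₗ[starRingEnd ℂ] Oq.FormsB q, Oq.IsFormStar σ →
      ∃ S₁ S₂ : Submodule ℂ (Oq.FormsB q) × Submodule ℂ (Oq.FormsB q),
        (Oq.cotSub S₁.1 = Submodule.span ℂ {Oq.cotE .a1, Oq.cotE .a2, Oq.cotE .a12} ∧
          Oq.cotSub S₁.2 = Submodule.span ℂ {Oq.cotF .a1, Oq.cotF .a2, Oq.cotF .a12}) ∧
        (Oq.cotSub S₂.1 = Submodule.span ℂ {Oq.cotE .a1, Oq.cotF .a2, Oq.cotE .a12} ∧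
          Oq.cotSub S₂.2 = Submodule.span ℂ {Oq.cotF .a1, Oq.cotE .a2, Oq.cotF .a12}) ∧
        {P | Oq.IsCovariantFoacs σ P} = {S₁, S₁.swap, S₂, S₂.swap} ∧
        {P | Oq.IsCovariantFoacs σ P}.ncard = 4 ∧
        ((fun P => s(P.1, P.2)) '' {P | Oq.IsCovariantFoacs σ P}).ncard = 2 := by
  refine ⟨⟨_, Oq.isFormStar_formStar, fun σ hσ => hσ.unique Oq.isFormStar_formStar⟩,
    Oq.cotMap_bijective, fun σ hσ => ?_⟩
  -- By uniqueness every *-structure is the constructed one, to which the classification applies.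
  obtain rfl := hσ.unique Oq.isFormStar_formStar
  have hset : {P | Oq.IsCovariantFoacs (Oq.formStar q) P} =
      {(Oq.coordForms q Oq.rootsPos, Oq.coordForms q Oq.rootsPosᶜ),
        (Oq.coordForms q Oq.rootsPosᶜ, Oq.coordForms q Oq.rootsPos),
        (Oq.coordForms q Oq.rootsMixed, Oq.coordForms q Oq.rootsMixedᶜ),
        (Oq.coordForms q Oq.rootsMixedᶜ, Oq.coordForms q Oq.rootsMixed)} := by
    ext P
    simp only [Set.mem_ofPred_eq, Oq.isCovariantFoacs_iff, ← and_assoc, Oq.isClosedSet_and_iff,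
      Set.mem_insert_iff, Set.mem_singleton_iff]
    constructor
    · rintro ⟨S, rfl | rfl | rfl | rfl, rfl⟩ <;> simp
    · rintro (rfl | rfl | rfl | rfl)
      · exact ⟨_, .inl rfl, rfl⟩
      · exact ⟨_, .inr (.inl rfl), by rw [compl_compl]⟩
      · exact ⟨_, .inr (.inr (.inl rfl)), rfl⟩
      · exact ⟨_, .inr (.inr (.inr rfl)), by rw [compl_compl]⟩
  have hne : ∀ {S T : Set Root} (γ : Root), ¬(γ ∈ S ↔ γ ∈ T) →
      Oq.coordForms q S ≠ Oq.coordForms q T := fun γ h he =>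
    h (by rw [Oq.coordForms_injective he])
  have h1 : Oq.coordForms q Oq.rootsPos ≠ Oq.coordForms q Oq.rootsPosᶜ :=
    hne (.inl .a1) (by simp)
  have h2 : Oq.coordForms q Oq.rootsMixed ≠ Oq.coordForms q Oq.rootsMixedᶜ :=
    hne (.inl .a1) (by simp)
  have h3 : Oq.coordForms q Oq.rootsPos ≠ Oq.coordForms q Oq.rootsMixed :=
    hne (.inl .a2) (by simp [Oq.rootsPos, Oq.rootsMixed])
  have h4 : Oq.coordForms q Oq.rootsPos ≠ Oq.coordForms q Oq.rootsMixedᶜ :=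
    hne (.inl .a1) (by simp [Oq.rootsPos, Oq.rootsMixed])
  have h5 : Oq.coordForms q Oq.rootsPosᶜ ≠ Oq.coordForms q Oq.rootsMixed :=
    hne (.inl .a1) (by simp [Oq.rootsPos, Oq.rootsMixed])
  have h6 : Oq.coordForms q Oq.rootsPosᶜ ≠ Oq.coordForms q Oq.rootsMixedᶜ :=
    hne (.inl .a2) (by simp [Oq.rootsPos, Oq.rootsMixed])
  refine ⟨(Oq.coordForms q Oq.rootsPos, Oq.coordForms q Oq.rootsPosᶜ),
    (Oq.coordForms q Oq.rootsMixed, Oq.coordForms q Oq.rootsMixedᶜ),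
    ⟨?_, ?_⟩, ⟨?_, ?_⟩, hset, ?_, ?_⟩
  · rw [Oq.cotSub_coordForms, Oq.rootsPos, Set.image_insert_eq, Set.image_insert_eq,
      Set.image_singleton]
    rfl
  · rw [Oq.cotSub_coordForms, Oq.compl_rootsPos, Set.image_insert_eq, Set.image_insert_eq,
      Set.image_singleton]
    rfl
  · rw [Oq.cotSub_coordForms, Oq.rootsMixed, Set.image_insert_eq, Set.image_insert_eq,
      Set.image_singleton]
    rfl
  · rw [Oq.cotSub_coordForms, Oq.compl_rootsMixed, Set.image_insert_eq, Set.image_insert_eq,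
      Set.image_singleton]
    rfl
  · rw [hset, Set.ncard_insert_of_notMem, Set.ncard_insert_of_notMem, Set.ncard_pair]
    all_goals
      simp [h1, h2, h3, h4, h5, h6, h1.symm, h2.symm]
  -- Opposite structures have the same unordered pair of summands, so the four ordered pairs
  -- collapse to two.
  · rw [hset, Set.image_insert_eq, Set.image_insert_eq, Set.image_pair, Sym2.eq_swap,
      Set.insert_eq_of_mem (Set.mem_insert _ _)]
    rw [Sym2.eq_swap (a := Oq.coordForms q Oq.rootsMixedᶜ), Set.pair_eq_singleton, Set.ncard_pair]
    simp [h3, h4]
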